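/- Let $\Omega\subseteq\mathbb R^N$ be open and, for $r\ge 0$, let $dm_r=(1+m^r)\,dm$ on $\mathbb R_+=[0,\infty)$ and $\mathcal X^1_r=L_1(\mathbb R_+,L_1(\Omega,dx),dm_r)=L_1(\Omega\times\mathbb R_+,dx\,dm_r)$, with the norm $\|u\|_{\mathcal X^1_r}=\int_0^\infty\!\int_\Omega|u(x,m)|\,dx\,(1+m^r)\,dm$. A $C_0$-semigroup is called substochastic if it is nonnegative and contractive. **Fragmentation rate.** Let $0\le a\in L_{\infty,loc}(\Omega\times\mathbb R_+)$, $\alpha_1,\alpha_2\in L_{\infty,loc}(\mathbb R_+)$ and $0<M<\infty$ with $\alpha_1(m)\le a(x,m)\le\alpha_2(m)\le M\alpha_1(m)$ for a.e. $(x,m)$, and suppose there are $a_0>0$, $\gamma>0$, $m_0\ge1$ with $\alpha_1(m)\ge a_0m^\gamma$ for a.e. $m\ge m_0$. **Fragmentation kernel.** Let $b\ge0$ be measurable on $\Omega\times\mathbb R_+\times\mathbb R_+$ with $b(x,m,s)=0$ for $m>s$, and put $n_k(x,s)=\int_0^s b(x,m,s)m^k\,dm$ for $k\ge 0$. Suppose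 that for a.e. $(x,s)$ one has $n_1(x,s)=s$ and $n_0(x,s)\le b_0(1+s^l)$, with constants $b_0\ge1$, $l\ge0$. **Assumptions for one exponent.** Suppose that for some $\rho>\max\{1,l\}$: 1. there are $c_\rho<1$ and $s_\rho>0$ with $n_\rho(x,s)\le c_\rho s^\rho$ for a.e. $(x,s)$ with $s\ge s_\rho$; 2. $(T_{0,m})_{m\in\mathbb R_+}$ is a family of linear operators in $L_1(\Omega)$ such that for a.e. $m$ the operator $T_{0,m}$ generates a substochastic semigroup $(G_{T_{0,m}}(t))_{t\ge0}$ in $L_1(\Omega)$; and the operator $[\mathbf T_0u](\cdot,m)=T_{0,m}u(\cdot,m)$, with domain $D(\mathbf T_0)=\{u\in\mathcal X^1_\rho:\ u(\cdot,m)\in D(T_{0,m})\text{ for a.e. }m,\ \mathbf T_0u\in\mathcal X^1_\rho\}$, generates a substochastic semigroup in $\mathcal X^1_\rho$ given by $[G_{\mathbf T_0}(t)u](\cdot,m)=G_{T_{0,m}}(t)u(\cdot,m)$ for a.e. $m$. **Conclusion.** Let $\max\{1,l\}<n<p<r$. Then the transport–fragmentation operator $$[\mathbf Ku](x,m)=[\mathbf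 T_0u](x,m)-a(x,m)u(x,m)+\int_m^\infty b(x,m,s)a(x,s)u(x,s)\,ds$$ with domain $\{u\in\mathcal X^1_p:\ u(\cdot,m)\in D(T_{0,m})\text{ for a.e. }m,\ \mathbf T_0u\in\mathcal X^1_p,\ au\in\mathcal X^1_p\}$ generates a positive $C_0$-semigroup $(G_{\mathbf K}(t))_{t\ge0}$ on $\mathcal X^1_p$, and there are constants $C>0$ and $\theta>0$ such that, for all $t>0$ and all $u\in\mathcal X^1_p$, $G_{\mathbf K}(t)u\in\mathcal X^1_r$ and $$\|G_{\mathbf K}(t)u\|_{\mathcal X^1_r}\le C e^{\theta t}\,t^{\frac{n-r}{\gamma}}\,\|u\|_{\mathcal X^1_p}.$$ -/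

import Mathlib

open MeasureTheory Set Filter Topology
open scoped NNReal ENNReal

noncomputable section

namespace TransportFragmentation

/-! ### Strongly continuous semigroups -/

/-- A `C₀`-semigroup of bounded linear operators on a real normed space `X`. -/
structure C0Semigroup (X : Type*) [NormedAddCommGroup X] [NormedSpace ℝ X] where
  /-- the operators of the semigroup -/
  op : ℝ≥0 → X →L[ℝ] X
  op_zero : op 0 = ContinuousLinearMap.id ℝ X
  op_add : ∀ s t, op (s + t) = (op s).comp (op t)
  tendsto_zero : ∀ u, Tendsto (fun t => op t u) (𝓝 0) (𝓝 u)

/-- The (possibly unbounded) operator with graph `R` is the infinitesimal generator of `S`: `R u f`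
holds if and only if `(S(t)u - u)/t` converges to `f` as `t → 0⁺`. In particular the domain of the
operator is exactly the set of `u` for which the limit exists. -/
def Generates {X : Type*} [NormedAddCommGroup X] [NormedSpace ℝ X]
    (R : X → X → Prop) (S : C0Semigroup X) : Prop :=
  ∀ u f, R u f ↔
    Tendsto (fun t : ℝ≥0 => (t : ℝ)⁻¹ • (S.op t u - u)) (𝓝[>] 0) (𝓝 f)

/-- A semigroup on `L₁(μ)` is substochastic if it is nonnegative and contractive. -/
def Substochastic {α : Type*} [MeasurableSpace α] {μ : Measure α}
    (S : C0Semigroup (Lp ℝ 1 μ)) : Prop :=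
  ∀ t, (∀ u, 0 ≤ u → 0 ≤ S.op t u) ∧ ‖S.op t‖ ≤ 1

/-! ### The spaces -/

/-- Lebesgue measure `dx` on `Ω ⊆ ℝᴺ`. -/
abbrev spaceMeasure {N : ℕ} (Ω : Set (EuclideanSpace ℝ (Fin N))) :
    Measure (EuclideanSpace ℝ (Fin N)) :=
  volume.restrict Ω

/-- Lebesgue measure `dm` on `[0, ∞)`. -/
abbrev sizeMeasure : Measure ℝ := volume.restrict (Ici 0)

/-- The measure `dm_r = (1 + m ^ r) dm` on `[0, ∞)`. -/
def weightedSizeMeasure (r : ℝ) : Measure ℝ :=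
  sizeMeasure.withDensity fun m => ENNReal.ofReal (1 + m ^ r)

/-- The space `L₁(Ω, dx)`. -/
abbrev SpaceL1 {N : ℕ} (Ω : Set (EuclideanSpace ℝ (Fin N))) : Type :=
  Lp ℝ 1 (spaceMeasure Ω)

/-- The measure `dx dm_r` on `Ω × [0, ∞)`. -/
def stateMeasure {N : ℕ} (Ω : Set (EuclideanSpace ℝ (Fin N))) (r : ℝ) :
    Measure (EuclideanSpace ℝ (Fin N) × ℝ) :=
  (spaceMeasure Ω).prod (weightedSizeMeasure r)

/-- The space `L₁(Ω × [0, ∞), dx dm_r)`, that is, `L₁([0, ∞), L₁(Ω, dx), dm_r)`, with its norm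
`∫∫ |u(x, m)| dx (1 + m ^ r) dm`. -/
abbrev StateSpace {N : ℕ} (Ω : Set (EuclideanSpace ℝ (Fin N))) (r : ℝ) : Type :=
  Lp ℝ 1 (stateMeasure Ω r)

/-- `v ∈ L₁(Ω)` is the section `u(·, m)` of the function `u` on `Ω × [0, ∞)`. -/
def IsSection {N : ℕ} {Ω : Set (EuclideanSpace ℝ (Fin N))}
    (u : EuclideanSpace ℝ (Fin N) × ℝ → ℝ) (m : ℝ) (v : SpaceL1 Ω) : Prop :=
  v =ᵐ[spaceMeasure Ω] fun x => u (x, m)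

/-- `f ∈ L_{∞,loc}(S)`: `f` is essentially bounded (and measurable) on each compact subset
of `S`. -/
def MemLinftyLoc {α : Type*} [TopologicalSpace α] [MeasureSpace α] (f : α → ℝ) (S : Set α) :
    Prop :=
  ∀ K ⊆ S, IsCompact K → MemLp f ∞ (volume.restrict K)

/-! ### The transport operator -/

/-- The graph of the operator `𝐓₀` in `StateSpace Ω r` assembled from the operators `T₀ m` in
`L₁(Ω)`: for almost every `m` the section `u(·, m)` is in the domain of `T₀ m`, and the function
`f : (x, m) ↦ [T₀ m u(·, m)](x)` belongs to `StateSpace Ω r`. -/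
def TransportGraph {N : ℕ} {Ω : Set (EuclideanSpace ℝ (Fin N))}
    (T₀ : ℝ → SpaceL1 Ω →ₗ.[ℝ] SpaceL1 Ω) (r : ℝ) (u f : StateSpace Ω r) : Prop :=
  ∀ᵐ m ∂sizeMeasure, ∃ v : (T₀ m).domain, IsSection u m v.1 ∧ IsSection f m (T₀ m v)

/-- The assumption on the transport part: for almost every `m` the operator `T₀ m` generates a
substochastic semigroup `G m` in `L₁(Ω)`, and `𝐓₀` generates a substochastic semigroup `S` in
`StateSpace Ω r`, which acts by `[S(t)u](·, m) = G m (t) u(·, m)` for almost every `m`. -/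
def TransportAssumption {N : ℕ} (Ω : Set (EuclideanSpace ℝ (Fin N)))
    (T₀ : ℝ → SpaceL1 Ω →ₗ.[ℝ] SpaceL1 Ω) (r : ℝ) : Prop :=
  ∃ G : ℝ → C0Semigroup (SpaceL1 Ω),
    (∀ᵐ m ∂sizeMeasure,
      Generates (fun v w => (v, w) ∈ (T₀ m).graph) (G m) ∧ Substochastic (G m)) ∧
    ∃ S : C0Semigroup (StateSpace Ω r),
      Generates (TransportGraph T₀ r) S ∧ Substochastic S ∧
      ∀ (t : ℝ≥0) (u : StateSpace Ω r), ∀ᵐ m ∂sizeMeasure,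
        ∃ v : SpaceL1 Ω, IsSection u m v ∧ IsSection (S.op t u) m ((G m).op t v)

/-! ### Loss and gain -/

/-- The assumptions on the fragmentation rate: `0 ≤ a ∈ L_{∞,loc}(Ω × [0, ∞))` and
`α₁(m) ≤ a(x, m) ≤ α₂(m) ≤ M α₁(m)` with `α₁, α₂ ∈ L_{∞,loc}([0, ∞))` and `0 < M < ∞`. -/
structure RateAssumption {N : ℕ} (Ω : Set (EuclideanSpace ℝ (Fin N)))
    (a : EuclideanSpace ℝ (Fin N) → ℝ → ℝ) (α₁ α₂ : ℝ → ℝ) (M : ℝ) : Prop where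
  nonneg : ∀ᵐ z ∂(spaceMeasure Ω).prod sizeMeasure, 0 ≤ a z.1 z.2
  rate_loc : MemLinftyLoc (Function.uncurry a) (Ω ×ˢ Ici 0)
  lower_loc : MemLinftyLoc α₁ (Ici 0)
  upper_loc : MemLinftyLoc α₂ (Ici 0)
  M_pos : 0 < M
  lower_le : ∀ᵐ z ∂(spaceMeasure Ω).prod sizeMeasure, α₁ z.2 ≤ a z.1 z.2
  le_upper : ∀ᵐ z ∂(spaceMeasure Ω).prod sizeMeasure, a z.1 z.2 ≤ α₂ z.2
  upper_le : ∀ᵐ m ∂sizeMeasure, α₂ m ≤ M * α₁ m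

/-- The `r`th moment `n_r(x, s) = ∫₀ˢ b(x, m, s) m ^ r dm` of the fragmentation kernel. -/
def kernelMoment {N : ℕ} (b : EuclideanSpace ℝ (Fin N) → ℝ → ℝ → ℝ) (r : ℝ)
    (x : EuclideanSpace ℝ (Fin N)) (s : ℝ) : ℝ≥0∞ :=
  ∫⁻ m in Icc 0 s, ENNReal.ofReal (b x m s * m ^ r)

/-- The assumptions on the fragmentation kernel `b(x, m, s)` (daughter size `m`, parent size `s`):
it is measurable, nonnegative, vanishes for `m > s`, conserves mass, and satisfies
`n₀(x, s) ≤ b₀ (1 + s ^ l)`. -/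
structure KernelAssumption {N : ℕ} (Ω : Set (EuclideanSpace ℝ (Fin N)))
    (b : EuclideanSpace ℝ (Fin N) → ℝ → ℝ → ℝ) (b₀ l : ℝ) : Prop where
  measurable : AEMeasurable (fun y : EuclideanSpace ℝ (Fin N) × ℝ × ℝ => b y.1 y.2.1 y.2.2)
    ((spaceMeasure Ω).prod (sizeMeasure.prod sizeMeasure))
  nonneg : ∀ x ∈ Ω, ∀ m, 0 ≤ m → ∀ s, 0 ≤ s → 0 ≤ b x m s
  eq_zero : ∀ x ∈ Ω, ∀ m s, 0 ≤ s → s < m → b x m s = 0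
  mass : ∀ᵐ z ∂(spaceMeasure Ω).prod sizeMeasure, kernelMoment b 1 z.1 z.2 = ENNReal.ofReal z.2
  one_le : 1 ≤ b₀
  l_nonneg : 0 ≤ l
  number_le : ∀ᵐ z ∂(spaceMeasure Ω).prod sizeMeasure,
    kernelMoment b 0 z.1 z.2 ≤ ENNReal.ofReal (b₀ * (1 + z.2 ^ l))

/-- There are `c_r < 1` and `s_r > 0` such that `n_r(x, s) ≤ c_r s ^ r` for `s ≥ s_r`. -/
def MomentAssumption {N : ℕ} (Ω : Set (EuclideanSpace ℝ (Fin N)))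
    (b : EuclideanSpace ℝ (Fin N) → ℝ → ℝ → ℝ) (r : ℝ) : Prop :=
  ∃ c < 1, ∃ s₀ > 0, ∀ᵐ z ∂(spaceMeasure Ω).prod sizeMeasure, s₀ ≤ z.2 →
    kernelMoment b r z.1 z.2 ≤ ENNReal.ofReal (c * z.2 ^ r)

/-- The graph of the transport–fragmentation operator `𝐊 = 𝐓₀ + 𝐀 + 𝐁` in `StateSpace Ω r` on the
domain `D(𝐓₀) ∩ D(𝐀)`, where `D(𝐀)` consists of the `u` with `a u` in `StateSpace Ω r`, and
`[𝐀u](x, m) = -a(x, m) u(x, m)`, `[𝐁u](x, m) = ∫ₘ^∞ b(x, m, s) a(x, s) u(x, s) ds`. -/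
def TransportFragmentationGraph {N : ℕ} {Ω : Set (EuclideanSpace ℝ (Fin N))}
    (T₀ : ℝ → SpaceL1 Ω →ₗ.[ℝ] SpaceL1 Ω) (a : EuclideanSpace ℝ (Fin N) → ℝ → ℝ)
    (b : EuclideanSpace ℝ (Fin N) → ℝ → ℝ → ℝ) (r : ℝ) (u f : StateSpace Ω r) : Prop :=
  ∃ g : StateSpace Ω r, TransportGraph T₀ r u g ∧
    MemLp (fun z => a z.1 z.2 * u z) 1 (stateMeasure Ω r) ∧
    f =ᵐ[stateMeasure Ω r] fun z =>
      g z - a z.1 z.2 * u z + ∫ s in Ioi z.2, b z.1 z.2 s * a z.1 s * u (z.1, s)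

end TransportFragmentation

end

/-! On nonnegative states the norm of $\mathcal X^1_q$ is a linear functional, so the whole argument
is a balance of loss against gain. By Tonelli, integrating the gain against $1+m^q$ replaces the
kernel by $n_0+n_q$. The moment condition at $\rho$ passes to every exponent $q>1$: mass
conservation $n_1=s$ allows interpolation between $1$ and $\rho$, and $m^{q-\rho}\le s^{q-\rho}$
covers $q\ge\rho$. For $q>\max\{1,l\}$ the moment $n_0$ is of lower order, so $n_0+n_q\le c(1+s^q)$
with $c<1$ for large $s$, while $a$ is bounded on small sizes. Hence
$\|B(au)\|\le(1-\delta)\|au\|+\omega\|u\|$ for $u\ge0$, with $\delta>0$ (`lossGainAssumption`).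
Transport acts separately at each size, so it commutes with multiplication by functions of $m$ and
is substochastic in every $\mathcal X^1_q$ as soon as it is so in $\mathcal X^1_\rho$.

Generation: integrating $(\lambda-\mathbf K)u$ over $\{u>0\}$ and over $\{u<0\}$ gives
$(\lambda-\omega)\|u\|+\delta\|au\|\le\|(\lambda-\mathbf K)u\|$ (`LossGainAssumption.norm_le`) and
positivity of the resolvent. Fragments are smaller than their parents, so $\{m<k\}$ is invariant
under the gain, and $a$ is bounded there; data supported in it are treated by a Neumann series. As
$k\to\infty$ the estimate makes $u_k$ and also $au_k$ converge, so the limit lies in $D(\mathbf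
T_0)\cap D(a)$ and no closure of $\mathbf K$ is needed. The Hille–Yosida theorem
(`QuasiMDissipative.exists_semigroup`) then yields the semigroup.

Smoothing: for $u\ge0$ in the domain in $\mathcal X^1_r$ put $v=G(t)u$ and $\varphi=\|v\|_r$. The
balance reads $\varphi'\le\omega\varphi-\delta\|av\|_r$. With $\beta=(r-n)/\gamma$ and
$\varepsilon=(p-n)/\gamma$, the term $\beta t^{\beta-1}\varphi$ in the derivative of
$t^\beta\varphi$ is absorbed by the loss where $tm^\gamma$ is large, and is at most a multiple of
$t^{\varepsilon-1}\|v\|_p$ elsewhere (`exists_weight_le`). Since $\varepsilon>0$, this is integrable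
at $0$ and $t^\beta\varphi$ is bounded by a multiple of $\|u\|_p$ for $t\le1$
(`rpow_mul_le_of_deriv_le`, `LossGainAssumption.rpow_mul_norm_op_le`). Density of $\mathcal X^1_r$
in $\mathcal X^1_p$ gives all $u$, and the semigroup law gives $t>1$. -/

noncomputable section

namespace TransportFragmentation

/-! ### Orbits and generators of strongly continuous semigroups -/

namespace C0Semigroup

variable {X : Type*} [NormedAddCommGroup X] [NormedSpace ℝ X]

theorem op_zero_apply (S : C0Semigroup X) (u : X) : S.op 0 u = u := by
  simp [S.op_zero]

theorem op_add_apply (S : C0Semigroup X) (s t : ℝ≥0) (u : X) :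
    S.op (s + t) u = S.op s (S.op t u) := by
  simp [S.op_add]

/-- A `C₀`-semigroup is bounded near `0`. -/
theorem exists_bound_near_zero [CompleteSpace X] (S : C0Semigroup X) :
    ∃ δ > 0, ∃ M : ℝ, ∀ t ≤ δ, ‖S.op t‖ ≤ M := by
  by_contra! h
  have hn : ∀ n : ℕ, ∃ t : ℝ≥0, t ≤ (n + 1 : ℝ≥0)⁻¹ ∧ (n : ℝ) < ‖S.op t‖ := fun n =>
    h _ (by positivity) n
  choose t ht hnt using hn
  have hlim : Tendsto t atTop (𝓝 0) := by
    refine tendsto_of_tendsto_of_tendsto_of_le_of_le tendsto_const_nhds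
      ?_ (fun n => zero_le) ht
    have := tendsto_one_div_add_atTop_nhds_zero_nat (𝕜 := ℝ≥0)
    simpa using this
  obtain ⟨C, hC⟩ := banach_steinhaus (g := fun n => S.op (t n)) fun x => by
    have := (S.tendsto_zero x).comp hlim
    obtain ⟨C, hC⟩ := (this.norm).bddAbove_range
    exact ⟨C, fun i => hC ⟨i, rfl⟩⟩
  obtain ⟨n, hn⟩ := exists_nat_gt C
  exact absurd ((hnt n).trans_le (hC n)) (not_lt.2 hn.le)

/-- A `C₀`-semigroup is bounded on bounded time intervals. -/
theorem exists_bound [CompleteSpace X] (S : C0Semigroup X) (T : ℝ≥0) :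
    ∃ M : ℝ, 0 ≤ M ∧ ∀ t ≤ T, ‖S.op t‖ ≤ M := by
  obtain ⟨δ, hδ, M, hM⟩ := S.exists_bound_near_zero
  have key : ∀ n : ℕ, ∃ C : ℝ, 0 ≤ C ∧ ∀ t ≤ n * δ, ‖S.op t‖ ≤ C := by
    intro n
    induction n with
    | zero => exact ⟨‖S.op 0‖, norm_nonneg _, fun t ht => by
        have : t = 0 := by simpa using ht
        rw [this]⟩
    | succ n ih =>
      obtain ⟨C, hC0, hC⟩ := ih
      have hM0 : 0 ≤ M := (norm_nonneg _).trans (hM 0 zero_le)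
      refine ⟨max M (M * C), le_max_of_le_left hM0, fun t ht => ?_⟩
      rcases le_total t δ with h | h
      · exact (hM t h).trans (le_max_left _ _)
      · have h1 : t = δ + (t - δ) := (add_tsub_cancel_of_le h).symm
        have h2 : t - δ ≤ n * δ := by
          rw [tsub_le_iff_right]
          push_cast at ht
          linarith
        rw [h1, S.op_add]
        refine (ContinuousLinearMap.opNorm_comp_le _ _).trans (le_trans ?_ (le_max_right _ _))
        exact mul_le_mul (hM _ le_rfl) (hC _ h2) (norm_nonneg _) hM0
  obtain ⟨n, hn⟩ := exists_nat_ge (T / δ)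
  obtain ⟨C, hC0, hC⟩ := key n
  refine ⟨C, hC0, fun t ht => hC t (ht.trans ?_)⟩
  rwa [div_le_iff₀ hδ] at hn

/-- The orbit `t ↦ S(t) u`, extended to negative times by `u`. -/
def orbit (S : C0Semigroup X) (u : X) (t : ℝ) : X := S.op t.toNNReal u

theorem orbit_zero (S : C0Semigroup X) (u : X) : S.orbit u 0 = u := by
  simp [orbit, S.op_zero_apply]

theorem orbit_coe (S : C0Semigroup X) (u : X) (t : ℝ≥0) : S.orbit u t = S.op t u := by
  simp [orbit]

theorem orbit_add (S : C0Semigroup X) (u : X) {s t : ℝ} (hs : 0 ≤ s) (ht : 0 ≤ t) :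
    S.orbit u (s + t) = S.op s.toNNReal (S.orbit u t) := by
  simp [orbit, Real.toNNReal_add hs ht, S.op_add_apply]

/-- Two-sided continuity follows from continuity at time $0$: the smaller of the two times is
factored out, and its operator is bounded locally uniformly in time. -/
theorem continuous_op_apply [CompleteSpace X] (S : C0Semigroup X) (u : X) :
    Continuous fun t => S.op t u := by
  rw [continuous_iff_continuousAt]
  intro t
  obtain ⟨M, hM0, hM⟩ := S.exists_bound (t + 1)
  -- With truncated subtraction, `s - t + (t - s)` is $|s-t|$, so one estimate serves both orders of
  -- $s$ and $t$.
  have key : ∀ s : ℝ≥0, s ≤ t + 1 → ‖S.op s u - S.op t u‖ ≤ M * ‖S.op (s - t + (t - s)) u - u‖ := by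
    intro s hs
    rcases le_total s t with h | h
    · have h1 : s - t + (t - s) = t - s := by simp [tsub_eq_zero_of_le h]
      have h2 : S.op t u = S.op s (S.op (t - s) u) := by
        rw [← S.op_add_apply, add_tsub_cancel_of_le h]
      rw [h1, h2, norm_sub_rev, ← map_sub]
      exact (S.op s).le_of_opNorm_le (hM s hs) _
    · have h1 : s - t + (t - s) = s - t := by simp [tsub_eq_zero_of_le h]
      have h2 : S.op s u = S.op t (S.op (s - t) u) := by
        rw [← S.op_add_apply, add_tsub_cancel_of_le h]
      rw [h1, h2, ← map_sub]
      exact (S.op t).le_of_opNorm_le (hM t (by simp)) _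
  have hlim : Tendsto (fun s : ℝ≥0 => s - t + (t - s)) (𝓝 t) (𝓝 0) := by
    have : Continuous fun s : ℝ≥0 => s - t + (t - s) := by fun_prop
    simpa using this.tendsto t
  have h3 : Tendsto (fun s => M * ‖S.op (s - t + (t - s)) u - u‖) (𝓝 t) (𝓝 0) := by
    have := (((S.tendsto_zero u).comp hlim).sub_const u).norm.const_mul M
    simpa using this
  refine tendsto_iff_norm_sub_tendsto_zero.2 (squeeze_zero' (Eventually.of_forall fun _ =>
    norm_nonneg _) ?_ h3)
  filter_upwards [Iio_mem_nhds (show t < t + 1 by simp)] with s hs using key s hs.le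

theorem continuous_orbit [CompleteSpace X] (S : C0Semigroup X) (u : X) :
    Continuous (S.orbit u) :=
  (S.continuous_op_apply u).comp continuous_real_toNNReal

/-- Joint continuity of a `C₀`-semigroup in time and state. -/
theorem continuous_op_apply₂ [CompleteSpace X] (S : C0Semigroup X) :
    Continuous fun y : ℝ≥0 × X => S.op y.1 y.2 := by
  rw [continuous_iff_continuousAt]
  rintro ⟨t, u⟩
  obtain ⟨M, hM0, hM⟩ := S.exists_bound (t + 1)
  have h1 : Tendsto (fun y : ℝ≥0 × X => S.op y.1 u) (𝓝 (t, u)) (𝓝 (S.op t u)) :=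
    ((S.continuous_op_apply u).tendsto t).comp continuous_fst.continuousAt
  have h2 : Tendsto (fun y : ℝ≥0 × X => S.op y.1 (y.2 - u)) (𝓝 (t, u)) (𝓝 0) := by
    have h3 : Tendsto (fun y : ℝ≥0 × X => M * ‖y.2 - u‖) (𝓝 (t, u)) (𝓝 0) := by
      have : Continuous fun y : ℝ≥0 × X => M * ‖y.2 - u‖ := by fun_prop
      simpa using this.tendsto (t, u)
    refine squeeze_zero_norm' ?_ h3
    have : ∀ᶠ y : ℝ≥0 × X in 𝓝 (t, u), y.1 < t + 1 :=
      (continuous_fst.tendsto (t, u)).eventually (Iio_mem_nhds (show t < t + 1 by simp))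
    filter_upwards [this] with y hy
    exact (S.op y.1).le_of_opNorm_le (hM _ hy.le) _
  have := h1.add h2
  simp only [map_sub, add_sub_cancel, add_zero] at this
  exact this

/-- Membership in the generator is right differentiability of the orbit at time `0`. -/
theorem tendsto_iff_hasDerivWithinAt (S : C0Semigroup X) (u f : X) :
    Tendsto (fun t : ℝ≥0 => (t : ℝ)⁻¹ • (S.op t u - u)) (𝓝[>] 0) (𝓝 f) ↔
      HasDerivWithinAt (S.orbit u) f (Ici 0) 0 := by
  rw [hasDerivWithinAt_iff_tendsto_slope, Ici_sdiff_left]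
  have hmap : map ((↑) : ℝ≥0 → ℝ) (𝓝[>] 0) = 𝓝[>] 0 := by
    have h1 : Topology.IsEmbedding ((↑) : ℝ≥0 → ℝ) := NNReal.isEmbedding_coe
    have := h1.map_nhdsWithin_eq (Ioi 0) 0
    rw [this]
    congr 1
    ext x
    constructor
    · rintro ⟨y, hy, rfl⟩
      exact hy
    · intro hx
      exact ⟨⟨x, le_of_lt hx⟩, hx, rfl⟩
  rw [← hmap, tendsto_map'_iff]
  have e : (fun t : ℝ≥0 => (t : ℝ)⁻¹ • (S.op t u - u)) = slope (S.orbit u) 0 ∘ NNReal.toReal := by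
    funext t
    simp [slope, orbit_coe, orbit_zero]
  rw [e]

/-- To the right of $x$ the orbit is the bounded operator $S(x)$ applied to the orbit started at
time $0$, so differentiability at $0$ is transported to $x$. -/
theorem hasDerivWithinAt_orbit (S : C0Semigroup X) {u f : X}
    (h : HasDerivWithinAt (S.orbit u) f (Ici 0) 0) {x : ℝ} (hx : 0 ≤ x) :
    HasDerivWithinAt (S.orbit u) (S.orbit f x) (Ici x) x := by
  have h1 : HasDerivWithinAt (fun y : ℝ => S.orbit u (y - x)) f (Ici x) x := by
    have h2 : HasDerivWithinAt (fun y : ℝ => y - x) 1 (Ici x) x :=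
      ((hasDerivAt_id x).sub_const x).hasDerivWithinAt
    have := HasDerivWithinAt.scomp (t' := Ici 0) x (by simpa using h) h2
      (fun y (hy : x ≤ y) => sub_nonneg.2 hy)
    rw [one_smul] at this
    exact this
  have h3 := (S.op x.toNNReal).hasFDerivAt.comp_hasDerivWithinAt x h1
  refine h3.congr (fun y (hy : x ≤ y) => ?_) ?_
  · have := S.orbit_add u hx (sub_nonneg.2 hy)
    simpa using this
  · have := S.orbit_add u hx le_rfl
    simpa using this

variable {R : X → X → Prop} {S : C0Semigroup X}

theorem generates_iff : Generates R S ↔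
    ∀ u f, R u f ↔ HasDerivWithinAt (S.orbit u) f (Ici 0) 0 := by
  simp only [Generates, tendsto_iff_hasDerivWithinAt]

theorem _root_.TransportFragmentation.Generates.hasDerivWithinAt (h : Generates R S) {u f : X}
    (huf : R u f) {x : ℝ} (hx : 0 ≤ x) :
    HasDerivWithinAt (S.orbit u) (S.orbit f x) (Ici x) x :=
  S.hasDerivWithinAt_orbit ((generates_iff.1 h u f).1 huf) hx

theorem _root_.TransportFragmentation.Generates.orbit_mem (h : Generates R S) {u f : X}
    (huf : R u f) {x : ℝ} (hx : 0 ≤ x) : R (S.orbit u x) (S.orbit f x) := by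
  rw [generates_iff.1 h]
  have h1 := h.hasDerivWithinAt huf le_rfl
  rw [S.orbit_zero] at h1
  have h3 := (S.op x.toNNReal).hasFDerivAt.comp_hasDerivWithinAt 0 h1
  refine h3.congr (fun y (hy : 0 ≤ y) => ?_) ?_
  · rw [Function.comp, ← S.orbit_add u hx hy, add_comm, S.orbit_add u hy hx]
    rfl
  · simp [orbit_zero]
    rfl

theorem _root_.TransportFragmentation.Generates.add (h : Generates R S) {u v f g : X}
    (hf : R u f) (hg : R v g) : R (u + v) (f + g) := by
  rw [h] at *
  convert! hf.add hg using 2 with t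
  rw [map_add, ← smul_add]
  congr 1
  abel

theorem _root_.TransportFragmentation.Generates.smul (h : Generates R S) (c : ℝ) {u f : X}
    (hf : R u f) : R (c • u) (c • f) := by
  rw [h] at *
  convert! hf.const_smul c using 2 with t
  rw [map_smul, ← smul_sub, smul_comm]

theorem _root_.TransportFragmentation.Generates.sub (h : Generates R S) {u v f g : X}
    (hf : R u f) (hg : R v g) : R (u - v) (f - g) := by
  have := h.add hf (h.smul (-1) hg)
  simpa [sub_eq_add_neg] using this

/-- A right differentiable solution of the Cauchy problem for the generator is an orbit of the
semigroup. -/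
theorem _root_.TransportFragmentation.Generates.eq_op [CompleteSpace X] (h : Generates R S)
    (T : ℝ≥0) {v : ℝ → X} (hv : ContinuousOn v (Icc 0 T))
    (hv' : ∀ x ∈ Ico (0 : ℝ) T, ∃ f, R (v x) f ∧ HasDerivWithinAt v f (Ici x) x) :
    v T = S.op T (v 0) := by
  obtain ⟨M, hM0, hM⟩ := S.exists_bound T
  -- Running the semigroup for the remaining time: $w(s)=S(T-s)v(s)$ interpolates between $S(T)v(0)$
  -- and $v(T)$, and it suffices that its right derivative vanishes.
  set w : ℝ → X := fun s => S.op (T - s).toNNReal (v s) with hw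
  have hcont : ContinuousOn w (Icc 0 T) := by
    refine S.continuous_op_apply₂.comp_continuousOn (ContinuousOn.prodMk ?_ hv)
    exact (continuous_real_toNNReal.comp (by fun_prop)).continuousOn
  have hder : ∀ x ∈ Ico (0 : ℝ) T, HasDerivWithinAt w 0 (Ici x) x := by
    intro x hx
    obtain ⟨f, hf, hvf⟩ := hv' x hx
    have h1 : HasDerivWithinAt (fun y : ℝ => S.orbit (v x) (y - x)) f (Ici x) x := by
      have h2 : HasDerivWithinAt (fun y : ℝ => y - x) 1 (Ici x) x :=
        ((hasDerivAt_id x).sub_const x).hasDerivWithinAt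
      have h0 := h.hasDerivWithinAt hf le_rfl
      rw [S.orbit_zero] at h0
      have := HasDerivWithinAt.scomp (t' := Ici 0) x (by simpa using h0) h2
        (fun y (hy : x ≤ y) => sub_nonneg.2 hy)
      rw [one_smul] at this
      exact this
    have h2 := hvf.sub h1
    rw [sub_self, hasDerivWithinAt_iff_isLittleO] at h2
    rw [hasDerivWithinAt_iff_isLittleO]
    refine Asymptotics.IsBigO.trans_isLittleO ?_ h2
    refine Asymptotics.IsBigO.of_bound M ?_
    have hxT : ∀ᶠ y : ℝ in 𝓝[≥] x, y < T := mem_nhdsWithin_of_mem_nhds (Iio_mem_nhds hx.2)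
    filter_upwards [hxT, self_mem_nhdsWithin] with y hyT (hy : x ≤ y)
    -- Since $S(T-x)v(x)=S(T-y)S(y-x)v(x)$, the increment of $w$ only sees the difference between
    -- $v$ and the orbit started at $v(x)$. Both have right derivative $f$ at $x$, so it is
    -- $o(y-x)$.
    have e1 : w y - w x = S.op (T - y).toNNReal (v y - S.orbit (v x) (y - x)) := by
      simp only [hw, map_sub]
      have : (T - x : ℝ) = (T - y) + (y - x) := by ring
      rw [this, ← S.orbit_add _ (by linarith) (by linarith)]
      rfl
    rw [smul_zero, sub_zero, e1]
    simp only [sub_self, S.orbit_zero, sub_zero, Pi.sub_apply]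
    refine (S.op _).le_of_opNorm_le (hM _ ?_) _
    rw [Real.toNNReal_le_iff_le_coe]
    linarith [hx.1]
  have := constant_of_has_deriv_right_zero hcont hder T ⟨T.2, le_rfl⟩
  simpa [hw, S.op_zero_apply] using this

/-- The finite time Laplace transform of an orbit lies in the domain of the generator. -/
theorem hasDerivWithinAt_laplace [CompleteSpace X] (S : C0Semigroup X) (μ : ℝ) {h : ℝ}
    (hh : 0 ≤ h) (f : X) :
    HasDerivWithinAt (S.orbit (∫ s in (0 : ℝ)..h, Real.exp (-(μ * s)) • S.orbit f s))
      (μ • (∫ s in (0 : ℝ)..h, Real.exp (-(μ * s)) • S.orbit f s) - f +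
        Real.exp (-(μ * h)) • S.orbit f h) (Ici 0) 0 := by
  set φ : ℝ → X := fun s => Real.exp (-(μ * s)) • S.orbit f s with hφ
  have hc : Continuous φ := by
    have := S.continuous_orbit f
    fun_prop
  set F : ℝ → X := fun t => ∫ s in (0 : ℝ)..t, φ s with hF
  have hFd : ∀ t, HasDerivAt F (φ t) t := fun t =>
    intervalIntegral.integral_hasDerivAt_right (hc.intervalIntegrable _ _)
      (hc.stronglyMeasurableAtFilter _ _) hc.continuousAt
  -- Moving $S(t)$ under the integral and translating the variable gives a difference of primitives
  -- times $e^{\mu t}$. This is differentiable in $t$ although $f$ need not be in the domain.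
  have horb : ∀ t, 0 ≤ t → S.orbit (F h) t = Real.exp (μ * t) • (F (t + h) - F t) := by
    intro t ht
    have e1 : F (t + h) - F t = ∫ s in t..(t + h), φ s :=
      intervalIntegral.integral_interval_sub_left (hc.intervalIntegrable _ _)
        (hc.intervalIntegrable _ _)
    have e2 : (∫ s in t..(t + h), φ s) = ∫ s in (0 : ℝ)..h, φ (s + t) := by
      rw [intervalIntegral.integral_comp_add_right]
      simp [add_comm]
    rw [e1, e2, ← intervalIntegral.integral_smul, orbit, hF,
      ← ContinuousLinearMap.intervalIntegral_comp_comm _ (hc.intervalIntegrable _ _)]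
    refine intervalIntegral.integral_congr fun s hs => ?_
    rw [uIcc_of_le hh] at hs
    simp only [hφ, map_smul]
    rw [← S.orbit_add f ht hs.1, smul_smul, ← Real.exp_add, add_comm t s]
    congr 2
    ring
  have hd : HasDerivAt (fun t : ℝ => Real.exp (μ * t) • (F (t + h) - F t))
      (Real.exp (μ * 0) • (φ (0 + h) - φ 0) + (Real.exp (μ * 0) * μ) • (F (0 + h) - F 0)) 0 := by
    have h1 : HasDerivAt (fun t : ℝ => Real.exp (μ * t)) (Real.exp (μ * 0) * μ) 0 := by
      have := ((hasDerivAt_id (0 : ℝ)).const_mul μ).exp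
      simpa using this
    have h2 : HasDerivAt (fun t : ℝ => F (t + h)) (φ (0 + h)) 0 :=
      (hFd (0 + h)).comp_add_const 0 h
    exact h1.smul (h2.sub (hFd 0))
  have hF0 : F 0 = 0 := by simp [hF]
  have hφ0 : φ 0 = f := by simp [hφ, orbit_zero]
  refine (hd.hasDerivWithinAt.congr (fun t ht => horb t ht) (horb 0 le_rfl)).congr_deriv ?_
  rw [hF0, hφ0]
  simp only [mul_zero, Real.exp_zero, one_smul, zero_add, one_mul, sub_zero, hφ]
  abel

/-- An element whose orbit stays in a closed convex set is a limit of elements of the domain of the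
generator lying in this set. -/
theorem _root_.TransportFragmentation.Generates.mem_closure_inter [CompleteSpace X]
    (h : Generates R S) {P : Set X} (hPc : IsClosed P) (hP : Convex ℝ P) {f : X}
    (hf : ∀ t, S.op t f ∈ P) : f ∈ closure ({u | ∃ f, R u f} ∩ P) := by
  -- The approximants are the averages $t^{-1}\int_0^tS(s)f\,ds$, the Laplace transform with
  -- $\mu=0$. They are in the domain, tend to $f$, and stay in $P$ because averages do not leave a
  -- closed convex set.
  set φ : ℝ → X := fun s => Real.exp (-(0 * s)) • S.orbit f s with hφ
  set F : ℝ → X := fun t => ∫ s in (0 : ℝ)..t, φ s with hF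
  have hc : Continuous φ := by
    have := S.continuous_orbit f
    fun_prop
  have hFd : HasDerivAt F (φ 0) 0 :=
    intervalIntegral.integral_hasDerivAt_right (hc.intervalIntegrable _ _)
      (hc.stronglyMeasurableAtFilter _ _) hc.continuousAt
  have h1 := hFd.hasDerivWithinAt (s := Ici 0)
  rw [hasDerivWithinAt_iff_tendsto_slope, Ici_sdiff_left] at h1
  simp only [hφ, mul_zero, neg_zero, Real.exp_zero, one_smul, orbit_zero] at h1
  refine mem_closure_of_tendsto h1 ?_
  filter_upwards [self_mem_nhdsWithin] with t (ht : 0 < t)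
  have h2 := (generates_iff.1 h _ _).2 (S.hasDerivWithinAt_laplace 0 ht.le f)
  have h3 := h.smul (t - 0)⁻¹ h2
  have h4 : slope F 0 t = (t - 0)⁻¹ • F t := by simp [slope, hF]
  refine ⟨⟨_, h4 ▸ h3⟩, ?_⟩
  rw [h4, hF, ← interval_average_eq]
  refine hP.set_average_mem hPc ?_ ?_ (Eventually.of_forall fun s => ?_)
    (hc.intervalIntegrable 0 t).def'
  · simp [uIoc_of_le ht.le, ht]
  · simp [uIoc_of_le ht.le]
  · simpa [hφ, orbit] using hf s.toNNReal

/-- The domain of the generator is dense. -/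
theorem _root_.TransportFragmentation.Generates.dense [CompleteSpace X] (h : Generates R S) :
    Dense {u | ∃ f, R u f} := fun f => by
  simpa using h.mem_closure_inter isClosed_univ convex_univ (f := f) fun _ => mem_univ _

/-- For a contraction semigroup, `μ - R` is surjective for `μ > 0`. -/
theorem _root_.TransportFragmentation.Generates.exists_resolvent [CompleteSpace X]
    (h : Generates R S) (hS : ∀ t, ‖S.op t‖ ≤ 1) {μ : ℝ} (hμ : 0 < μ) (f : X) :
    ∃ u, R u (μ • u - f) := by
  -- The Laplace transform over $[0,1]$ inverts $\mu-R$ up to the factor $1-Q$ with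
  -- $Q=e^{-\mu}S(1)$. As $\|Q\|\le e^{-\mu}<1$, the datum is corrected to $f'=(1-Q)^{-1}f$, and no
  -- improper integral is needed.
  set Q : X →L[ℝ] X := Real.exp (-(μ * 1)) • S.op (1 : ℝ).toNNReal with hQ
  have hQ1 : ‖Q‖ < 1 := by
    rw [hQ, norm_smul, Real.norm_of_nonneg (Real.exp_pos _).le]
    calc _ ≤ Real.exp (-(μ * 1)) * 1 := by gcongr; exact hS _
      _ < 1 := by simpa using hμ
  obtain ⟨W, hW⟩ := isUnit_one_sub_of_norm_lt_one hQ1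
  set f' : X := (↑W⁻¹ : X →L[ℝ] X) f with hf'
  have e : f' - Q f' = f := by
    have : ((1 - Q) * (↑W⁻¹ : X →L[ℝ] X)) f = f := by rw [← hW]; simp
    simpa using this
  refine ⟨∫ s in (0 : ℝ)..1, Real.exp (-(μ * s)) • S.orbit f' s, ?_⟩
  have := (generates_iff.1 h _ _).2 (S.hasDerivWithinAt_laplace μ zero_le_one f')
  convert this using 1
  rw [← e]
  simp only [hQ, orbit, _root_.smul_apply]
  abel

/-- The generator of a contraction semigroup is dissipative. -/
theorem _root_.TransportFragmentation.Generates.dissipative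
    (h : Generates R S) (hS : ∀ t, ‖S.op t‖ ≤ 1) {μ : ℝ} (hμ : 0 < μ) {u f : X} (huf : R u f) :
    μ * ‖u‖ ≤ ‖μ • u - f‖ := by
  have h1 := (((h u f).1 huf).const_sub (μ • u)).norm
  refine ge_of_tendsto h1 ?_
  filter_upwards [self_mem_nhdsWithin] with t (ht : 0 < t)
  have ht' : (0 : ℝ) < t := ht
  have e : μ • u - (t : ℝ)⁻¹ • (S.op t u - u) = (μ + (t : ℝ)⁻¹) • u - (t : ℝ)⁻¹ • S.op t u := by
    module
  rw [e]
  refine le_trans ?_ (norm_sub_norm_le _ _)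
  rw [norm_smul, norm_smul, Real.norm_of_nonneg (by positivity), Real.norm_of_nonneg (by positivity)]
  have h2 : ‖S.op t u‖ ≤ ‖u‖ := by simpa using (S.op t).le_of_opNorm_le (hS t) u
  have : (t : ℝ)⁻¹ * ‖S.op t u‖ ≤ (t : ℝ)⁻¹ * ‖u‖ := by gcongr
  linarith

end C0Semigroup

/-! ### Quasi-dissipative operators, Yosida approximation and generation -/

section HilleYosida

variable {X : Type*} [NormedAddCommGroup X] [NormedSpace ℝ X]

/-- A densely defined linear operator `K`, given by its graph, such that `K - ω` is dissipative
and `λ - K` is surjective for `λ > ω`. -/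
structure QuasiMDissipative (K : X → X → Prop) (ω : ℝ) : Prop where
  nonneg : 0 ≤ ω
  add : ∀ {u v f g}, K u f → K v g → K (u + v) (f + g)
  smul : ∀ (c : ℝ) {u f}, K u f → K (c • u) (c • f)
  dissipative : ∀ {μ}, ω < μ → ∀ {u f}, K u f → (μ - ω) * ‖u‖ ≤ ‖μ • u - f‖
  surjective : ∀ {μ}, ω < μ → ∀ f, ∃ u, K u (μ • u - f)
  dense : Dense {u | ∃ f, K u f}

namespace QuasiMDissipative

variable {K : X → X → Prop} {ω : ℝ}

theorem eq_of_sub_eq (h : QuasiMDissipative K ω) {μ : ℝ} (hμ : ω < μ) {u v f g : X}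
    (hu : K u f) (hv : K v g) (he : μ • u - f = μ • v - g) : u = v := by
  have h1 := h.dissipative hμ (h.add hu (h.smul (-1) hv))
  have e : μ • (u + (-1 : ℝ) • v) - (f + (-1 : ℝ) • g) = (μ • u - f) - (μ • v - g) := by module
  rw [e, he, sub_self, norm_zero] at h1
  have h2 : ‖u + (-1 : ℝ) • v‖ ≤ 0 := by
    by_contra! h3
    nlinarith
  have h3 := norm_le_zero_iff.1 h2
  rw [neg_one_smul, ← sub_eq_add_neg] at h3
  exact sub_eq_zero.1 h3

/-- Dissipativity gives uniqueness of the solution of $(\mu-K)u=f$, which forces linearity of the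
solution map, and it gives the norm bound as well. -/
theorem exists_resolvent (h : QuasiMDissipative K ω) {μ : ℝ} (hμ : ω < μ) :
    ∃ R : X →L[ℝ] X, ‖R‖ ≤ (μ - ω)⁻¹ ∧ ∀ f, K (R f) (μ • R f - f) := by
  choose R hR using fun f => h.surjective hμ f
  have hμ' : 0 < μ - ω := sub_pos.2 hμ
  let L : X →ₗ[ℝ] X :=
    { toFun := R
      map_add' := fun f g => h.eq_of_sub_eq hμ (hR _) (h.add (hR f) (hR g)) (by module)
      map_smul' := fun c f => h.eq_of_sub_eq hμ (hR _) (h.smul c (hR f)) (by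
        simp only [RingHom.id_apply]; module) }
  refine ⟨L.mkContinuous (μ - ω)⁻¹ fun f => ?_,
    LinearMap.mkContinuous_norm_le _ (by positivity) _, hR⟩
  have := h.dissipative hμ (hR f)
  rw [sub_sub_cancel] at this
  rw [inv_mul_eq_div, le_div_iff₀ hμ', mul_comm]
  exact this

end QuasiMDissipative

variable [CompleteSpace X]

open NormedSpace (exp)

/-! ### Exponentials of bounded operators -/

theorem exp_add_smul_op (A : X →L[ℝ] X) (s t : ℝ) :
    exp ((s + t) • A) = exp (s • A) * exp (t • A) := by
  let _ := NormedAlgebra.restrictScalars ℚ ℝ (X →L[ℝ] X)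
  rw [add_smul]
  exact NormedSpace.exp_add_of_commute (((Commute.refl A).smul_left s).smul_right t)

theorem hasDerivAt_exp_smul_apply (A : X →L[ℝ] X) (u : X) (t : ℝ) :
    HasDerivAt (fun s : ℝ => exp (s • A) u) (exp (t • A) (A u)) t := by
  have h := (hasDerivAt_exp_smul_const (𝕂 := ℝ) A t).clm_apply (hasDerivAt_const t u)
  simpa using h

theorem norm_exp_apply_le (A : X →L[ℝ] X) (u : X) : ‖exp A u‖ ≤ Real.exp ‖A‖ * ‖u‖ := by
  have h1 : HasSum (fun n : ℕ => (((n.factorial : ℝ)⁻¹ • A ^ n : X →L[ℝ] X)) u) (exp A u) :=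
    (NormedSpace.exp_series_hasSum_exp' (𝕂 := ℝ) A).mapL (ContinuousLinearMap.apply ℝ X u)
  have h2 : HasSum (fun n : ℕ => ((n.factorial : ℝ)⁻¹ • ‖A‖ ^ n) * ‖u‖)
      (Real.exp ‖A‖ * ‖u‖) := by
    rw [Real.exp_eq_exp_ℝ]
    exact (NormedSpace.exp_series_hasSum_exp' (𝕂 := ℝ) ‖A‖).mul_right _
  rw [← h1.tsum_eq]
  refine tsum_of_norm_bounded h2 fun n => ?_
  rw [_root_.smul_apply, norm_smul, Real.norm_of_nonneg (by positivity), smul_eq_mul,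
    mul_assoc]
  gcongr
  induction n with
  | zero => simp
  | succ n ih =>
    rw [pow_succ', pow_succ', mul_apply_eq_comp, mul_assoc]
    exact (A.le_opNorm _).trans (by gcongr)

/-- The exponential of an operator preserving a closed convex cone preserves the cone. -/
theorem exp_apply_mem_of_cone {P : Set X} (hPc : IsClosed P) (hP0 : 0 ∈ P)
    (hPadd : ∀ u ∈ P, ∀ v ∈ P, u + v ∈ P) (hPsmul : ∀ c : ℝ, 0 ≤ c → ∀ u ∈ P, c • u ∈ P)
    {A : X →L[ℝ] X} (hA : ∀ u ∈ P, A u ∈ P) {u : X} (hu : u ∈ P) : exp A u ∈ P := by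
  have h1 : HasSum (fun n : ℕ => (((n.factorial : ℝ)⁻¹ • A ^ n : X →L[ℝ] X)) u) (exp A u) :=
    (NormedSpace.exp_series_hasSum_exp' (𝕂 := ℝ) A).mapL (ContinuousLinearMap.apply ℝ X u)
  have hpow : ∀ n : ℕ, (A ^ n) u ∈ P := by
    intro n
    induction n with
    | zero => simpa using hu
    | succ n ih =>
      rw [pow_succ', mul_apply_eq_comp]
      exact hA _ ih
  refine hPc.mem_of_tendsto h1 (Eventually.of_forall fun s => ?_)
  exact Finset.sum_induction _ (· ∈ P) (fun u v hu hv => hPadd u hu v hv) hP0 fun n _ =>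
    hPsmul _ (by positivity) _ (hpow n)

theorem exp_sub_smul_one (A : X →L[ℝ] X) (c : ℝ) :
    exp (A - c • (1 : X →L[ℝ] X)) = Real.exp (-c) • exp A := by
  let _ := NormedAlgebra.restrictScalars ℚ ℝ (X →L[ℝ] X)
  have h1 : exp ((-c) • (1 : X →L[ℝ] X)) = Real.exp (-c) • (1 : X →L[ℝ] X) := by
    rw [← Algebra.algebraMap_eq_smul_one, ← NormedSpace.algebraMap_exp_comm, ← Real.exp_eq_exp_ℝ,
      Algebra.algebraMap_eq_smul_one]
  rw [sub_eq_add_neg, ← neg_smul, NormedSpace.exp_add_of_commute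
    ((Commute.one_right A).smul_right (-c)), h1]
  simp

/-- Two exponentially bounded commuting groups differ by at most the difference of their
generators. -/
theorem norm_exp_smul_sub_le {A B : X →L[ℝ] X} (hAB : Commute A B) {κ : ℝ}
    (hA : ∀ s : ℝ, 0 ≤ s → ∀ u, ‖exp (s • A) u‖ ≤ Real.exp (κ * s) * ‖u‖)
    (hB : ∀ s : ℝ, 0 ≤ s → ∀ u, ‖exp (s • B) u‖ ≤ Real.exp (κ * s) * ‖u‖)
    {t : ℝ} (ht : 0 ≤ t) (u : X) :
    ‖exp (t • A) u - exp (t • B) u‖ ≤ Real.exp (κ * t) * ‖A u - B u‖ * t := by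
  -- Duhamel path $e^{sA}e^{(t-s)B}u$ from $e^{tB}u$ to $e^{tA}u$. Because $A$ and $B$ commute, its
  -- derivative is $e^{sA}e^{(t-s)B}(A-B)u$.
  set f : ℝ → X := fun s => exp (s • A) (exp ((t - s) • B) u) with hf
  have hd : ∀ s, HasDerivAt f (exp (s • A) (exp ((t - s) • B) (A u - B u))) s := by
    intro s
    have h1 := hasDerivAt_exp_smul_const (𝕂 := ℝ) A s
    have h2 : HasDerivAt (fun s : ℝ => exp ((t - s) • B) u) (-(exp ((t - s) • B) (B u))) s := by
      have := HasDerivAt.scomp s (hasDerivAt_exp_smul_apply B u (t - s))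
        ((hasDerivAt_id s).const_sub t)
      rw [neg_one_smul] at this
      exact this
    refine (h1.clm_apply h2).congr_deriv ?_
    have hc : A * exp ((t - s) • B) = exp ((t - s) • B) * A :=
      (hAB.smul_right (t - s)).exp_right
    have hc' := congrArg (fun Z : X →L[ℝ] X => Z u) hc
    simp only [mul_apply_eq_comp] at hc' ⊢
    rw [hc']
    simp [sub_eq_add_neg]
  have := norm_image_sub_le_of_norm_deriv_le_segment' (f := f) (a := 0) (b := t)
    (C := Real.exp (κ * t) * ‖A u - B u‖) (fun x _ => (hd x).hasDerivWithinAt) (fun s hs => by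
      calc _ ≤ Real.exp (κ * s) * (Real.exp (κ * (t - s)) * ‖A u - B u‖) :=
            (hA s hs.1 _).trans (by gcongr; exact hB _ (by linarith [hs.2]) _)
        _ = _ := by rw [← mul_assoc, ← Real.exp_add]; ring_nf) t ⟨ht, le_rfl⟩
  simpa [hf] using this

/-! ### Limits of exponentials -/

/-- Exponentials of commuting, uniformly exponentially bounded operators that converge on a dense
set converge to a `C₀`-semigroup, whose generator extends the limit operator. -/
theorem exists_semigroup_of_tendsto {A : ℕ → X →L[ℝ] X} (hA : ∀ n m, Commute (A n) (A m))
    {κ : ℝ} (hκ : 0 ≤ κ)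
    (hexp : ∀ n, ∀ s : ℝ, 0 ≤ s → ∀ u, ‖exp (s • A n) u‖ ≤ Real.exp (κ * s) * ‖u‖)
    (hdense : Dense {u | ∃ f, Tendsto (fun n => A n u) atTop (𝓝 f)}) :
    ∃ S : C0Semigroup X,
      (∀ (t : ℝ≥0) u, Tendsto (fun n => exp ((t : ℝ) • A n) u) atTop (𝓝 (S.op t u))) ∧
      (∀ t : ℝ≥0, ‖S.op t‖ ≤ Real.exp (κ * t)) ∧
      ∀ u f, Tendsto (fun n => A n u) atTop (𝓝 f) → HasDerivWithinAt (S.orbit u) f (Ici 0) 0 := by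
  have hone : ∀ t : ℝ, 0 ≤ t → 1 ≤ Real.exp (κ * t) := fun t ht => Real.one_le_exp (by positivity)
  -- pointwise convergence
  have hcauchy : ∀ (t : ℝ≥0) u, CauchySeq fun n => exp ((t : ℝ) • A n) u := by
    intro t u
    rw [Metric.cauchySeq_iff']
    intro ε hε
    set c := Real.exp (κ * t) with hc
    have hc0 : 0 < c := Real.exp_pos _
    obtain ⟨v, ⟨f, hf⟩, hv⟩ := hdense.exists_dist_lt u (show 0 < ε / (4 * c) by positivity)
    have h1 := (Metric.cauchySeq_iff'.1 hf.cauchySeq) (ε / (4 * (c * (t + 1)))) (by positivity)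
    obtain ⟨N, hN⟩ := h1
    refine ⟨N, fun n hn => ?_⟩
    rw [dist_eq_norm] at hv ⊢
    have e1 : exp ((t : ℝ) • A n) u - exp ((t : ℝ) • A N) u =
        exp ((t : ℝ) • A n) (u - v) + (exp ((t : ℝ) • A n) v - exp ((t : ℝ) • A N) v) -
          exp ((t : ℝ) • A N) (u - v) := by
      simp only [map_sub]; abel
    have b1 : ‖exp ((t : ℝ) • A n) (u - v)‖ ≤ ε / 4 := (hexp n t t.2 _).trans <| by
      calc c * ‖u - v‖ ≤ c * (ε / (4 * c)) := by gcongr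
        _ = ε / 4 := by field_simp
    have b2 : ‖exp ((t : ℝ) • A N) (u - v)‖ ≤ ε / 4 := (hexp N t t.2 _).trans <| by
      calc c * ‖u - v‖ ≤ c * (ε / (4 * c)) := by gcongr
        _ = ε / 4 := by field_simp
    have b3 : ‖exp ((t : ℝ) • A n) v - exp ((t : ℝ) • A N) v‖ ≤ ε / 4 :=
      (norm_exp_smul_sub_le (hA n N) (hexp n) (hexp N) t.2 v).trans <| by
      have h2 := hN n hn
      rw [dist_eq_norm] at h2
      have h3 : (t : ℝ) ≤ t + 1 := by linarith
      calc c * ‖A n v - A N v‖ * t ≤ c * (ε / (4 * (c * (t + 1)))) * (t + 1) := by gcongr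
        _ = ε / 4 := by field_simp
    rw [e1]
    calc _ ≤ ε / 4 + ε / 4 + ε / 4 :=
          (norm_sub_le _ _).trans (add_le_add ((norm_add_le _ _).trans (add_le_add b1 b3)) b2)
      _ < ε := by linarith
  choose L hL using fun (t : ℝ≥0) u => cauchySeq_tendsto_of_complete (hcauchy t u)
  let op : ℝ≥0 → X →L[ℝ] X := fun t =>
    LinearMap.mkContinuous
      { toFun := L t
        map_add' := fun u v => tendsto_nhds_unique (hL t (u + v)) (by
          simpa using (hL t u).add (hL t v))
        map_smul' := fun c u => tendsto_nhds_unique (hL t (c • u)) (by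
          simpa using (hL t u).const_smul c) } (Real.exp (κ * t))
      fun u => le_of_tendsto (hL t u).norm (Eventually.of_forall fun n => hexp n t t.2 u)
  have hop : ∀ (t : ℝ≥0) u, Tendsto (fun n => exp ((t : ℝ) • A n) u) atTop (𝓝 (op t u)) := hL
  have hopn : ∀ t : ℝ≥0, ‖op t‖ ≤ Real.exp (κ * t) := fun t =>
    LinearMap.mkContinuous_norm_le _ (Real.exp_pos _).le _
  -- equicontinuity at time zero
  have hequi : ∀ u, ∀ ε > 0, ∃ η > 0, ∀ s : ℝ, 0 ≤ s → s ≤ η → ∀ n,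
      ‖exp (s • A n) u - u‖ ≤ ε := by
    intro u ε hε
    set c := Real.exp (κ * 1) with hc
    have hc1 : 1 ≤ c := hone 1 zero_le_one
    obtain ⟨v, ⟨f, hf⟩, hv⟩ := hdense.exists_dist_lt u (show 0 < ε / (4 * c) by positivity)
    obtain ⟨C, hC⟩ := hf.norm.bddAbove_range
    have hC' : ∀ n, ‖A n v‖ ≤ C := fun n => hC ⟨n, rfl⟩
    have hC0 : 0 ≤ C := (norm_nonneg _).trans (hC' 0)
    refine ⟨min 1 (ε / (2 * (c * (C + 1)))), by positivity, fun s hs0 hs n => ?_⟩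
    have hs1 : s ≤ 1 := hs.trans (min_le_left _ _)
    have hs2 : s ≤ ε / (2 * (c * (C + 1))) := hs.trans (min_le_right _ _)
    have hcs : Real.exp (κ * s) ≤ c := by
      rw [hc]; gcongr
    rw [dist_eq_norm] at hv
    have e1 : exp (s • A n) u - u =
        exp (s • A n) (u - v) + (exp (s • A n) v - v) - (u - v) := by
      simp only [map_sub]; abel
    have hcu : c * ‖u - v‖ ≤ ε / 4 := by
      calc c * ‖u - v‖ ≤ c * (ε / (4 * c)) := by gcongr
        _ = ε / 4 := by field_simp
    have b1 : ‖exp (s • A n) (u - v)‖ ≤ ε / 4 :=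
      (hexp n s hs0 _).trans (le_trans (by gcongr) hcu)
    have b2 : ‖u - v‖ ≤ ε / 4 := by
      refine le_trans ?_ hcu
      nlinarith [norm_nonneg (u - v)]
    have b3 : ‖exp (s • A n) v - v‖ ≤ ε / 2 := by
      have := norm_exp_smul_sub_le (Commute.zero_right (A n)) (hexp n) (κ := κ)
        (fun s hs u => by
          simpa using mul_le_mul_of_nonneg_right (hone s hs) (norm_nonneg u)) hs0 v
      simp only [smul_zero, NormedSpace.exp_zero, one_apply_eq_self,
        _root_.zero_apply, sub_zero] at this
      refine this.trans ?_
      calc Real.exp (κ * s) * ‖A n v‖ * s ≤ c * (C + 1) * (ε / (2 * (c * (C + 1)))) := by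
            gcongr
            linarith [hC' n]
        _ = ε / 2 := by field_simp
    rw [e1]
    calc _ ≤ ε / 4 + ε / 2 + ε / 4 :=
          (norm_sub_le _ _).trans (add_le_add ((norm_add_le _ _).trans (add_le_add b1 b3)) b2)
      _ = ε := by ring
  let S : C0Semigroup X :=
    { op := op
      op_zero := by
        ext u
        refine tendsto_nhds_unique (hop 0 u) ?_
        simp
      op_add := fun s t => by
        ext u
        refine tendsto_nhds_unique (hop (s + t) u) ?_
        have h1 := hop s (op t u)
        have h2 : Tendsto (fun n => exp ((s : ℝ) • A n) (exp ((t : ℝ) • A n) u - op t u))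
            atTop (𝓝 0) := by
          have h3 := ((hop t u).sub_const (op t u)).norm.const_mul (Real.exp (κ * s))
          rw [sub_self, norm_zero, mul_zero] at h3
          exact squeeze_zero_norm (fun n => hexp n s s.2 _) h3
        have h4 := h2.add h1
        rw [zero_add] at h4
        refine h4.congr fun n => ?_
        rw [NNReal.coe_add, exp_add_smul_op]
        simp
      tendsto_zero := fun u => by
        rw [Metric.tendsto_nhds]
        intro ε hε
        obtain ⟨η, hη, h⟩ := hequi u (ε / 2) (by positivity)
        have : ∀ᶠ t : ℝ≥0 in 𝓝 0, (t : ℝ) < η :=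
          (NNReal.continuous_coe.tendsto 0).eventually (Iio_mem_nhds (by simpa using hη))
        filter_upwards [this] with t ht
        rw [dist_eq_norm]
        have : ‖op t u - u‖ ≤ ε / 2 := le_of_tendsto ((hop t u).sub_const u).norm
          (Eventually.of_forall fun n => h t t.2 ht.le n)
        linarith }
  refine ⟨S, hop, hopn, fun u f huf => ?_⟩
  rw [hasDerivWithinAt_iff_isLittleO, Asymptotics.isLittleO_iff]
  intro ε hε
  obtain ⟨η, hη, h⟩ := hequi f ε hε
  have : ∀ᶠ t : ℝ in 𝓝[≥] 0, t < η := mem_nhdsWithin_of_mem_nhds (Iio_mem_nhds hη)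
  filter_upwards [this, self_mem_nhdsWithin] with t htη (ht : 0 ≤ t)
  -- Mean value inequality for $t\mapsto e^{tA_n}u-tf$. The error $\varepsilon$ is uniform in $n$ by
  -- `hequi`, so it survives the limit $n\to\infty$ while $\|A_nu-f\|$ disappears.
  have key : ∀ n, ‖exp (t • A n) u - t • f - u‖ ≤ (Real.exp (κ * t) * ‖A n u - f‖ + ε) * t := by
    intro n
    have hd : ∀ s, HasDerivAt (fun s : ℝ => exp (s • A n) u - s • f)
        (exp (s • A n) (A n u) - f) s := by
      intro s
      have h2 : HasDerivAt (fun s : ℝ => s • f) f s := by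
        simpa using (hasDerivAt_id s).smul_const f
      exact (hasDerivAt_exp_smul_apply (A n) u s).sub h2
    have := norm_image_sub_le_of_norm_deriv_le_segment' (a := 0) (b := t)
      (C := Real.exp (κ * t) * ‖A n u - f‖ + ε) (fun x _ => (hd x).hasDerivWithinAt) (fun s hs => by
        have e2 : exp (s • A n) (A n u) - f = exp (s • A n) (A n u - f) + (exp (s • A n) f - f) := by
          simp
        rw [e2]
        refine (norm_add_le _ _).trans (add_le_add ?_ (h s hs.1 (hs.2.le.trans htη.le) n))
        refine (hexp n s hs.1 _).trans ?_
        have := hs.2.le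
        gcongr) t ⟨ht, le_rfl⟩
    simpa using this
  have hlim : Tendsto (fun n => exp (t • A n) u - t • f - u) atTop (𝓝 (S.orbit u t - t • f - u)) := by
    have := hop t.toNNReal u
    rw [Real.coe_toNNReal t ht] at this
    exact (this.sub_const _).sub_const _
  have hlim2 : Tendsto (fun n => (Real.exp (κ * t) * ‖A n u - f‖ + ε) * t) atTop (𝓝 (ε * t)) := by
    have := (((huf.sub_const f).norm.const_mul (Real.exp (κ * t))).add_const ε).mul_const t
    simpa using this
  have hle := le_of_tendsto_of_tendsto' hlim.norm hlim2 key
  rw [S.orbit_zero, sub_zero, Real.norm_of_nonneg ht]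
  convert! hle using 2
  abel

/-! ### The Hille–Yosida theorem -/

namespace QuasiMDissipative

variable {K : X → X → Prop} {ω : ℝ}

/-- **Hille–Yosida theorem** for quasi-dissipative operators, with an invariant cone. -/
theorem exists_semigroup (h : QuasiMDissipative K ω) {P : Set X} (hPc : IsClosed P) (hP0 : 0 ∈ P)
    (hPadd : ∀ u ∈ P, ∀ v ∈ P, u + v ∈ P) (hPsmul : ∀ c : ℝ, 0 ≤ c → ∀ u ∈ P, c • u ∈ P)
    (hP : ∀ μ, ω < μ → ∀ u f, K u f → μ • u - f ∈ P → u ∈ P) :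
    ∃ S : C0Semigroup X, Generates K S ∧ (∀ t : ℝ≥0, ‖S.op t‖ ≤ Real.exp (2 * ω * t)) ∧
      ∀ t, ∀ u ∈ P, S.op t u ∈ P := by
  have hω := h.nonneg
  -- Starting at $2\omega+1$ ensures $\mu_n/(\mu_n-\omega)\le2$ for all $n$; this is where the
  -- growth rate $2\omega$ comes from.
  set μ : ℕ → ℝ := fun n => 2 * ω + 1 + n with hμdef
  have hμ : ∀ n, 2 * ω + 1 ≤ μ n := fun n => by simp [hμdef]
  have hμω : ∀ n, ω < μ n := fun n => by linarith [hμ n]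
  have hμlim : Tendsto μ atTop atTop :=
    tendsto_atTop_add_const_left _ _ tendsto_natCast_atTop_atTop
  choose R hRn hR using fun n => h.exists_resolvent (hμω n)
  have hres : ∀ n {u f}, K u f → R n (μ n • u - f) = u := fun n u f huf =>
    h.eq_of_sub_eq (hμω n) (hR n _) huf (by module)
  -- Yosida approximations: on the domain of $K$, $A_nu=\mu_nR_nKu$, which tends to $Ku$ since
  -- $\mu_nR_n$ tends strongly to the identity.
  set A : ℕ → X →L[ℝ] X := fun n => μ n • (μ n • R n - 1) with hAdef
  have hAK : ∀ n {u f}, K u f → A n u = μ n • R n f := by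
    intro n u f huf
    have h1 := hres n huf
    rw [map_sub, map_smul, sub_eq_iff_eq_add] at h1
    simp only [hAdef, _root_.smul_apply, _root_.sub_apply,
      one_apply_eq_self]
    rw [h1, add_sub_cancel_left]
  have hcomm : ∀ n m, Commute (R n) (R m) := by
    have key : ∀ n m y, (μ n - μ m) • R n (R m y) = R m y - R n y := by
      intro n m y
      have h1 := hres n (hR m y)
      have e : μ n • R m y - (μ m • R m y - y) = (μ n - μ m) • R m y + y := by module
      rw [e, map_add, map_smul] at h1
      exact eq_sub_of_add_eq h1
    intro n m
    rcases eq_or_ne n m with rfl | hnm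
    · exact Commute.refl _
    have hne : μ n - μ m ≠ 0 := by
      simp only [hμdef, add_sub_add_left_eq_sub]
      exact sub_ne_zero.2 (by exact_mod_cast hnm)
    ext y
    have h1 := key n m y
    have h2 := key m n y
    have h3 : (μ n - μ m) • R n (R m y) = (μ n - μ m) • R m (R n y) := by
      rw [h1, ← neg_sub (μ m), neg_smul, h2]
      abel
    exact smul_right_injective X hne h3
  have hAcomm : ∀ n m, Commute (A n) (A m) := by
    intro n m
    refine Commute.smul_left (Commute.smul_right ?_ _) _
    exact (((hcomm n m).smul_left _).smul_right _ |>.sub_left (Commute.one_left _)).sub_right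
      (Commute.one_right _)
  -- Splitting off the scalar part leaves the exponential of a nonnegative multiple of $R_n$. This
  -- gives both the norm bound and the invariance of the cone.
  have hexpA : ∀ n (s : ℝ), exp (s • A n) = Real.exp (-(s * μ n)) • exp ((s * μ n ^ 2) • R n) := by
    intro n s
    rw [← exp_sub_smul_one]
    congr 1
    simp only [hAdef]
    module
  have hexp : ∀ n, ∀ s : ℝ, 0 ≤ s → ∀ u, ‖exp (s • A n) u‖ ≤ Real.exp (2 * ω * s) * ‖u‖ := by
    intro n s hs u
    have hpos : 0 < μ n - ω := sub_pos.2 (hμω n)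
    rw [hexpA, _root_.smul_apply, norm_smul, Real.norm_of_nonneg (Real.exp_pos _).le]
    have h1 := norm_exp_apply_le ((s * μ n ^ 2) • R n) u
    have h2 : ‖(s * μ n ^ 2) • R n‖ ≤ s * μ n ^ 2 * (μ n - ω)⁻¹ := by
      rw [norm_smul, Real.norm_of_nonneg (by positivity)]
      gcongr
      exact hRn n
    have h3 : -(s * μ n) + s * μ n ^ 2 * (μ n - ω)⁻¹ ≤ 2 * ω * s := by
      have e : -(s * μ n) + s * μ n ^ 2 * (μ n - ω)⁻¹ = s * (ω * (μ n / (μ n - ω))) := by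
        field_simp
        ring
      have h4 : μ n / (μ n - ω) ≤ 2 := by
        rw [div_le_iff₀ hpos]
        linarith [hμ n]
      rw [e]
      calc _ ≤ s * (ω * 2) := by gcongr
        _ = _ := by ring
    calc _ ≤ Real.exp (-(s * μ n)) * (Real.exp (s * μ n ^ 2 * (μ n - ω)⁻¹) * ‖u‖) := by
          gcongr
          exact h1.trans (by gcongr)
      _ = Real.exp (-(s * μ n) + s * μ n ^ 2 * (μ n - ω)⁻¹) * ‖u‖ := by
          rw [Real.exp_add]; ring
      _ ≤ _ := by gcongr
  -- `μ n • R n` converges strongly to the identity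
  have hid : ∀ f, Tendsto (fun n => μ n • R n f) atTop (𝓝 f) := by
    have hb : ∀ n f, ‖μ n • R n f‖ ≤ 2 * ‖f‖ := by
      intro n f
      have hpos : 0 < μ n - ω := sub_pos.2 (hμω n)
      have hμ0 : 0 ≤ μ n := by linarith [hμ n]
      rw [norm_smul, Real.norm_of_nonneg hμ0]
      have h1 : ‖R n f‖ ≤ (μ n - ω)⁻¹ * ‖f‖ := (R n).le_of_opNorm_le (hRn n) f
      have h4 : μ n * (μ n - ω)⁻¹ ≤ 2 := by
        rw [← div_eq_mul_inv, div_le_iff₀ hpos]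
        linarith [hμ n]
      calc _ ≤ μ n * ((μ n - ω)⁻¹ * ‖f‖) := by gcongr
        _ = μ n * (μ n - ω)⁻¹ * ‖f‖ := by ring
        _ ≤ _ := by gcongr
    have hD : ∀ u g, K u g → Tendsto (fun n => μ n • R n u) atTop (𝓝 u) := by
      intro u g hug
      have h1 : ∀ n, μ n • R n u - u = R n g := by
        intro n
        have h1 := hres n hug
        rw [map_sub, map_smul, sub_eq_iff_eq_add] at h1
        rw [h1, add_sub_cancel_left]
      rw [tendsto_iff_norm_sub_tendsto_zero]
      have h2 : Tendsto (fun n => (μ n - ω)⁻¹ * ‖g‖) atTop (𝓝 0) := by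
        have := (tendsto_inv_atTop_zero.comp (tendsto_atTop_add_const_right _ (-ω) hμlim)).mul_const
          ‖g‖
        simpa [sub_eq_add_neg] using this
      refine squeeze_zero (fun _ => norm_nonneg _) (fun n => ?_) h2
      rw [h1]
      exact (R n).le_of_opNorm_le (hRn n) g
    intro f
    rw [Metric.tendsto_atTop]
    intro ε hε
    obtain ⟨v, ⟨g, hg⟩, hv⟩ := h.dense.exists_dist_lt f (show 0 < ε / 4 by positivity)
    obtain ⟨N, hN⟩ := Metric.tendsto_atTop.1 (hD v g hg) (ε / 4) (by positivity)
    refine ⟨N, fun n hn => ?_⟩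
    have h1 := hN n hn
    rw [dist_eq_norm] at hv h1 ⊢
    have e : μ n • R n f - f = μ n • R n (f - v) + (μ n • R n v - v) - (f - v) := by
      rw [map_sub]; module
    rw [e]
    have h2 := hb n (f - v)
    calc _ ≤ ‖μ n • R n (f - v)‖ + ‖μ n • R n v - v‖ + ‖f - v‖ :=
          (norm_sub_le _ _).trans (by gcongr; exact norm_add_le _ _)
      _ < ε := by linarith
  have hAlim : ∀ u f, K u f → Tendsto (fun n => A n u) atTop (𝓝 f) := fun u f huf =>
    (hid f).congr fun n => (hAK n huf).symm
  obtain ⟨S, hS1, hS2, hS3⟩ := exists_semigroup_of_tendsto hAcomm (κ := 2 * ω) (by positivity) hexp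
    (h.dense.mono (by rintro u ⟨f, hf⟩; exact ⟨f, hAlim u f hf⟩))
  refine ⟨S, C0Semigroup.generates_iff.2 fun u g => ⟨fun hug => hS3 u g (hAlim u g hug),
    fun hug => ?_⟩, hS2, fun t u hu => ?_⟩
  · -- maximality of `K`
    -- If $u$ is in the domain of the generator with value $g$, solve $(\nu-K)v=\nu u-g$. Then $u-v$
    -- is an eigenvector of the generator for $\nu$, so its orbit grows like $e^{\nu t}$, against
    -- the bound $e^{2\omega t}$ unless $u=v$.
    set ν : ℝ := 2 * ω + 1 with hν
    obtain ⟨v, hv⟩ := h.surjective (show ω < ν by linarith) (ν • u - g)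
    set R' : X → X → Prop := fun u f => HasDerivWithinAt (S.orbit u) f (Ici 0) 0 with hR'
    have hgen : Generates R' S := C0Semigroup.generates_iff.2 fun _ _ => Iff.rfl
    have hv' : R' v (ν • v - (ν • u - g)) := hS3 _ _ (hAlim _ _ hv)
    have hw : R' (u - v) (ν • (u - v)) := by
      convert hgen.sub (show R' u g from hug) hv' using 1
      module
    have hsol := hgen.eq_op 1 (v := fun t => Real.exp (ν * t) • (u - v))
      (Continuous.continuousOn (by fun_prop)) (by
        intro x hx
        refine ⟨Real.exp (ν * x) • ν • (u - v), hgen.smul _ hw, ?_⟩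
        have h1 : HasDerivAt (fun t : ℝ => Real.exp (ν * t)) (Real.exp (ν * x) * ν) x := by
          have := ((hasDerivAt_id x).const_mul ν).exp
          simpa using this
        have := (h1.smul_const (u - v)).hasDerivWithinAt (s := Ici x)
        rwa [mul_smul] at this)
    have huv : u = v := by
      by_contra hne
      have hpos : 0 < ‖u - v‖ := norm_pos_iff.2 (sub_ne_zero.2 hne)
      have h1 : ‖S.op 1 (u - v)‖ ≤ Real.exp (2 * ω * 1) * ‖u - v‖ := by
        simpa using (S.op 1).le_of_opNorm_le (hS2 1) (u - v)
      simp only [NNReal.coe_one, mul_zero, Real.exp_zero, one_smul] at hsol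
      rw [← hsol, norm_smul, Real.norm_of_nonneg (Real.exp_pos _).le] at h1
      have h2 := le_of_mul_le_mul_right h1 hpos
      have h3 := Real.exp_le_exp.1 h2
      linarith
    subst huv
    simpa using hv
  · refine hPc.mem_of_tendsto (hS1 t u) (Eventually.of_forall fun n => ?_)
    rw [hexpA, _root_.smul_apply]
    refine hPsmul _ (Real.exp_pos _).le _ (exp_apply_mem_of_cone hPc hP0 hPadd hPsmul ?_ hu)
    intro v hv
    refine hPsmul _ (mul_nonneg t.2 (sq_nonneg _)) _ (hP _ (hμω n) _ _ (hR n v) ?_)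
    simpa using hv

end QuasiMDissipative

end HilleYosida

/-! ### Tools for `L₁` -/

section L1

variable {α β : Type*} [MeasurableSpace α] [MeasurableSpace β] {μ : Measure α} {ν : Measure β}

theorem memLp_one_of_lintegral_le {f : β → ℝ} (hf : AEStronglyMeasurable f ν) {C : ℝ}
    (h : ∫⁻ x, ‖f x‖ₑ ∂ν ≤ ENNReal.ofReal C) : MemLp f 1 ν :=
  memLp_one_iff_integrable.2 ⟨hf, h.trans_lt ENNReal.ofReal_lt_top⟩

theorem norm_toLp_one_le {f : β → ℝ} (hf : MemLp f 1 ν) {C : ℝ} (hC : 0 ≤ C)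
    (h : ∫⁻ x, ‖f x‖ₑ ∂ν ≤ ENNReal.ofReal C) : ‖hf.toLp f‖ ≤ C := by
  rw [Lp.norm_toLp, eLpNorm_one_eq_lintegral_enorm]
  exact ENNReal.toReal_le_of_le_ofReal hC h

theorem lintegral_enorm_coeFn (u : Lp ℝ 1 μ) : ∫⁻ x, ‖u x‖ₑ ∂μ = ENNReal.ofReal ‖u‖ :=
  (L1.ofReal_norm_eq_lintegral u).symm

/-- A pointwise a.e. additive and homogeneous operation with an `L₁` bound is a bounded operator
between `L₁` spaces. -/
theorem exists_clm_of_lintegral_le (F : Lp ℝ 1 μ → β → ℝ) (C : ℝ) (hC : 0 ≤ C)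
    (hmeas : ∀ u, AEStronglyMeasurable (F u) ν)
    (hadd : ∀ u v, F (u + v) =ᵐ[ν] fun x => F u x + F v x)
    (hsmul : ∀ (c : ℝ) u, F (c • u) =ᵐ[ν] fun x => c * F u x)
    (hbound : ∀ u, ∫⁻ x, ‖F u x‖ₑ ∂ν ≤ ENNReal.ofReal (C * ‖u‖)) :
    ∃ L : Lp ℝ 1 μ →L[ℝ] Lp ℝ 1 ν, (∀ u, L u =ᵐ[ν] F u) ∧ ‖L‖ ≤ C := by
  have hmem : ∀ u, MemLp (F u) 1 ν := fun u => memLp_one_of_lintegral_le (hmeas u) (hbound u)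
  let L : Lp ℝ 1 μ →ₗ[ℝ] Lp ℝ 1 ν :=
    { toFun := fun u => (hmem u).toLp (F u)
      map_add' := fun u v => by
        apply Lp.ext
        filter_upwards [(hmem (u + v)).coeFn_toLp, (hmem u).coeFn_toLp, (hmem v).coeFn_toLp,
          Lp.coeFn_add ((hmem u).toLp (F u)) ((hmem v).toLp (F v)), hadd u v] with x h1 h2 h3 h4 h5
        rw [h1, h4, Pi.add_apply, h2, h3, h5]
      map_smul' := fun c u => by
        apply Lp.ext
        filter_upwards [(hmem (c • u)).coeFn_toLp, (hmem u).coeFn_toLp,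
          Lp.coeFn_smul c ((hmem u).toLp (F u)), hsmul c u] with x h1 h2 h3 h4
        simp only [RingHom.id_apply]
        rw [h1, h3, Pi.smul_apply, h2, h4, smul_eq_mul] }
  refine ⟨L.mkContinuous C fun u => ?_, fun u => (hmem u).coeFn_toLp,
    LinearMap.mkContinuous_norm_le _ hC _⟩
  exact norm_toLp_one_le (hmem u) (by positivity) (hbound u)

/-- Multiplication by an essentially bounded function as a bounded operator on `L₁`. -/
theorem exists_mul_clm {w : α → ℝ} (hw : AEStronglyMeasurable w μ) {c : ℝ} (hc : 0 ≤ c)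
    (hwc : ∀ᵐ x ∂μ, |w x| ≤ c) :
    ∃ L : Lp ℝ 1 μ →L[ℝ] Lp ℝ 1 μ, (∀ u, L u =ᵐ[μ] fun x => w x * u x) ∧ ‖L‖ ≤ c := by
  refine exists_clm_of_lintegral_le (fun u x => w x * u x) c hc
    (fun u => hw.mul (Lp.aestronglyMeasurable u)) (fun u v => ?_) (fun k u => ?_) fun u => ?_
  · filter_upwards [Lp.coeFn_add u v] with x hx
    rw [hx, Pi.add_apply, mul_add]
  · filter_upwards [Lp.coeFn_smul k u] with x hx
    rw [hx, Pi.smul_apply, smul_eq_mul]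
    ring
  · rw [ENNReal.ofReal_mul hc, ← lintegral_enorm_coeFn,
      ← lintegral_const_mul' _ _ ENNReal.ofReal_ne_top]
    refine lintegral_mono_ae ?_
    filter_upwards [hwc] with x hx
    rw [enorm_mul]
    gcongr
    rw [Real.enorm_eq_ofReal_abs]
    exact ENNReal.ofReal_le_ofReal hx

open Classical in
/-- Restriction of `L₁` functions to a measurable set. -/
def cut (s : Set α) : Lp ℝ 1 μ →L[ℝ] Lp ℝ 1 μ :=
  if hs : MeasurableSet s then
    (exists_mul_clm (μ := μ) (w := s.indicator 1) (c := 1)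
      (((measurable_one).indicator hs).aestronglyMeasurable) zero_le_one
      (Eventually.of_forall fun x => by
        by_cases hx : x ∈ s <;> simp [hx])).choose
  else 0

theorem cut_ae {s : Set α} (hs : MeasurableSet s) (u : Lp ℝ 1 μ) :
    cut s u =ᵐ[μ] s.indicator u := by
  have h := (exists_mul_clm (μ := μ) (w := s.indicator 1) (c := 1)
      (((measurable_one).indicator hs).aestronglyMeasurable) zero_le_one
      (Eventually.of_forall fun x => by
        by_cases hx : x ∈ s <;> simp [hx])).choose_spec.1 u
  rw [cut, dif_pos hs]
  filter_upwards [h] with x hx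
  rw [hx]
  by_cases hxs : x ∈ s <;> simp [hxs]

theorem coeFn_posPart_ae (u : Lp ℝ 1 μ) : ⇑(u⁺) =ᵐ[μ] fun x => max (u x) 0 := by
  rw [posPart_def]
  filter_upwards [Lp.coeFn_sup u 0, Lp.coeFn_zero ℝ 1 μ] with x h1 h2
  rw [h1, Pi.sup_apply, h2, Pi.zero_apply]

theorem norm_eq_integral_of_nonneg {u : Lp ℝ 1 μ} (hu : 0 ≤ u) : ‖u‖ = ∫ x, u x ∂μ := by
  rw [L1.norm_eq_integral_norm]
  refine integral_congr_ae ?_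
  filter_upwards [(Lp.coeFn_nonneg u).2 hu] with x hx
  exact Real.norm_of_nonneg hx

/-- The integral as a bounded functional on `L₁`. -/
def totalMass (μ : Measure α) : Lp ℝ 1 μ →L[ℝ] ℝ := L1.integralCLM

theorem totalMass_apply (u : Lp ℝ 1 μ) : totalMass μ u = ∫ x, u x ∂μ := by
  rw [totalMass, ← L1.integral_eq, L1.integral_eq_integral]

/-- Linearity of the norm on the positive cone: this turns mass balances into norm estimates, and
makes the norm of a nonnegative orbit differentiable. -/
theorem totalMass_of_nonneg {u : Lp ℝ 1 μ} (hu : 0 ≤ u) : totalMass μ u = ‖u‖ := by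
  rw [totalMass_apply, norm_eq_integral_of_nonneg hu]

theorem totalMass_mono {u v : Lp ℝ 1 μ} (h : u ≤ v) : totalMass μ u ≤ totalMass μ v := by
  have h1 := totalMass_of_nonneg (sub_nonneg.2 h)
  rw [map_sub] at h1
  linarith [norm_nonneg (v - u)]

theorem norm_add_of_nonneg {u v : Lp ℝ 1 μ} (hu : 0 ≤ u) (hv : 0 ≤ v) :
    ‖u + v‖ = ‖u‖ + ‖v‖ := by
  rw [← totalMass_of_nonneg hu, ← totalMass_of_nonneg hv, ← totalMass_of_nonneg (add_nonneg hu hv),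
    map_add]

theorem norm_posPart_add_norm_posPart_neg (u : Lp ℝ 1 μ) : ‖u⁺‖ + ‖(-u)⁺‖ = ‖u‖ := by
  rw [← norm_add_of_nonneg (posPart_nonneg _) (posPart_nonneg _), posPart_neg,
    posPart_add_negPart, norm_abs_eq_norm]

theorem cut_le_posPart {s : Set α} (hs : MeasurableSet s) (u : Lp ℝ 1 μ) : cut s u ≤ u⁺ := by
  rw [← Lp.coeFn_le]
  filter_upwards [cut_ae hs u, coeFn_posPart_ae u] with x h1 h2
  rw [h1, h2]
  by_cases hx : x ∈ s <;> simp [hx]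

theorem cut_nonneg {s : Set α} (hs : MeasurableSet s) {u : Lp ℝ 1 μ} (hu : 0 ≤ u) :
    0 ≤ cut s u := by
  rw [← Lp.coeFn_nonneg] at hu ⊢
  filter_upwards [cut_ae hs u, hu] with x h1 h2
  rw [h1]
  by_cases hx : x ∈ s
  · simpa [hx] using h2
  · simp [hx]

theorem cut_le_of_le {s : Set α} (hs : MeasurableSet s) {u v : Lp ℝ 1 μ} (h : u ≤ v)
    (hv : 0 ≤ v) : cut s u ≤ v :=
  (cut_le_posPart hs u).trans (sup_le h hv)

theorem norm_cut_le {s : Set α} (hs : MeasurableSet s) (u : Lp ℝ 1 μ) : ‖cut s u‖ ≤ ‖u‖ := by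
  refine Lp.norm_le_norm_of_ae_le ?_
  filter_upwards [cut_ae hs u] with x hx
  rw [hx]
  exact norm_indicator_le_norm_self _ _

theorem cut_cut {s : Set α} (hs : MeasurableSet s) (u : Lp ℝ 1 μ) :
    cut s (cut s u) = cut s u := by
  apply Lp.ext
  filter_upwards [cut_ae hs u, cut_ae hs (cut s u)] with x h1 h2
  rw [h2, h1]
  by_cases hx : x ∈ s <;> simp [hx, h1]

theorem cut_univ (u : Lp ℝ 1 μ) : cut univ u = u := by
  apply Lp.ext
  filter_upwards [cut_ae MeasurableSet.univ u] with x hx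
  rw [hx, indicator_univ]

/-- The positive part of an `L₁` function is the restriction to a measurable set. -/
theorem exists_cut_eq_posPart (u : Lp ℝ 1 μ) : ∃ s, MeasurableSet s ∧ cut s u = u⁺ := by
  have hs : MeasurableSet {x | 0 < u x} :=
    (Lp.stronglyMeasurable u).measurable measurableSet_Ioi
  refine ⟨_, hs, Lp.ext ?_⟩
  filter_upwards [cut_ae hs u, coeFn_posPart_ae u] with x h1 h2
  rw [h1, h2]
  by_cases hx : 0 < u x
  · simp [hx, hx.le]
  · simp [hx, not_lt.1 hx]

/-- Restrictions to an exhausting sequence of sets converge. -/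
theorem tendsto_cut {J : ℕ → Set α} (hJ : ∀ k, MeasurableSet (J k)) (hmono : Monotone J)
    (hex : ∀ᵐ x ∂μ, ∃ k, x ∈ J k) (u : Lp ℝ 1 μ) :
    Tendsto (fun k => cut (J k) u) atTop (𝓝 u) := by
  rw [tendsto_iff_norm_sub_tendsto_zero]
  have h0 : ∀ k, ‖cut (J k) u - u‖ = ∫ x, ‖(J k).indicator u x - u x‖ ∂μ := by
    intro k
    rw [L1.norm_eq_integral_norm]
    refine integral_congr_ae ?_
    filter_upwards [cut_ae (hJ k) u, Lp.coeFn_sub (cut (J k) u) u] with x h1 h2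
    rw [h2, Pi.sub_apply, h1]
  simp only [h0]
  have := tendsto_integral_of_dominated_convergence (μ := μ)
    (F := fun k x => ‖(J k).indicator u x - u x‖) (f := fun _ => (0 : ℝ)) (fun x => ‖u x‖)
    (fun k => (((Lp.stronglyMeasurable u).indicator (hJ k)).sub
      (Lp.stronglyMeasurable u)).norm.aestronglyMeasurable)
    (L1.integrable_coeFn u).norm (fun k => Eventually.of_forall fun x => by
      by_cases hx : x ∈ J k <;> simp [hx])
    (by
      filter_upwards [hex] with x ⟨k, hk⟩
      refine tendsto_const_nhds.congr' ?_
      filter_upwards [eventually_ge_atTop k] with j hj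
      simp [hmono hj hk])
  simpa using this

/-- `L₁` convergence with pointwise identities: multiplication by a fixed function is closed. -/
theorem ae_eq_mul_of_tendsto {a : α → ℝ} {u h : ℕ → Lp ℝ 1 μ} {u₀ h₀ : Lp ℝ 1 μ}
    (hu : Tendsto u atTop (𝓝 u₀)) (hh : Tendsto h atTop (𝓝 h₀))
    (hah : ∀ n, h n =ᵐ[μ] fun x => a x * u n x) : h₀ =ᵐ[μ] fun x => a x * u₀ x := by
  -- A subsequence along which $u$ converges almost everywhere, then a further one for $h$, so that
  -- both limits can be compared pointwise.
  obtain ⟨φ, hφ, h1⟩ := (tendstoInMeasure_of_tendsto_Lp hu).exists_seq_tendsto_ae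
  obtain ⟨ψ, hψ, h2⟩ := (tendstoInMeasure_of_tendsto_Lp
    (hh.comp hφ.tendsto_atTop)).exists_seq_tendsto_ae
  filter_upwards [h1, h2, ae_all_iff.2 hah] with x hx1 hx2 hx3
  refine tendsto_nhds_unique hx2 ?_
  have := (hx1.comp hψ.tendsto_atTop).const_mul (a x)
  refine this.congr fun n => ?_
  exact (hx3 _).symm

end L1

/-! ### Absorption and gain perturbations of substochastic semigroups -/

section Perturbation

variable {α : Type*} [MeasurableSpace α] {μ : Measure α}

/-- The graph of `T - a + B a`. -/
def LossGainGraph (T : Lp ℝ 1 μ → Lp ℝ 1 μ → Prop) (a : α → ℝ) (B : Lp ℝ 1 μ →L[ℝ] Lp ℝ 1 μ)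
    (u f : Lp ℝ 1 μ) : Prop :=
  ∃ g h : Lp ℝ 1 μ, T u g ∧ h =ᵐ[μ] (fun x => a x * u x) ∧ f = g - h + B h

/-- For a positive contraction semigroup, the integral of the generator over `{u > 0}` is
nonpositive. -/
theorem Generates.totalMass_cut_nonpos {T : Lp ℝ 1 μ → Lp ℝ 1 μ → Prop}
    {S : C0Semigroup (Lp ℝ 1 μ)} (hT : Generates T S) (hS : Substochastic S) {s : Set α}
    (hs : MeasurableSet s) {u g : Lp ℝ 1 μ} (hu : cut s u = u⁺) (hg : T u g) :
    totalMass μ (cut s g) ≤ 0 := by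
  have h1 := (((totalMass μ).comp (cut s)).continuous.tendsto g).comp ((hT u g).1 hg)
  refine le_of_tendsto h1 (Eventually.of_forall fun t => ?_)
  simp only [Function.comp, ContinuousLinearMap.comp_apply, map_smul, smul_eq_mul, map_sub]
  refine mul_nonpos_of_nonneg_of_nonpos (by positivity) (sub_nonpos.2 ?_)
  have h2 : S.op t u ≤ S.op t u⁺ := by
    have := (hS t).1 _ (negPart_nonneg u)
    have e : S.op t u⁺ = S.op t u + S.op t u⁻ := by
      rw [← map_add]
      congr 1
      exact (eq_add_of_sub_eq (posPart_sub_negPart u))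
    rw [e]
    exact le_add_of_nonneg_right this
  have h3 : 0 ≤ S.op t u⁺ := (hS t).1 _ (posPart_nonneg u)
  calc totalMass μ (cut s (S.op t u)) ≤ totalMass μ (S.op t u⁺) :=
        totalMass_mono (cut_le_of_le hs h2 h3)
    _ = ‖S.op t u⁺‖ := totalMass_of_nonneg h3
    _ ≤ ‖u⁺‖ := by simpa using (S.op t).le_of_opNorm_le (hS t).2 u⁺
    _ = totalMass μ (cut s u) := by rw [hu, totalMass_of_nonneg (posPart_nonneg u)]

/-- Assumptions under which the operator `T - a + B a` generates a semigroup: `T` generates a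
substochastic semigroup and commutes with the restriction to an exhausting sequence of sets on
which `a` is bounded and which the gain operator `B` leaves invariant, and gain is controlled by
loss. -/
structure LossGainAssumption (T : Lp ℝ 1 μ → Lp ℝ 1 μ → Prop) (S : C0Semigroup (Lp ℝ 1 μ))
    (a : α → ℝ) (B : Lp ℝ 1 μ →L[ℝ] Lp ℝ 1 μ) (J : ℕ → Set α) (δ ω : ℝ) : Prop where
  generates : Generates T S
  substochastic : Substochastic S
  measurableSet : ∀ k, MeasurableSet (J k)
  mono : Monotone J
  exhaust : ∀ᵐ x ∂μ, ∃ k, x ∈ J k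
  cut_mem : ∀ k {u g}, T u g → T (cut (J k) u) (cut (J k) g)
  rate_meas : AEStronglyMeasurable a μ
  rate_nonneg : ∀ᵐ x ∂μ, 0 ≤ a x
  rate_bdd : ∀ k, ∃ c, ∀ᵐ x ∂μ, x ∈ J k → a x ≤ c
  gain_nonneg : ∀ {h}, 0 ≤ h → 0 ≤ B h
  gain_cut : ∀ k h, cut (J k) (B (cut (J k) h)) = B (cut (J k) h)
  delta_pos : 0 < δ
  omega_nonneg : 0 ≤ ω
  gain_le : ∀ {u h : Lp ℝ 1 μ}, 0 ≤ u → h =ᵐ[μ] (fun x => a x * u x) →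
    ‖B h‖ ≤ (1 - δ) * ‖h‖ + ω * ‖u‖

namespace LossGainAssumption

variable {T : Lp ℝ 1 μ → Lp ℝ 1 μ → Prop} {S : C0Semigroup (Lp ℝ 1 μ)}
  {a : α → ℝ} {B : Lp ℝ 1 μ →L[ℝ] Lp ℝ 1 μ} {J : ℕ → Set α} {δ ω : ℝ}

theorem add (H : LossGainAssumption T S a B J δ ω) {u v f g : Lp ℝ 1 μ}
    (hu : LossGainGraph T a B u f) (hv : LossGainGraph T a B v g) :
    LossGainGraph T a B (u + v) (f + g) := by
  obtain ⟨g₁, h₁, hT₁, ha₁, rfl⟩ := hu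
  obtain ⟨g₂, h₂, hT₂, ha₂, rfl⟩ := hv
  refine ⟨g₁ + g₂, h₁ + h₂, H.generates.add hT₁ hT₂, ?_, ?_⟩
  · filter_upwards [ha₁, ha₂, Lp.coeFn_add h₁ h₂, Lp.coeFn_add u v] with x e1 e2 e3 e4
    rw [e3, e4, Pi.add_apply, Pi.add_apply, e1, e2, mul_add]
  · rw [map_add]
    abel

theorem smul (H : LossGainAssumption T S a B J δ ω) (c : ℝ) {u f : Lp ℝ 1 μ}
    (hu : LossGainGraph T a B u f) : LossGainGraph T a B (c • u) (c • f) := by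
  obtain ⟨g, h, hT, ha, rfl⟩ := hu
  refine ⟨c • g, c • h, H.generates.smul c hT, ?_, ?_⟩
  · filter_upwards [ha, Lp.coeFn_smul c h, Lp.coeFn_smul c u] with x e1 e2 e3
    rw [e2, e3, Pi.smul_apply, Pi.smul_apply, e1, smul_eq_mul, smul_eq_mul]
    ring
  · rw [map_smul]
    module

/-- Balance inequality on `{u > 0}`. -/
theorem totalMass_cut_le (H : LossGainAssumption T S a B J δ ω) {s : Set α}
    (hs : MeasurableSet s) {u g h : Lp ℝ 1 μ} (hu : cut s u = u⁺) (hg : T u g)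
    (hh : h =ᵐ[μ] fun x => a x * u x) :
    totalMass μ (cut s (g - h + B h)) + δ * ‖h⁺‖ ≤ ω * ‖u⁺‖ := by
  have h1 := H.generates.totalMass_cut_nonpos H.substochastic hs hu hg
  -- Since $a\ge0$, the set that cuts $u^+$ out of $u$ also cuts $(au)^+$ out of $au$.
  have h2 : cut s h = h⁺ := by
    apply Lp.ext
    have hu' : ∀ᵐ x ∂μ, cut s u x = u⁺ x := by rw [hu]; exact Eventually.of_forall fun _ => rfl
    filter_upwards [hu', cut_ae hs u, coeFn_posPart_ae u, cut_ae hs h, coeFn_posPart_ae h, hh,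
      H.rate_nonneg] with x e1 e2 e3 e4 e5 e6 e7
    rw [e2, e3] at e1
    rw [e4, e5]
    by_cases hx : x ∈ s
    · simp only [hx, indicator_of_mem] at e1 ⊢
      rw [eq_comm, max_eq_left_iff, e6]
      exact mul_nonneg e7 (max_eq_left_iff.1 e1.symm)
    · simp only [hx, not_false_eq_true, indicator_of_notMem] at e1 ⊢
      rw [eq_comm, max_eq_right_iff, e6]
      exact mul_nonpos_of_nonneg_of_nonpos e7 (max_eq_right_iff.1 e1.symm)
  have h3 : ⇑(h⁺) =ᵐ[μ] fun x => a x * u⁺ x := by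
    filter_upwards [coeFn_posPart_ae u, coeFn_posPart_ae h, hh, H.rate_nonneg] with x e1 e2 e3 e4
    rw [e1, e2, e3, mul_max_of_nonneg _ _ e4, mul_zero]
  have h4 := H.gain_le (posPart_nonneg u) h3
  have h5 : 0 ≤ B h⁺ := H.gain_nonneg (posPart_nonneg h)
  have h6 : B h ≤ B h⁺ := by
    have := H.gain_nonneg (negPart_nonneg h)
    have e : B h⁺ = B h + B h⁻ := by
      rw [← map_add]
      congr 1
      exact (eq_add_of_sub_eq (posPart_sub_negPart h))
    rw [e]
    exact le_add_of_nonneg_right this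
  have h7 : totalMass μ (cut s (B h)) ≤ ‖B h⁺‖ := by
    rw [← totalMass_of_nonneg h5]
    exact totalMass_mono (cut_le_of_le hs h6 h5)
  rw [map_add, map_sub, map_add, map_sub, h2, totalMass_of_nonneg (posPart_nonneg h)]
  linarith

/-- The case of the whole space. Along a nonnegative orbit it is the differential inequality for the
norm, and the retained term $\delta\|h\|$ is what drives the smoothing. -/
theorem totalMass_le_of_nonneg (H : LossGainAssumption T S a B J δ ω) {u g h : Lp ℝ 1 μ}
    (hu : 0 ≤ u) (hg : T u g) (hh : h =ᵐ[μ] fun x => a x * u x) :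
    totalMass μ (g - h + B h) + δ * ‖h‖ ≤ ω * ‖u‖ := by
  have h0 : 0 ≤ h := by
    rw [← Lp.coeFn_nonneg] at hu ⊢
    filter_upwards [hu, hh, H.rate_nonneg] with x e1 e2 e3
    rw [e2]
    exact mul_nonneg e3 e1
  have := H.totalMass_cut_le MeasurableSet.univ (u := u)
    (by rw [cut_univ, posPart_of_nonneg hu]) hg hh
  rwa [cut_univ, posPart_of_nonneg hu, posPart_of_nonneg h0] at this

/-- The dispersivity estimate. -/
theorem norm_posPart_le (H : LossGainAssumption T S a B J δ ω) (lam : ℝ) {u g h : Lp ℝ 1 μ}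
    (hg : T u g) (hh : h =ᵐ[μ] fun x => a x * u x) :
    (lam - ω) * ‖u⁺‖ + δ * ‖h⁺‖ ≤ ‖(lam • u - (g - h + B h))⁺‖ := by
  obtain ⟨s, hs, hsu⟩ := exists_cut_eq_posPart u
  have h1 := H.totalMass_cut_le hs hsu hg hh
  have h2 := totalMass_mono (cut_le_posPart hs (lam • u - (g - h + B h)))
  rw [totalMass_of_nonneg (posPart_nonneg _), map_sub, map_sub, map_smul, map_smul, hsu,
    totalMass_of_nonneg (posPart_nonneg u), smul_eq_mul] at h2
  linarith

/-- The estimate for positive parts is applied to $u$ and $-u$ and added. The term $\delta\|h\|$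
controls the loss $au$ by the right-hand side and so keeps limits inside the domain of
multiplication by $a$. -/
theorem norm_le (H : LossGainAssumption T S a B J δ ω) (lam : ℝ) {u g h : Lp ℝ 1 μ}
    (hg : T u g) (hh : h =ᵐ[μ] fun x => a x * u x) :
    (lam - ω) * ‖u‖ + δ * ‖h‖ ≤ ‖lam • u - (g - h + B h)‖ := by
  have h1 := H.norm_posPart_le lam hg hh
  have hg' : T (-u) (-g) := by simpa using H.generates.smul (-1) hg
  have hh' : (-h : Lp ℝ 1 μ) =ᵐ[μ] fun x => a x * (-u : Lp ℝ 1 μ) x := by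
    filter_upwards [hh, Lp.coeFn_neg h, Lp.coeFn_neg u] with x e1 e2 e3
    rw [e2, e3, Pi.neg_apply, Pi.neg_apply, e1, mul_neg]
  have h2 := H.norm_posPart_le lam hg' hh'
  have e : lam • (-u) - (-g - -h + B (-h)) = -(lam • u - (g - h + B h)) := by
    rw [map_neg]; module
  rw [e] at h2
  rw [← norm_posPart_add_norm_posPart_neg (lam • u - (g - h + B h)),
    ← norm_posPart_add_norm_posPart_neg u, ← norm_posPart_add_norm_posPart_neg h]
  linarith

/-- For $-u$ the right-hand side of the dispersivity estimate is the norm of $(-(\lambda u-f))^+=0$,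
so $u$ has no negative part. -/
theorem nonneg_of_sub_nonneg (H : LossGainAssumption T S a B J δ ω) {lam : ℝ} (hl : ω < lam)
    {u f : Lp ℝ 1 μ} (hu : LossGainGraph T a B u f) (hf : 0 ≤ lam • u - f) : 0 ≤ u := by
  obtain ⟨g, h, hg, hh, rfl⟩ := hu
  have hg' : T (-u) (-g) := by simpa using H.generates.smul (-1) hg
  have hh' : (-h : Lp ℝ 1 μ) =ᵐ[μ] fun x => a x * (-u : Lp ℝ 1 μ) x := by
    filter_upwards [hh, Lp.coeFn_neg h, Lp.coeFn_neg u] with x e1 e2 e3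
    rw [e2, e3, Pi.neg_apply, Pi.neg_apply, e1, mul_neg]
  have h2 := H.norm_posPart_le lam hg' hh'
  have e : lam • (-u) - (-g - -h + B (-h)) = -(lam • u - (g - h + B h)) := by
    rw [map_neg]; module
  rw [e, posPart_of_nonpos (neg_nonpos.2 hf), norm_zero] at h2
  have h3 : ‖(-u)⁺‖ ≤ 0 := by
    have := mul_nonneg H.delta_pos.le (norm_nonneg (-h)⁺)
    by_contra! h4
    nlinarith
  have h4 := norm_le_zero_iff.1 h3
  have h5 := le_posPart (-u)
  rw [h4] at h5
  exact neg_nonpos.1 h5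

/-- Solvability of the resolvent equation for data supported in `J k`. -/
theorem exists_resolvent_cut (H : LossGainAssumption T S a B J δ ω) {lam : ℝ} (hl : ω < lam)
    (k : ℕ) {f : Lp ℝ 1 μ} (hf : cut (J k) f = f) :
    ∃ u, LossGainGraph T a B u (lam • u - f) := by
  have hJ := H.measurableSet k
  have hω := H.omega_nonneg
  obtain ⟨c, hc⟩ := H.rate_bdd k
  wlog hc0 : 0 ≤ c generalizing c
  · exact this 0 (hc.mono fun x hx hxk => (hx hxk).trans (not_le.1 hc0).le) le_rfl
  have hbd : ∀ᵐ x ∂μ, |(J k).indicator a x| ≤ c := by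
    filter_upwards [hc, H.rate_nonneg] with x h1 h2
    by_cases hx : x ∈ J k
    · simpa [hx, abs_of_nonneg h2] using h1 hx
    · simpa [hx] using hc0
  obtain ⟨A, hA, -⟩ := exists_mul_clm (H.rate_meas.indicator hJ) hc0 hbd
  have hAcut : ∀ u, cut (J k) (A u) = A u := by
    intro u
    apply Lp.ext
    filter_upwards [cut_ae hJ (A u), hA u] with x h1 h2
    rw [h1]
    by_cases hx : x ∈ J k <;> simp [hx, h2]
  have hAnn : ∀ {u}, 0 ≤ u → 0 ≤ A u := by
    intro u hu
    rw [← Lp.coeFn_nonneg] at hu ⊢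
    filter_upwards [hu, hA u, H.rate_nonneg] with x e1 e2 e3
    rw [e2]
    by_cases hx : x ∈ J k
    · simpa [hx] using mul_nonneg e3 e1
    · simp [hx]
  have hAmul : ∀ u, A u =ᵐ[μ] fun x => a x * (cut (J k) u) x := by
    intro u
    filter_upwards [cut_ae hJ u, hA u] with x h1 h2
    rw [h1, h2]
    by_cases hx : x ∈ J k <;> simp [hx]
  have hAc : ∀ {u}, 0 ≤ u → A u ≤ c • u := by
    intro u hu
    rw [← Lp.coeFn_nonneg] at hu
    rw [← Lp.coeFn_le]
    filter_upwards [hu, hA u, Lp.coeFn_smul c u, hbd] with x e1 e2 e3 e4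
    rw [e2, e3, Pi.smul_apply, smul_eq_mul]
    exact mul_le_mul_of_nonneg_right ((le_abs_self _).trans e4) e1
  -- the bounded part of the operator
  set L : Lp ℝ 1 μ →L[ℝ] Lp ℝ 1 μ := c • 1 - A + B.comp A with hL
  have hLapp : ∀ u, L u = c • u - A u + B (A u) := fun u => by simp [hL]
  have hLnn : ∀ {u}, 0 ≤ u → 0 ≤ L u := by
    intro u hu
    rw [hLapp]
    exact add_nonneg (sub_nonneg.2 (hAc hu)) (H.gain_nonneg (hAnn hu))
  -- On the cone, $\|Lu\|=c\|u\|-\|Au\|+\|BAu\|$, and gain does not exceed loss up to $\omega\|u\|$: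
  -- the possibly large norms of $A$ and $B$ do not enter.
  have hLb : ∀ {u}, 0 ≤ u → ‖L u‖ ≤ (c + ω) * ‖u‖ := by
    intro u hu
    have h1 := H.gain_le (cut_nonneg hJ hu) (hAmul u)
    have h2 : ‖cut (J k) u‖ ≤ ‖u‖ := norm_cut_le hJ u
    have h3 : ‖B (A u)‖ ≤ ‖A u‖ + ω * ‖u‖ := by
      have := mul_nonneg H.delta_pos.le (norm_nonneg (A u))
      have := mul_le_mul_of_nonneg_left h2 hω
      linarith
    rw [← totalMass_of_nonneg (hLnn hu), hLapp, map_add, map_sub, map_smul,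
      totalMass_of_nonneg (hAnn hu), totalMass_of_nonneg (H.gain_nonneg (hAnn hu)),
      totalMass_of_nonneg hu, smul_eq_mul]
    linarith
  have hLn : ‖L‖ ≤ c + ω := by
    refine L.opNorm_le_bound (by positivity) fun u => ?_
    have e : L u = L u⁺ - L (-u)⁺ := by
      rw [← map_sub, posPart_neg, posPart_sub_negPart]
    rw [e, ← norm_posPart_add_norm_posPart_neg u, mul_add]
    exact (norm_sub_le _ _).trans (add_le_add (hLb (posPart_nonneg _)) (hLb (posPart_nonneg _)))
  -- the resolvent of the transport operator
  have hTq : QuasiMDissipative T 0 :=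
    { nonneg := le_rfl
      add := H.generates.add
      smul := H.generates.smul
      dissipative := fun hm _ _ hT => by
        simpa using H.generates.dissipative (fun t => (H.substochastic t).2) hm hT
      surjective := fun hm f => H.generates.exists_resolvent (fun t => (H.substochastic t).2) hm f
      dense := H.generates.dense }
  -- On $J_k$ the equation reads $(\lambda+c-T)u=f+Lu$. Since $\|L\|\le c+\omega<\lambda+c$, the map
  -- $RL$ is a strict contraction. The fixed point is afterwards restricted to $J_k$, which every
  -- term respects.
  have hlc : 0 < lam + c := by linarith
  obtain ⟨R, hRn, hR⟩ := hTq.exists_resolvent hlc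
  rw [sub_zero] at hRn
  have hRL : ‖R.comp L‖ < 1 := by
    calc ‖R.comp L‖ ≤ ‖R‖ * ‖L‖ := R.opNorm_comp_le L
      _ ≤ (lam + c)⁻¹ * (c + ω) := by gcongr
      _ < 1 := by rw [inv_mul_lt_one₀ hlc]; linarith
  obtain ⟨W, hW⟩ := isUnit_one_sub_of_norm_lt_one hRL
  set u : Lp ℝ 1 μ := (↑W⁻¹ : Lp ℝ 1 μ →L[ℝ] Lp ℝ 1 μ) (R f) with hu
  have hfix : u = R (f + L u) := by
    have h1 : ((1 - R.comp L) * (↑W⁻¹ : Lp ℝ 1 μ →L[ℝ] Lp ℝ 1 μ)) (R f) = R f := by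
      rw [← hW]; simp
    have h2 : u - R (L u) = R f := h1
    rw [map_add, ← h2, sub_add_cancel]
  have hTu : T u ((lam + c) • u - (f + L u)) := by
    have := hR (f + L u)
    rwa [← hfix] at this
  have hTv := H.cut_mem k hTu
  refine ⟨cut (J k) u, _, A u, hTv, hAmul u, ?_⟩
  have hBA : cut (J k) (B (A u)) = B (A u) := by
    have := H.gain_cut k (A u)
    rwa [hAcut] at this
  rw [hLapp]
  simp only [map_sub, map_add, map_smul, hf, hAcut, hBA]
  module

/-- Solutions for the truncated data form a Cauchy sequence together with their losses $au_k$, by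
`norm_le`. Boundedness of $B$ then makes $Tu_k$ converge, and $T$ is closed. -/
theorem exists_resolvent (H : LossGainAssumption T S a B J δ ω) {lam : ℝ} (hl : ω < lam)
    (f : Lp ℝ 1 μ) : ∃ u, LossGainGraph T a B u (lam • u - f) := by
  choose u hu using fun k => H.exists_resolvent_cut hl k (cut_cut (H.measurableSet k) f)
  choose g h hg hh hgh using hu
  have hlim := tendsto_cut H.measurableSet H.mono H.exhaust f
  have hl' : 0 < lam - ω := sub_pos.2 hl
  have key : ∀ j k, (lam - ω) * ‖u j - u k‖ + δ * ‖h j - h k‖ ≤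
      ‖cut (J j) f - cut (J k) f‖ := by
    intro j k
    have h1 := H.norm_le lam (H.generates.sub (hg j) (hg k)) (h := h j - h k) (by
      filter_upwards [hh j, hh k, Lp.coeFn_sub (h j) (h k), Lp.coeFn_sub (u j) (u k)]
        with x e1 e2 e3 e4
      rw [e3, e4, Pi.sub_apply, Pi.sub_apply, e1, e2, mul_sub])
    have e : lam • (u j - u k) - (g j - g k - (h j - h k) + B (h j - h k)) =
        cut (J j) f - cut (J k) f := by
      have e1 := hgh j
      have e2 := hgh k
      rw [sub_eq_iff_eq_add] at e1 e2
      rw [smul_sub, e1, e2, map_sub]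
      abel
    rwa [e] at h1
  have hcu : CauchySeq u := by
    rw [Metric.cauchySeq_iff]
    intro ε hε
    obtain ⟨N, hN⟩ := Metric.cauchySeq_iff.1 hlim.cauchySeq ((lam - ω) * ε) (by positivity)
    refine ⟨N, fun m hm n hn => ?_⟩
    have h1 := hN m hm n hn
    rw [dist_eq_norm] at h1 ⊢
    have h2 := key m n
    have h3 := mul_nonneg H.delta_pos.le (norm_nonneg (h m - h n))
    exact lt_of_mul_lt_mul_left (by linarith) hl'.le
  have hch : CauchySeq h := by
    rw [Metric.cauchySeq_iff]
    intro ε hε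
    have hδ := H.delta_pos
    obtain ⟨N, hN⟩ := Metric.cauchySeq_iff.1 hlim.cauchySeq (δ * ε) (by positivity)
    refine ⟨N, fun m hm n hn => ?_⟩
    have h1 := hN m hm n hn
    rw [dist_eq_norm] at h1 ⊢
    have h2 := key m n
    have h3 := mul_nonneg hl'.le (norm_nonneg (u m - u n))
    exact lt_of_mul_lt_mul_left (by linarith) hδ.le
  obtain ⟨u₀, hu₀⟩ := cauchySeq_tendsto_of_complete hcu
  obtain ⟨h₀, hh₀⟩ := cauchySeq_tendsto_of_complete hch
  have hg₀ : Tendsto g atTop (𝓝 (lam • u₀ - f + h₀ - B h₀)) := by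
    have h1 := (((hu₀.const_smul lam).sub hlim).add hh₀).sub ((B.continuous.tendsto h₀).comp hh₀)
    refine h1.congr fun k => ?_
    simp only [Function.comp, hgh k]
    abel
  -- closedness of the transport operator
  obtain ⟨v, hv⟩ := H.generates.exists_resolvent (fun t => (H.substochastic t).2) zero_lt_one
    (u₀ - (lam • u₀ - f + h₀ - B h₀))
  have hvu : v = u₀ := by
    have h1 : Tendsto (fun k => u k - g k) atTop (𝓝 (u₀ - (lam • u₀ - f + h₀ - B h₀))) :=
      hu₀.sub hg₀
    have h2 : ∀ k, ‖u k - v‖ ≤ ‖(u k - g k) - (u₀ - (lam • u₀ - f + h₀ - B h₀))‖ := by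
      intro k
      have := H.generates.dissipative (fun t => (H.substochastic t).2) zero_lt_one
        (H.generates.sub (hg k) hv)
      rw [one_mul] at this
      refine this.trans_eq (congrArg _ ?_)
      module
    have h3 : Tendsto u atTop (𝓝 v) := by
      rw [tendsto_iff_norm_sub_tendsto_zero] at h1 ⊢
      exact squeeze_zero (fun _ => norm_nonneg _) h2 h1
    exact tendsto_nhds_unique h3 hu₀
  subst hvu
  refine ⟨v, _, h₀, hv, ae_eq_mul_of_tendsto hu₀ hh₀ hh, ?_⟩
  module

/-- Truncating an element of the domain of $T$ to $J_k$ keeps it there and makes the loss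
integrable, as $a$ is bounded on $J_k$. -/
theorem dense (H : LossGainAssumption T S a B J δ ω) :
    Dense {u | ∃ f, LossGainGraph T a B u f} := by
  have h1 : ∀ u ∈ {u | ∃ g, T u g}, u ∈ closure {u | ∃ f, LossGainGraph T a B u f} := by
    rintro u ⟨g, hg⟩
    refine mem_closure_of_tendsto (tendsto_cut H.measurableSet H.mono H.exhaust u)
      (Eventually.of_forall fun k => ?_)
    have hJ := H.measurableSet k
    obtain ⟨c, hc⟩ := H.rate_bdd k
    have hbd : ∀ᵐ x ∂μ, |(J k).indicator a x| ≤ max c 0 := by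
      filter_upwards [hc, H.rate_nonneg] with x h1 h2
      by_cases hx : x ∈ J k
      · simpa [hx, abs_of_nonneg h2] using Or.inl (h1 hx)
      · simp [hx]
    obtain ⟨A, hA, -⟩ := exists_mul_clm (H.rate_meas.indicator hJ) (le_max_right c 0) hbd
    refine ⟨_, _, A u, H.cut_mem k hg, ?_, rfl⟩
    filter_upwards [cut_ae hJ u, hA u] with x h1 h2
    rw [h1, h2]
    by_cases hx : x ∈ J k <;> simp [hx]
  exact dense_closure.1 (H.generates.dense.mono h1)

theorem quasiMDissipative (H : LossGainAssumption T S a B J δ ω) :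
    QuasiMDissipative (LossGainGraph T a B) ω where
  nonneg := H.omega_nonneg
  add := H.add
  smul := H.smul
  dissipative := by
    rintro lam hl u f ⟨g, h, hg, hh, rfl⟩
    have := H.norm_le lam hg hh
    have := mul_nonneg H.delta_pos.le (norm_nonneg h)
    linarith
  surjective := H.exists_resolvent
  dense := H.dense

/-- The operator `T - a + B a` generates a positive semigroup. -/
theorem exists_semigroup (H : LossGainAssumption T S a B J δ ω) :
    ∃ G : C0Semigroup (Lp ℝ 1 μ), Generates (LossGainGraph T a B) G ∧
      (∀ t : ℝ≥0, ‖G.op t‖ ≤ Real.exp (2 * ω * t)) ∧ ∀ t u, 0 ≤ u → 0 ≤ G.op t u :=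
  H.quasiMDissipative.exists_semigroup (P := {u | 0 ≤ u}) isClosed_nonneg
    (show (0 : Lp ℝ 1 μ) ≤ 0 from le_rfl)
    (fun u (hu : 0 ≤ u) v (hv : 0 ≤ v) => (add_nonneg hu hv : 0 ≤ u + v))
    (fun c hc u (hu : 0 ≤ u) => by
      change 0 ≤ c • u
      rw [← Lp.coeFn_nonneg] at hu ⊢
      filter_upwards [hu, Lp.coeFn_smul c u] with x e1 e2
      rw [e2, Pi.smul_apply, smul_eq_mul]
      exact mul_nonneg hc e1)
    fun _ hl _ _ hu hf => H.nonneg_of_sub_nonneg hl hu hf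

end LossGainAssumption

end Perturbation

/-! ### Conjugation of semigroups -/

/-- Conjugation of a semigroup by an isomorphism. -/
def C0Semigroup.conj {X Y : Type*} [NormedAddCommGroup X] [NormedSpace ℝ X]
    [NormedAddCommGroup Y] [NormedSpace ℝ Y] (S : C0Semigroup Y) (W : X →L[ℝ] Y) (V : Y →L[ℝ] X)
    (hVW : ∀ u, V (W u) = u) (hWV : ∀ y, W (V y) = y) : C0Semigroup X where
  op t := V.comp ((S.op t).comp W)
  op_zero := by
    ext u
    simp [S.op_zero, hVW]
  op_add s t := by
    ext u
    simp [S.op_add, hWV]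
  tendsto_zero u := by
    have := (V.continuous.tendsto _).comp (S.tendsto_zero (W u))
    rw [hVW] at this
    exact this

theorem Generates.conj {X Y : Type*} [NormedAddCommGroup X] [NormedSpace ℝ X]
    [NormedAddCommGroup Y] [NormedSpace ℝ Y] {S : C0Semigroup Y} {R : Y → Y → Prop}
    (h : Generates R S) (W : X →L[ℝ] Y) (V : Y →L[ℝ] X)
    (hVW : ∀ u, V (W u) = u) (hWV : ∀ y, W (V y) = y) :
    Generates (fun u f => R (W u) (W f)) (S.conj W V hVW hWV) := by
  intro u f
  change R (W u) (W f) ↔ _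
  rw [h]
  constructor
  · intro h1
    have := (V.continuous.tendsto _).comp h1
    rw [hVW] at this
    refine this.congr fun t => ?_
    simp [C0Semigroup.conj, hVW]
  · intro h1
    refine ((W.continuous.tendsto _).comp h1).congr fun t => ?_
    simp [C0Semigroup.conj, hWV]

/-! ### The weighted measures -/

section Weighted

variable {N : ℕ} {Ω : Set (EuclideanSpace ℝ (Fin N))}

/-- The unweighted measure `dx dm` on `Ω × [0, ∞)`. -/
abbrev baseMeasure (Ω : Set (EuclideanSpace ℝ (Fin N))) :
    Measure (EuclideanSpace ℝ (Fin N) × ℝ) :=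
  (spaceMeasure Ω).prod sizeMeasure

theorem measurable_weight (r : ℝ) :
    Measurable fun z : EuclideanSpace ℝ (Fin N) × ℝ => ENNReal.ofReal (1 + z.2 ^ r) := by
  fun_prop

theorem stateMeasure_eq (r : ℝ) : stateMeasure Ω r =
    (baseMeasure Ω).withDensity fun z => ENNReal.ofReal (1 + z.2 ^ r) := by
  rw [stateMeasure, weightedSizeMeasure, prod_withDensity_right (by fun_prop)]

theorem ae_size_nonneg : ∀ᵐ m ∂sizeMeasure, 0 ≤ m :=
  ae_restrict_mem measurableSet_Ici

theorem ae_base_of_ae_size {P : ℝ → Prop} (h : ∀ᵐ m ∂sizeMeasure, P m) :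
    ∀ᵐ z ∂baseMeasure Ω, P z.2 :=
  Measure.quasiMeasurePreserving_snd.ae h

theorem ae_base_snd_nonneg : ∀ᵐ z ∂baseMeasure Ω, 0 ≤ z.2 :=
  ae_base_of_ae_size ae_size_nonneg

theorem one_le_weight {m : ℝ} (hm : 0 ≤ m) (r : ℝ) : 1 ≤ 1 + m ^ r :=
  le_add_of_nonneg_right (Real.rpow_nonneg hm r)

theorem weight_pos {m : ℝ} (hm : 0 ≤ m) (r : ℝ) : 0 < 1 + m ^ r :=
  zero_lt_one.trans_le (one_le_weight hm r)

/-- The weight is at least $1$ and finite, so all the weighted measures have the null sets of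
$dx\,dm$; almost-everywhere statements can move between exponents. -/
theorem ae_state_iff {r : ℝ} {P : EuclideanSpace ℝ (Fin N) × ℝ → Prop} :
    (∀ᵐ z ∂stateMeasure Ω r, P z) ↔ ∀ᵐ z ∂baseMeasure Ω, P z := by
  rw [stateMeasure_eq]
  constructor
  · intro h
    refine (withDensity_absolutelyContinuous' (measurable_weight r).aemeasurable ?_).ae_le h
    filter_upwards [ae_base_snd_nonneg] with z hz
    exact (ENNReal.ofReal_pos.2 (weight_pos hz r)).ne'
  · intro h
    exact (withDensity_absolutelyContinuous _ _).ae_le h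

theorem aeStronglyMeasurable_state_iff {r : ℝ} {f : EuclideanSpace ℝ (Fin N) × ℝ → ℝ} :
    AEStronglyMeasurable f (stateMeasure Ω r) ↔ AEStronglyMeasurable f (baseMeasure Ω) := by
  constructor
  · rintro ⟨g, hg, hfg⟩
    exact ⟨g, hg, ae_state_iff.1 hfg⟩
  · rintro ⟨g, hg, hfg⟩
    exact ⟨g, hg, ae_state_iff.2 hfg⟩

theorem lintegral_state (r : ℝ) {f : EuclideanSpace ℝ (Fin N) × ℝ → ℝ≥0∞}
    (hf : AEMeasurable f (baseMeasure Ω)) :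
    ∫⁻ z, f z ∂stateMeasure Ω r = ∫⁻ z, ENNReal.ofReal (1 + z.2 ^ r) * f z ∂baseMeasure Ω := by
  rw [stateMeasure_eq, lintegral_withDensity_eq_lintegral_mul₀
    (measurable_weight r).aemeasurable hf]
  rfl

theorem lintegral_state_enorm (r : ℝ) {f : EuclideanSpace ℝ (Fin N) × ℝ → ℝ}
    (hf : AEStronglyMeasurable f (baseMeasure Ω)) :
    ∫⁻ z, ‖f z‖ₑ ∂stateMeasure Ω r =
      ∫⁻ z, ENNReal.ofReal (1 + z.2 ^ r) * ‖f z‖ₑ ∂baseMeasure Ω :=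
  lintegral_state r hf.enorm

theorem ofReal_norm_state {r : ℝ} (u : StateSpace Ω r) :
    ENNReal.ofReal ‖u‖ = ∫⁻ z, ENNReal.ofReal (1 + z.2 ^ r) * ‖u z‖ₑ ∂baseMeasure Ω := by
  rw [← lintegral_enorm_coeFn,
    lintegral_state_enorm r (Lp.stronglyMeasurable u).aestronglyMeasurable]

theorem ae_ae_of_ae_base {P : EuclideanSpace ℝ (Fin N) × ℝ → Prop}
    (h : ∀ᵐ z ∂baseMeasure Ω, P z) : ∀ᵐ m ∂sizeMeasure, ∀ᵐ x ∂spaceMeasure Ω, P (x, m) := by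
  have h1 : ∀ᵐ z ∂sizeMeasure.prod (spaceMeasure Ω), P z.swap :=
    (Measure.measurePreserving_swap (μ := sizeMeasure)
      (ν := spaceMeasure Ω)).quasiMeasurePreserving.ae h
  exact Measure.ae_ae_of_ae_prod h1

/-- Pointwise multiplication by a weight as an operator between the weighted spaces. -/
theorem exists_weight_clm {p q : ℝ} (w : ℝ → ℝ) (hw : Measurable w) (C : ℝ) (hC : 0 ≤ C)
    (hwC : ∀ m, 0 ≤ m → |w m| * (1 + m ^ q) ≤ C * (1 + m ^ p)) :
    ∃ L : StateSpace Ω p →L[ℝ] StateSpace Ω q,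
      (∀ u, L u =ᵐ[baseMeasure Ω] fun z => w z.2 * u z) ∧ ‖L‖ ≤ C := by
  have hmeas : ∀ u : StateSpace Ω p, AEStronglyMeasurable (fun z => w z.2 * u z) (baseMeasure Ω) :=
    fun u => ((hw.comp measurable_snd).mul
      (Lp.stronglyMeasurable u).measurable).aestronglyMeasurable
  obtain ⟨L, hL, hLn⟩ := exists_clm_of_lintegral_le (μ := stateMeasure Ω p) (ν := stateMeasure Ω q)
    (fun u z => w z.2 * u z) C hC (fun u => aeStronglyMeasurable_state_iff.2 (hmeas u))
    (fun u v => by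
      refine ae_state_iff.2 ?_
      filter_upwards [ae_state_iff.1 (Lp.coeFn_add u v)] with z hz
      rw [hz, Pi.add_apply, mul_add])
    (fun c u => by
      refine ae_state_iff.2 ?_
      filter_upwards [ae_state_iff.1 (Lp.coeFn_smul c u)] with z hz
      rw [hz, Pi.smul_apply, smul_eq_mul]
      ring)
    (fun u => by
      rw [lintegral_state_enorm q (hmeas u), ENNReal.ofReal_mul hC, ofReal_norm_state,
        ← lintegral_const_mul' _ _ ENNReal.ofReal_ne_top]
      refine lintegral_mono_ae ?_
      filter_upwards [ae_base_snd_nonneg] with z hz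
      rw [enorm_mul, ← mul_assoc, ← mul_assoc, Real.enorm_eq_ofReal_abs (w z.2),
        ← ENNReal.ofReal_mul (weight_pos hz q).le, ← ENNReal.ofReal_mul hC]
      gcongr ENNReal.ofReal ?_ * _
      rw [mul_comm]
      exact hwC _ hz)
  exact ⟨L, fun u => ae_state_iff.1 (hL u), hLn⟩

/-! ### Transport in the weighted spaces -/

variable {T₀ : ℝ → SpaceL1 Ω →ₗ.[ℝ] SpaceL1 Ω}

/-- The transport operator commutes with multiplication by functions of the size. -/
theorem TransportGraph.mul {p q : ℝ} {u f : StateSpace Ω p} {u' f' : StateSpace Ω q}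
    (h : TransportGraph T₀ p u f) (c : ℝ → ℝ) (hu : u' =ᵐ[baseMeasure Ω] fun z => c z.2 * u z)
    (hf : f' =ᵐ[baseMeasure Ω] fun z => c z.2 * f z) : TransportGraph T₀ q u' f' := by
  filter_upwards [h, ae_ae_of_ae_base hu, ae_ae_of_ae_base hf] with m ⟨v, hv, hTv⟩ hum hfm
  refine ⟨c m • v, ?_, ?_⟩
  · filter_upwards [hv, hum, Lp.coeFn_smul (c m) v.1] with x e1 e2 e3
    rw [e2, Submodule.coe_smul, e3, Pi.smul_apply, smul_eq_mul, e1]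
  · filter_upwards [hTv, hfm, Lp.coeFn_smul (c m) (T₀ m v)] with x e1 e2 e3
    rw [e2, LinearPMap.map_smul, e3, Pi.smul_apply, smul_eq_mul, e1]

/-- The transport operator generates a substochastic semigroup in every weighted space. -/
theorem TransportAssumption.exists_semigroup {ρ : ℝ} (h : TransportAssumption Ω T₀ ρ) (p : ℝ) :
    ∃ S : C0Semigroup (StateSpace Ω p), Generates (TransportGraph T₀ p) S ∧ Substochastic S := by
  obtain ⟨-, -, S, hS, hsub, -⟩ := h
  have hw : ∀ q r m : ℝ, 0 ≤ m → |(1 + m ^ r) / (1 + m ^ q)| * (1 + m ^ q) ≤ 1 * (1 + m ^ r) := by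
    intro q r m hm
    rw [abs_of_pos (div_pos (weight_pos hm r) (weight_pos hm q)),
      div_mul_cancel₀ _ (weight_pos hm q).ne', one_mul]
  -- Multiplication by the quotient of the two weights is an isometric, order-preserving bijection
  -- whose inverse is $V$. It depends on $m$ only, so it commutes with transport, and conjugating by
  -- it changes the exponent.
  obtain ⟨W, hW, hWn⟩ := exists_weight_clm (Ω := Ω) (p := p) (q := ρ)
    (fun m => (1 + m ^ p) / (1 + m ^ ρ)) (by fun_prop) 1 zero_le_one (hw ρ p)
  obtain ⟨V, hV, hVn⟩ := exists_weight_clm (Ω := Ω) (p := ρ) (q := p)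
    (fun m => (1 + m ^ ρ) / (1 + m ^ p)) (by fun_prop) 1 zero_le_one (hw p ρ)
  have hVW : ∀ u, V (W u) = u := by
    intro u
    refine Lp.ext (ae_state_iff.2 ?_)
    filter_upwards [hV (W u), hW u, ae_base_snd_nonneg] with z e1 e2 hz
    have h1 := (weight_pos hz p).ne'
    have h2 := (weight_pos hz ρ).ne'
    rw [e1, e2]
    field_simp
  have hWV : ∀ u, W (V u) = u := by
    intro u
    refine Lp.ext (ae_state_iff.2 ?_)
    filter_upwards [hV u, hW (V u), ae_base_snd_nonneg] with z e1 e2 hz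
    have h1 := (weight_pos hz p).ne'
    have h2 := (weight_pos hz ρ).ne'
    rw [e2, e1]
    field_simp
  refine ⟨S.conj W V hVW hWV, ?_, fun t => ⟨fun u hu => ?_, ?_⟩⟩
  · intro u f
    rw [← hS.conj W V hVW hWV u f]
    refine ⟨fun h => h.mul (fun m => (1 + m ^ p) / (1 + m ^ ρ)) (hW u) (hW f), fun h => ?_⟩
    have h1 := hV (W u)
    have h2 := hV (W f)
    rw [hVW] at h1 h2
    exact h.mul (fun m => (1 + m ^ ρ) / (1 + m ^ p)) h1 h2
  · have h1 : 0 ≤ W u := by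
      rw [← Lp.coeFn_nonneg] at hu ⊢
      refine ae_state_iff.2 ?_
      filter_upwards [ae_state_iff.1 hu, hW u, ae_base_snd_nonneg] with z e1 e2 hz
      rw [e2]
      exact mul_nonneg (div_pos (weight_pos hz p) (weight_pos hz ρ)).le e1
    have h2 := (hsub t).1 _ h1
    change 0 ≤ V (S.op t (W u))
    rw [← Lp.coeFn_nonneg] at h2 ⊢
    refine ae_state_iff.2 ?_
    filter_upwards [ae_state_iff.1 h2, hV (S.op t (W u)), ae_base_snd_nonneg] with z e1 e2 hz
    rw [e2]
    exact mul_nonneg (div_pos (weight_pos hz ρ) (weight_pos hz p)).le e1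
  · refine (ContinuousLinearMap.opNorm_comp_le _ _).trans ?_
    refine mul_le_one₀ hVn (norm_nonneg _) ((ContinuousLinearMap.opNorm_comp_le _ _).trans ?_)
    exact mul_le_one₀ (hsub t).2 (norm_nonneg _) hWn

end Weighted

/-! ### Moments of the fragmentation kernel -/

section Moments

variable {N : ℕ} {Ω : Set (EuclideanSpace ℝ (Fin N))}
  {b : EuclideanSpace ℝ (Fin N) → ℝ → ℝ → ℝ} {b₀ l : ℝ}

/-- Exchange of the last two variables. -/
def exchange (N : ℕ) :
    (EuclideanSpace ℝ (Fin N) × ℝ) × ℝ ≃ᵐ (EuclideanSpace ℝ (Fin N) × ℝ) × ℝ :=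
  MeasurableEquiv.prodAssoc.trans
    (((MeasurableEquiv.refl _).prodCongr MeasurableEquiv.prodComm).trans
      MeasurableEquiv.prodAssoc.symm)

theorem exchange_apply (x : EuclideanSpace ℝ (Fin N)) (m s : ℝ) :
    exchange N ((x, m), s) = ((x, s), m) := rfl

theorem measurePreserving_exchange :
    MeasurePreserving (exchange N) ((baseMeasure Ω).prod sizeMeasure)
      ((baseMeasure Ω).prod sizeMeasure) := by
  have h1 : MeasurePreserving (MeasurableEquiv.prodAssoc
      (α := EuclideanSpace ℝ (Fin N)) (β := ℝ) (γ := ℝ)) ((baseMeasure Ω).prod sizeMeasure)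
      ((spaceMeasure Ω).prod (sizeMeasure.prod sizeMeasure)) :=
    ⟨MeasurableEquiv.prodAssoc.measurable, Measure.prodAssoc_prod⟩
  have h2 := (MeasurePreserving.id (spaceMeasure Ω)).prod
    (Measure.measurePreserving_swap (μ := sizeMeasure) (ν := sizeMeasure))
  exact h1.trans (MeasurePreserving.trans h2 (h1.symm _))

theorem KernelAssumption.aemeasurable (hb : KernelAssumption Ω b b₀ l) :
    AEMeasurable (fun y : (EuclideanSpace ℝ (Fin N) × ℝ) × ℝ => b y.1.1 y.1.2 y.2)
      ((baseMeasure Ω).prod sizeMeasure) := by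
  have h1 : MeasurePreserving (MeasurableEquiv.prodAssoc
      (α := EuclideanSpace ℝ (Fin N)) (β := ℝ) (γ := ℝ)) ((baseMeasure Ω).prod sizeMeasure)
      ((spaceMeasure Ω).prod (sizeMeasure.prod sizeMeasure)) :=
    ⟨MeasurableEquiv.prodAssoc.measurable, Measure.prodAssoc_prod⟩
  exact hb.measurable.comp_quasiMeasurePreserving h1.quasiMeasurePreserving

theorem KernelAssumption.ae_aemeasurable (hb : KernelAssumption Ω b b₀ l) :
    ∀ᵐ z ∂baseMeasure Ω, AEMeasurable (fun m => b z.1 m z.2) sizeMeasure := by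
  have h1 := (hb.aemeasurable.comp_quasiMeasurePreserving
    measurePreserving_exchange.quasiMeasurePreserving).aestronglyMeasurable.prodMk_left
  filter_upwards [h1] with z hz using hz.aemeasurable

theorem ae_base_fst_mem (hΩ : IsOpen Ω) : ∀ᵐ z ∂baseMeasure Ω, z.1 ∈ Ω :=
  Measure.quasiMeasurePreserving_fst.ae (ae_restrict_mem hΩ.measurableSet)

/-- A comparison of powers on $[0,s]$ is integrated against $b(x,\cdot,s)\ge0$. The coefficients may
depend on $s$. -/
theorem kernelMoment_le_of_le {q r t A B : ℝ} (hA : 0 ≤ A) (hB : 0 ≤ B)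
    {x : EuclideanSpace ℝ (Fin N)} {s : ℝ}
    (hm : AEMeasurable (fun m => b x m s) sizeMeasure) (hb0 : ∀ m, 0 ≤ m → 0 ≤ b x m s)
    (h : ∀ m, 0 ≤ m → m ≤ s → m ^ q ≤ A * m ^ r + B * m ^ t) :
    kernelMoment b q x s ≤
      ENNReal.ofReal A * kernelMoment b r x s + ENNReal.ofReal B * kernelMoment b t x s := by
  have hmr : AEMeasurable (fun m => ENNReal.ofReal A * ENNReal.ofReal (b x m s * m ^ r))
      (volume.restrict (Icc 0 s)) := by
    have := hm.mono_measure
      (Measure.restrict_mono (fun y hy => hy.1 : Icc 0 s ⊆ Ici 0) (le_refl volume))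
    fun_prop
  rw [kernelMoment, kernelMoment, kernelMoment,
    ← lintegral_const_mul' _ _ ENNReal.ofReal_ne_top,
    ← lintegral_const_mul' _ _ ENNReal.ofReal_ne_top, ← lintegral_add_left' hmr]
  refine setLIntegral_mono' measurableSet_Icc fun m hms => ?_
  have h0 := hb0 m hms.1
  have h1 := Real.rpow_nonneg hms.1 r
  have h2 := Real.rpow_nonneg hms.1 t
  rw [← ENNReal.ofReal_mul hA, ← ENNReal.ofReal_mul hB,
    ← ENNReal.ofReal_add (by positivity) (by positivity)]
  refine ENNReal.ofReal_le_ofReal ?_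
  calc b x m s * m ^ q ≤ b x m s * (A * m ^ r + B * m ^ t) := by gcongr; exact h m hms.1 hms.2
    _ = _ := by ring

/-- The moment condition for one exponent above `1` implies it for all of them. -/
theorem MomentAssumption.of_exponent (hΩ : IsOpen Ω) (hb : KernelAssumption Ω b b₀ l) {ρ q : ℝ}
    (hρ : 1 < ρ) (hq : 1 < q) (h : MomentAssumption Ω b ρ) :
    ∃ c, 0 ≤ c ∧ c < 1 ∧ ∃ s₀ > 0, ∀ᵐ z ∂baseMeasure Ω, s₀ ≤ z.2 →
      kernelMoment b q z.1 z.2 ≤ ENNReal.ofReal (c * z.2 ^ q) := by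
  obtain ⟨c', hc', s₀, hs₀, hmom'⟩ := h
  -- The given constant may be negative; it is replaced by its maximum with $0$.
  obtain ⟨c, hc0, hc1, hmom⟩ : ∃ c, 0 ≤ c ∧ c < 1 ∧ ∀ᵐ z ∂baseMeasure Ω, s₀ ≤ z.2 →
      kernelMoment b ρ z.1 z.2 ≤ ENNReal.ofReal (c * z.2 ^ ρ) := by
    refine ⟨max c' 0, le_max_right _ _, by simpa using hc', hmom'.mono fun z hz hzs => ?_⟩
    refine (hz hzs).trans (ENNReal.ofReal_le_ofReal ?_)
    have := Real.rpow_nonneg (hs₀.le.trans hzs) ρ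
    gcongr
    exact le_max_left _ _
  rcases le_total ρ q with hρq | hρq
  · refine ⟨c, hc0, hc1, s₀, hs₀, ?_⟩
    filter_upwards [hmom, hb.ae_aemeasurable, ae_base_fst_mem hΩ] with z h1 h2 h3 hs
    have hz0 : 0 < z.2 := hs₀.trans_le hs
    refine (kernelMoment_le_of_le (r := ρ) (t := ρ) (A := z.2 ^ (q - ρ)) (B := 0)
      (Real.rpow_nonneg hz0.le _) le_rfl h2 (fun m hm => hb.nonneg _ h3 _ hm _ hz0.le) ?_).trans ?_
    · intro m hm hms
      rw [zero_mul, add_zero]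
      calc m ^ q = m ^ (q - ρ) * m ^ ρ := by
            rcases hm.eq_or_lt with rfl | hm'
            · rw [Real.zero_rpow (by linarith), Real.zero_rpow (by linarith : ρ ≠ 0), mul_zero]
            · rw [← Real.rpow_add hm']; ring_nf
        _ ≤ _ := by gcongr
    · rw [ENNReal.ofReal_zero, zero_mul, add_zero]
      refine (mul_le_mul_right (h1 hs) _).trans_eq ?_
      rw [← ENNReal.ofReal_mul (Real.rpow_nonneg hz0.le _)]
      congr 1
      rw [mul_left_comm, ← Real.rpow_add hz0]
      ring_nf
  -- Here $q=(1-t)\cdot1+t\rho$. The weighted mean inequality for $s^{q-1}m$ and $s^{q-\rho}m^\rho$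
  -- bounds $m^q$ by terms homogeneous of degree $q$; with $n_1=s$ the new constant is $1-t+tc<1$.
  · set t : ℝ := (q - 1) / (ρ - 1) with ht
    have hρ1 : 0 < ρ - 1 := by linarith
    have ht0 : 0 < t := div_pos (by linarith) hρ1
    have ht1 : t ≤ 1 := by rw [ht, div_le_one hρ1]; linarith
    have htρ : t * (ρ - 1) = q - 1 := div_mul_cancel₀ _ hρ1.ne'
    refine ⟨1 - t + t * c, by nlinarith, by nlinarith, s₀, hs₀, ?_⟩
    filter_upwards [hmom, hb.ae_aemeasurable, ae_base_fst_mem hΩ, hb.mass] with z h1 h2 h3 h4 hs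
    have hz0 : 0 < z.2 := hs₀.trans_le hs
    have hA : 0 ≤ (1 - t) * z.2 ^ (q - 1) := mul_nonneg (by linarith) (Real.rpow_nonneg hz0.le _)
    have hB : 0 ≤ t * z.2 ^ (q - ρ) := mul_nonneg ht0.le (Real.rpow_nonneg hz0.le _)
    refine (kernelMoment_le_of_le (r := 1) (t := ρ) hA hB h2
      (fun m hm => hb.nonneg _ h3 _ hm _ hz0.le) ?_).trans ?_
    · intro m hm hms
      rcases hm.eq_or_lt with rfl | hm'
      · rw [Real.zero_rpow (by linarith), Real.zero_rpow (by linarith : ρ ≠ 0)]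
        simp
      have hX : 0 ≤ z.2 ^ (q - 1) * m := by positivity
      have hY : 0 ≤ z.2 ^ (q - ρ) * m ^ ρ := by positivity
      have h5 := Real.geom_mean_le_arith_mean2_weighted (sub_nonneg.2 ht1) ht0.le hX hY
        (sub_add_cancel _ _)
      rw [Real.rpow_one]
      calc m ^ q = (z.2 ^ (q - 1) * m) ^ (1 - t) * (z.2 ^ (q - ρ) * m ^ ρ) ^ t := by
            rw [Real.mul_rpow (by positivity) hm, Real.mul_rpow (by positivity) (by positivity),
              ← Real.rpow_mul hz0.le, ← Real.rpow_mul hz0.le, ← Real.rpow_mul hm,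
              mul_mul_mul_comm, ← Real.rpow_add hz0, ← Real.rpow_add hm']
            have e1 : (q - 1) * (1 - t) + (q - ρ) * t = 0 := by linear_combination -htρ
            have e2 : 1 - t + ρ * t = q := by linear_combination htρ
            rw [e1, e2, Real.rpow_zero, one_mul]
        _ ≤ _ := h5
        _ = _ := by ring
    · rw [h4]
      calc _ ≤ ENNReal.ofReal ((1 - t) * z.2 ^ (q - 1)) * ENNReal.ofReal z.2 +
              ENNReal.ofReal (t * z.2 ^ (q - ρ)) * ENNReal.ofReal (c * z.2 ^ ρ) := by
            gcongr
            exact h1 hs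
        _ = ENNReal.ofReal ((1 - t) * z.2 ^ (q - 1) * z.2 +
              t * z.2 ^ (q - ρ) * (c * z.2 ^ ρ)) := by
            rw [← ENNReal.ofReal_mul hA, ← ENNReal.ofReal_mul hB,
              ← ENNReal.ofReal_add (by positivity) (by positivity)]
        _ = _ := by
            congr 1
            have e1 : z.2 ^ (q - 1) * z.2 = z.2 ^ q := by
              nth_rewrite 2 [← Real.rpow_one z.2]
              rw [← Real.rpow_add hz0, sub_add_cancel]
            have e2 : z.2 ^ (q - ρ) * z.2 ^ ρ = z.2 ^ q := by
              rw [← Real.rpow_add hz0, sub_add_cancel]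
            linear_combination (1 - t) * e1 + t * c * e2

/-- The moments of order `0` and `q` together are at most a constant multiple of `1 + s ^ q`. -/
theorem KernelAssumption.moments_le (hΩ : IsOpen Ω) (hb : KernelAssumption Ω b b₀ l) {q : ℝ}
    (hq : max 1 l < q) : ∀ᵐ z ∂baseMeasure Ω,
      kernelMoment b 0 z.1 z.2 + kernelMoment b q z.1 z.2 ≤
        ENNReal.ofReal ((2 * b₀ + 1) * (1 + z.2 ^ q)) := by
  have hq1 : 1 < q := (le_max_left _ _).trans_lt hq
  have hql : l < q := (le_max_right _ _).trans_lt hq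
  have hb1 := hb.one_le
  filter_upwards [hb.ae_aemeasurable, ae_base_fst_mem hΩ, hb.mass, hb.number_le,
    ae_base_snd_nonneg] with z h2 h3 h4 h5 hz
  have hzq := Real.rpow_nonneg hz q
  have hzq1 := Real.rpow_nonneg hz (q - 1)
  -- From $m^q\le s^{q-1}m$ for $m\le s$ and mass conservation.
  have h6 : kernelMoment b q z.1 z.2 ≤ ENNReal.ofReal (z.2 ^ q) := by
    refine (kernelMoment_le_of_le (r := 1) (t := 1) (A := z.2 ^ (q - 1)) (B := 0)
      hzq1 le_rfl h2 (fun m hm => hb.nonneg _ h3 _ hm _ hz) ?_).trans ?_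
    · intro m hm hms
      rw [zero_mul, add_zero]
      calc m ^ q = m ^ (q - 1) * m ^ (1 : ℝ) := by
            rcases hm.eq_or_lt with rfl | hm'
            · rw [Real.zero_rpow (by linarith), Real.zero_rpow one_ne_zero, mul_zero]
            · rw [← Real.rpow_add hm']; ring_nf
        _ ≤ _ := by gcongr
    · rw [ENNReal.ofReal_zero, zero_mul, add_zero, h4, ← ENNReal.ofReal_mul hzq1]
      refine ENNReal.ofReal_le_ofReal (le_of_eq ?_)
      rcases hz.eq_or_lt with h0 | h0
      · rw [← h0, mul_zero, Real.zero_rpow (by linarith)]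
      · nth_rewrite 2 [← Real.rpow_one z.2]
        rw [← Real.rpow_add h0, sub_add_cancel]
  have h7 : z.2 ^ l ≤ 1 + z.2 ^ q := by
    rcases le_total z.2 1 with h | h
    · exact (Real.rpow_le_one hz h hb.l_nonneg).trans (by linarith)
    · exact (Real.rpow_le_rpow_of_exponent_le h hql.le).trans (by linarith)
  have hzl := Real.rpow_nonneg hz l
  calc _ ≤ ENNReal.ofReal (b₀ * (1 + z.2 ^ l)) + ENNReal.ofReal (z.2 ^ q) := add_le_add h5 h6
    _ = ENNReal.ofReal (b₀ * (1 + z.2 ^ l) + z.2 ^ q) := by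
      rw [← ENNReal.ofReal_add (by positivity) hzq]
    _ ≤ _ := by
      refine ENNReal.ofReal_le_ofReal ?_
      nlinarith

/-- For large sizes the moments of order `0` and `q` together are a proper fraction of
`1 + s ^ q`. -/
theorem MomentAssumption.moments_lt (hΩ : IsOpen Ω) (hb : KernelAssumption Ω b b₀ l) {ρ q : ℝ}
    (hρ : 1 < ρ) (hq : max 1 l < q) (h : MomentAssumption Ω b ρ) :
    ∃ c, 0 ≤ c ∧ c < 1 ∧ ∃ s₀, ∀ᵐ z ∂baseMeasure Ω, s₀ ≤ z.2 →
      kernelMoment b 0 z.1 z.2 + kernelMoment b q z.1 z.2 ≤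
        ENNReal.ofReal (c * (1 + z.2 ^ q)) := by
  have hq1 : 1 < q := (le_max_left _ _).trans_lt hq
  have hql : l < q := (le_max_right _ _).trans_lt hq
  have hb1 := hb.one_le
  obtain ⟨c, hc0, hc1, s₁, hs₁, hmom⟩ := h.of_exponent hΩ hb hρ hq1
  have hlim : Tendsto (fun s : ℝ => b₀ * (s ^ (-q) + s ^ (-(q - l)))) atTop (𝓝 0) := by
    have := ((tendsto_rpow_neg_atTop (show 0 < q by linarith)).add
      (tendsto_rpow_neg_atTop (sub_pos.2 hql))).const_mul b₀
    simpa using this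
  obtain ⟨s₂, hs₂⟩ := eventually_atTop.1 (hlim.eventually
    (Iio_mem_nhds (show 0 < (1 - c) / 2 by linarith)))
  -- Half of the gap $1-c$ is spent on the number of fragments, which is $o(s^q)$ because $q>l$ and
  -- $q>0$.
  refine ⟨(1 + c) / 2, by linarith, by linarith, max s₁ s₂, ?_⟩
  filter_upwards [hmom, hb.number_le] with z h1 h2 hs
  have hs1 : s₁ ≤ z.2 := (le_max_left _ _).trans hs
  have hz : 0 < z.2 := hs₁.trans_le hs1
  have h3 := hs₂ z.2 ((le_max_right _ _).trans hs)
  have hzq : 0 < z.2 ^ q := Real.rpow_pos_of_pos hz q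
  have hzl := Real.rpow_nonneg hz.le l
  have h4 : b₀ * (1 + z.2 ^ l) ≤ (1 - c) / 2 * z.2 ^ q := by
    have e : b₀ * (1 + z.2 ^ l) = b₀ * (z.2 ^ (-q) + z.2 ^ (-(q - l))) * z.2 ^ q := by
      rw [mul_assoc, add_mul, ← Real.rpow_add hz, ← Real.rpow_add hz]
      ring_nf
      simp
      ring
    rw [e]
    exact mul_le_mul_of_nonneg_right h3.le hzq.le
  calc _ ≤ ENNReal.ofReal (b₀ * (1 + z.2 ^ l)) + ENNReal.ofReal (c * z.2 ^ q) :=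
        add_le_add h2 (h1 hs1)
    _ = ENNReal.ofReal (b₀ * (1 + z.2 ^ l) + c * z.2 ^ q) := by
      rw [← ENNReal.ofReal_add (by positivity) (by positivity)]
    _ ≤ _ := by
      refine ENNReal.ofReal_le_ofReal ?_
      nlinarith

end Moments

/-! ### The gain operator -/

section Gain

variable {N : ℕ} {Ω : Set (EuclideanSpace ℝ (Fin N))}
  {b : EuclideanSpace ℝ (Fin N) → ℝ → ℝ → ℝ} {b₀ l : ℝ}

/-- The integrand of the gain term. -/
def gainIntegrand (b : EuclideanSpace ℝ (Fin N) → ℝ → ℝ → ℝ)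
    (h : EuclideanSpace ℝ (Fin N) × ℝ → ℝ) (y : (EuclideanSpace ℝ (Fin N) × ℝ) × ℝ) : ℝ :=
  {y : (EuclideanSpace ℝ (Fin N) × ℝ) × ℝ | y.1.2 < y.2}.indicator
    (fun y => b y.1.1 y.1.2 y.2 * h (y.1.1, y.2)) y

/-- The gain term. -/
def gainFun (b : EuclideanSpace ℝ (Fin N) → ℝ → ℝ → ℝ)
    (h : EuclideanSpace ℝ (Fin N) × ℝ → ℝ) (z : EuclideanSpace ℝ (Fin N) × ℝ) : ℝ :=
  ∫ s in Ioi z.2, b z.1 z.2 s * h (z.1, s)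

theorem measurableSet_size_lt :
    MeasurableSet {y : (EuclideanSpace ℝ (Fin N) × ℝ) × ℝ | y.1.2 < y.2} :=
  measurableSet_lt (measurable_snd.comp measurable_fst) measurable_snd

theorem gainFun_eq (b : EuclideanSpace ℝ (Fin N) → ℝ → ℝ → ℝ)
    (h : EuclideanSpace ℝ (Fin N) × ℝ → ℝ) {z : EuclideanSpace ℝ (Fin N) × ℝ} (hz : 0 ≤ z.2) :
    gainFun b h z = ∫ s, gainIntegrand b h (z, s) ∂sizeMeasure := by
  have e : (fun s => gainIntegrand b h (z, s)) =
      (Ioi z.2).indicator fun s => b z.1 z.2 s * h (z.1, s) := by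
    funext s
    by_cases hs : z.2 < s <;> simp [gainIntegrand, hs]
  rw [e, integral_indicator measurableSet_Ioi, Measure.restrict_restrict measurableSet_Ioi,
    inter_eq_left.2 (show Ioi z.2 ⊆ Ici 0 from fun s (hs : z.2 < s) => hz.trans hs.le), gainFun]

theorem ae_restrict_Ioi_of_ae_size {P : ℝ → Prop} {m : ℝ} (hm : 0 ≤ m)
    (h : ∀ᵐ s ∂sizeMeasure, P s) : ∀ᵐ s ∂volume.restrict (Ioi m), P s :=
  ae_mono (Measure.restrict_mono (fun s (hs : m < s) => hm.trans hs.le) le_rfl) h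

theorem ae_ae_base {P : EuclideanSpace ℝ (Fin N) × ℝ → Prop}
    (h : ∀ᵐ z ∂baseMeasure Ω, P z) : ∀ᵐ z ∂baseMeasure Ω, ∀ᵐ s ∂sizeMeasure, P (z.1, s) :=
  Measure.quasiMeasurePreserving_fst.ae (Measure.ae_ae_of_ae_prod h)

/-- By Fubini a null set has null size-slices for almost every $x$, and the integral in the gain
runs over such a slice. -/
theorem gainFun_congr {h h' : EuclideanSpace ℝ (Fin N) × ℝ → ℝ} (hh : h =ᵐ[baseMeasure Ω] h') :
    gainFun b h =ᵐ[baseMeasure Ω] gainFun b h' := by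
  filter_upwards [ae_ae_base hh, ae_base_snd_nonneg] with z hz hz0
  refine integral_congr_ae ?_
  filter_upwards [ae_restrict_Ioi_of_ae_size hz0 hz] with s hs
  rw [hs]

theorem gainFun_nonneg (hΩ : IsOpen Ω) (hb : KernelAssumption Ω b b₀ l)
    {h : EuclideanSpace ℝ (Fin N) × ℝ → ℝ} (hh : ∀ᵐ z ∂baseMeasure Ω, 0 ≤ h z) :
    ∀ᵐ z ∂baseMeasure Ω, 0 ≤ gainFun b h z := by
  filter_upwards [ae_ae_base hh, ae_base_snd_nonneg, ae_base_fst_mem hΩ] with z hz hz0 hzΩ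
  refine integral_nonneg_of_ae ?_
  filter_upwards [ae_restrict_Ioi_of_ae_size hz0 hz, ae_restrict_mem measurableSet_Ioi]
    with s hs (hzs : z.2 < s)
  exact mul_nonneg (hb.nonneg _ hzΩ _ hz0 _ (hz0.trans hzs.le)) hs

theorem aestronglyMeasurable_gainIntegrand (hb : KernelAssumption Ω b b₀ l)
    {h : EuclideanSpace ℝ (Fin N) × ℝ → ℝ} (hh : Measurable h) :
    AEStronglyMeasurable (gainIntegrand b h) ((baseMeasure Ω).prod sizeMeasure) := by
  refine AEStronglyMeasurable.indicator ?_ measurableSet_size_lt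
  refine (hb.aemeasurable.mul (Measurable.aemeasurable ?_)).aestronglyMeasurable
  exact hh.comp ((measurable_fst.comp measurable_fst).prodMk measurable_snd)

/-- Tonelli estimate of the gain term through the moments of the kernel. -/
theorem lintegral_gainIntegrand_le (hΩ : IsOpen Ω) (hb : KernelAssumption Ω b b₀ l) {q : ℝ}
    {h : EuclideanSpace ℝ (Fin N) × ℝ → ℝ} (hh : Measurable h)
    {κ : EuclideanSpace ℝ (Fin N) × ℝ → ℝ≥0∞}
    (hκ : ∀ᵐ z ∂baseMeasure Ω, kernelMoment b 0 z.1 z.2 + kernelMoment b q z.1 z.2 ≤ κ z) :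
    ∫⁻ z, ENNReal.ofReal (1 + z.2 ^ q) * ∫⁻ s, ‖gainIntegrand b h (z, s)‖ₑ ∂sizeMeasure
      ∂baseMeasure Ω ≤ ∫⁻ z, κ z * ‖h z‖ₑ ∂baseMeasure Ω := by
  set F : (EuclideanSpace ℝ (Fin N) × ℝ) × ℝ → ℝ≥0∞ := fun y =>
    ENNReal.ofReal (1 + y.1.2 ^ q) * ‖gainIntegrand b h y‖ₑ with hF
  have hFm : AEMeasurable F ((baseMeasure Ω).prod sizeMeasure) := by
    refine AEMeasurable.mul ?_ (aestronglyMeasurable_gainIntegrand hb hh).enorm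
    exact ((measurable_weight q).comp measurable_fst).aemeasurable
  have hswap : ∫⁻ z, ∫⁻ s, F (z, s) ∂sizeMeasure ∂baseMeasure Ω =
      ∫⁻ z, ∫⁻ m, F (exchange N (z, m)) ∂sizeMeasure ∂baseMeasure Ω := by
    rw [← lintegral_prod _ hFm, ← measurePreserving_exchange.lintegral_comp_emb
      (exchange N).measurableEmbedding, lintegral_prod]
    exact hFm.comp_quasiMeasurePreserving measurePreserving_exchange.quasiMeasurePreserving
  calc _ = ∫⁻ z, ∫⁻ s, F (z, s) ∂sizeMeasure ∂baseMeasure Ω := by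
        refine lintegral_congr fun z => ?_
        rw [← lintegral_const_mul' _ _ ENNReal.ofReal_ne_top]
    _ = _ := hswap
    _ ≤ _ := by
        refine lintegral_mono_ae ?_
        filter_upwards [hκ, hb.ae_aemeasurable, ae_base_fst_mem hΩ, ae_base_snd_nonneg]
          with z h1 h2 h3 hz
        refine le_trans ?_ (mul_le_mul_left h1 _)
        have hm0 : AEMeasurable (fun m => ENNReal.ofReal (b z.1 m z.2 * m ^ (0 : ℝ)))
            (volume.restrict (Icc 0 z.2)) := by
          have := h2.mono_measure
            (Measure.restrict_mono (fun y hy => hy.1 : Icc 0 z.2 ⊆ Ici 0) (le_refl volume))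
          fun_prop
        rw [kernelMoment, kernelMoment, ← lintegral_add_left' hm0,
          ← lintegral_mul_const' _ _ enorm_ne_top, ← lintegral_indicator measurableSet_Icc,
          ← lintegral_indicator measurableSet_Ici]
        refine lintegral_mono fun m => ?_
        by_cases hm : 0 ≤ m
        · rw [indicator_of_mem (show m ∈ Ici (0 : ℝ) from hm)]
          by_cases hmz : m < z.2
          · rw [indicator_of_mem (show m ∈ Icc 0 z.2 from ⟨hm, hmz.le⟩)]
            have h0 := hb.nonneg _ h3 _ hm _ hz
            have hmq := Real.rpow_nonneg hm q
            obtain ⟨x, s⟩ := z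
            rw [exchange_apply]
            simp only [hF, gainIntegrand]
            rw [indicator_of_mem (show ((x, m), s) ∈
              {y : (EuclideanSpace ℝ (Fin N) × ℝ) × ℝ | y.1.2 < y.2} from hmz), enorm_mul,
              ← mul_assoc]
            gcongr
            rw [Real.enorm_of_nonneg h0, ← ENNReal.ofReal_mul (by positivity), Real.rpow_zero,
              ← ENNReal.ofReal_add (by simpa using h0) (by positivity)]
            refine ENNReal.ofReal_le_ofReal (le_of_eq ?_)
            ring
          · obtain ⟨x, s⟩ := z
            rw [exchange_apply]
            simp only [hF, gainIntegrand]
            rw [indicator_of_notMem (show ((x, m), s) ∉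
              {y : (EuclideanSpace ℝ (Fin N) × ℝ) × ℝ | y.1.2 < y.2} from hmz)]
            simp
        · rw [indicator_of_notMem (show m ∉ Ici (0 : ℝ) from hm)]
          exact zero_le

/-- The gain term as a bounded positive operator in the weighted spaces. -/
theorem exists_gain_clm (hΩ : IsOpen Ω) (hb : KernelAssumption Ω b b₀ l) {q : ℝ}
    (hq : max 1 l < q) :
    ∃ B : StateSpace Ω q →L[ℝ] StateSpace Ω q,
      (∀ h, B h =ᵐ[baseMeasure Ω] gainFun b h) ∧
      ∀ (h : StateSpace Ω q) (κ : EuclideanSpace ℝ (Fin N) × ℝ → ℝ≥0∞),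
        (∀ᵐ z ∂baseMeasure Ω, kernelMoment b 0 z.1 z.2 + kernelMoment b q z.1 z.2 ≤ κ z) →
        ENNReal.ofReal ‖B h‖ ≤ ∫⁻ z, κ z * ‖h z‖ₑ ∂baseMeasure Ω := by
  have hmeas : ∀ h : StateSpace Ω q, Measurable h := fun h => (Lp.stronglyMeasurable h).measurable
  set C : ℝ := 2 * b₀ + 1 with hC
  have hC0 : 0 ≤ C := by have := hb.one_le; linarith
  have hgm : ∀ h : StateSpace Ω q, AEStronglyMeasurable (gainFun b h) (baseMeasure Ω) := by
    intro h
    refine (aestronglyMeasurable_gainIntegrand hb (hmeas h)).integral_prod_right'.congr ?_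
    filter_upwards [ae_base_snd_nonneg] with z hz using (gainFun_eq b h hz).symm
  -- The majorant $\kappa$ stays arbitrary: a crude one gives boundedness here, a sharp one later
  -- compares gain with loss.
  have hle : ∀ (h : StateSpace Ω q) (κ : EuclideanSpace ℝ (Fin N) × ℝ → ℝ≥0∞),
      (∀ᵐ z ∂baseMeasure Ω, kernelMoment b 0 z.1 z.2 + kernelMoment b q z.1 z.2 ≤ κ z) →
      ∫⁻ z, ‖gainFun b h z‖ₑ ∂stateMeasure Ω q ≤ ∫⁻ z, κ z * ‖h z‖ₑ ∂baseMeasure Ω := by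
    intro h κ hκ
    rw [lintegral_state_enorm q (hgm h)]
    refine le_trans (lintegral_mono_ae ?_) (lintegral_gainIntegrand_le hΩ hb (hmeas h) hκ)
    filter_upwards [ae_base_snd_nonneg] with z hz
    rw [gainFun_eq b h hz]
    gcongr
    exact enorm_integral_le_lintegral_enorm _
  have hfin : ∀ h : StateSpace Ω q,
      ∫⁻ z, (ENNReal.ofReal (C * (1 + z.2 ^ q))) * ‖h z‖ₑ ∂baseMeasure Ω =
        ENNReal.ofReal (C * ‖h‖) := by
    intro h
    rw [ENNReal.ofReal_mul hC0, ofReal_norm_state, ← lintegral_const_mul' _ _ ENNReal.ofReal_ne_top]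
    refine lintegral_congr fun z => ?_
    rw [ENNReal.ofReal_mul hC0, mul_assoc]
  -- The Bochner integral is additive only on integrable functions; finiteness of the Tonelli
  -- integral supplies this for almost every point.
  have hint : ∀ h : StateSpace Ω q, ∀ᵐ z ∂baseMeasure Ω,
      Integrable (fun s => b z.1 z.2 s * h (z.1, s)) (volume.restrict (Ioi z.2)) := by
    intro h
    have hF := aestronglyMeasurable_gainIntegrand hb (hmeas h) (Ω := Ω)
    have h1 := (lintegral_gainIntegrand_le hΩ hb (hmeas h) (hb.moments_le hΩ hq)).trans_lt
      ((hfin h).trans_lt ENNReal.ofReal_lt_top)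
    have h2 := ae_lt_top' ((measurable_weight q).aemeasurable.mul hF.enorm.lintegral_prod_right')
      h1.ne
    filter_upwards [h2, ae_base_snd_nonneg, hF.prodMk_left] with z e1 hz e2
    have e3 : (∫⁻ s, ‖gainIntegrand b h (z, s)‖ₑ ∂sizeMeasure) < ∞ := by
      refine lt_top_iff_ne_top.2 fun htop => ?_
      rw [Pi.mul_apply, htop, ENNReal.mul_top] at e1
      · exact lt_irrefl _ e1
      · exact (ENNReal.ofReal_pos.2 (weight_pos hz q)).ne'
    have e4 : Integrable (fun s => gainIntegrand b h (z, s)) sizeMeasure := ⟨e2, e3⟩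
    have e5 : (fun s => gainIntegrand b h (z, s)) =
        (Ioi z.2).indicator fun s => b z.1 z.2 s * h (z.1, s) := by
      funext s
      by_cases hs : z.2 < s <;> simp [gainIntegrand, hs]
    rw [e5, integrable_indicator_iff measurableSet_Ioi] at e4
    rwa [IntegrableOn, Measure.restrict_restrict measurableSet_Ioi,
      inter_eq_left.2 (show Ioi z.2 ⊆ Ici 0 from fun s (hs : z.2 < s) => hz.trans hs.le)] at e4
  obtain ⟨B, hB, -⟩ := exists_clm_of_lintegral_le (μ := stateMeasure Ω q) (ν := stateMeasure Ω q)
    (fun h => gainFun b h) C hC0 (fun h => aeStronglyMeasurable_state_iff.2 (hgm h))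
    (fun u v => by
      refine ae_state_iff.2 ?_
      filter_upwards [gainFun_congr (b := b) (ae_state_iff.1 (Lp.coeFn_add u v)), hint u, hint v]
        with z e1 e2 e3
      rw [e1, gainFun, gainFun, gainFun, ← integral_add e2 e3]
      refine integral_congr_ae (Eventually.of_forall fun s => ?_)
      simp only [Pi.add_apply]
      ring)
    (fun c u => by
      refine ae_state_iff.2 ?_
      filter_upwards [gainFun_congr (b := b) (ae_state_iff.1 (Lp.coeFn_smul c u))] with z e1
      rw [e1, gainFun, gainFun, ← integral_const_mul]
      refine integral_congr_ae (Eventually.of_forall fun s => ?_)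
      simp only [Pi.smul_apply, smul_eq_mul]
      ring)
    (fun h => (hle h _ (hb.moments_le hΩ hq)).trans (hfin h).le)
  refine ⟨B, fun h => ae_state_iff.1 (hB h), fun h κ hκ => ?_⟩
  rw [← lintegral_enorm_coeFn]
  refine le_trans (lintegral_mono_ae ?_) (hle h κ hκ)
  filter_upwards [hB h] with z hz
  rw [hz]

end Gain

/-! ### The fragmentation rate -/

section Rate

variable {N : ℕ} {Ω : Set (EuclideanSpace ℝ (Fin N))} {a : EuclideanSpace ℝ (Fin N) → ℝ → ℝ}
  {α₁ α₂ : ℝ → ℝ} {M : ℝ}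

/-- A locally closed subset of a finite-dimensional space is locally compact, hence
$\sigma$-compact, and measurability on each compact piece is part of local boundedness. -/
theorem RateAssumption.aestronglyMeasurable (hΩ : IsOpen Ω) (ha : RateAssumption Ω a α₁ α₂ M) :
    AEStronglyMeasurable (fun z => a z.1 z.2) (baseMeasure Ω) := by
  have h1 : IsSigmaCompact (Ω ×ˢ Ici (0 : ℝ)) := by
    have h2 : IsLocallyClosed (Ω ×ˢ Ici (0 : ℝ)) := by
      rw [Set.prod_eq]
      exact (hΩ.preimage continuous_fst).isLocallyClosed.inter
        (isClosed_Ici.preimage continuous_snd).isLocallyClosed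
    have := h2.locallyCompactSpace
    exact isSigmaCompact_iff_sigmaCompactSpace.2 inferInstance
  obtain ⟨K, hK, hKU⟩ := h1
  have h3 : baseMeasure Ω = (volume : Measure (EuclideanSpace ℝ (Fin N) × ℝ)).restrict
      (⋃ n, K n) := by
    rw [hKU, baseMeasure, Measure.prod_restrict]
    rfl
  rw [h3, aestronglyMeasurable_iUnion_iff]
  intro n
  exact (ha.rate_loc (K n) (hKU ▸ subset_iUnion K n) (hK n)).1

/-- The bound must be uniform in $x$ over the possibly unbounded $\Omega$, so it comes from
$\alpha_2$ and not from local boundedness of $a$. -/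
theorem RateAssumption.exists_bound (ha : RateAssumption Ω a α₁ α₂ M) (R : ℝ) :
    ∃ c, 0 ≤ c ∧ ∀ᵐ z ∂baseMeasure Ω, z.2 ≤ R → a z.1 z.2 ≤ c := by
  have h1 := ha.upper_loc (Icc 0 R) (fun y hy => hy.1) isCompact_Icc
  refine ⟨(eLpNorm α₂ ∞ (volume.restrict (Icc 0 R))).toReal, ENNReal.toReal_nonneg, ?_⟩
  have h2 : ∀ᵐ m ∂sizeMeasure, m ≤ R →
      α₂ m ≤ (eLpNorm α₂ ∞ (volume.restrict (Icc 0 R))).toReal := by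
    have h3 : ∀ᵐ m ∂volume.restrict (Icc 0 R),
        ‖α₂ m‖ₑ ≤ eLpNorm α₂ ∞ (volume.restrict (Icc 0 R)) := by
      rw [eLpNorm_exponent_top]
      exact enorm_ae_le_eLpNormEssSup _ _
    rw [ae_restrict_iff' measurableSet_Icc] at h3
    rw [ae_restrict_iff' measurableSet_Ici]
    filter_upwards [h3] with m hm hm0 hmR
    refine (le_abs_self _).trans ?_
    have h4 := ENNReal.toReal_mono h1.2.ne (hm ⟨hm0, hmR⟩)
    rwa [toReal_enorm] at h4
  filter_upwards [ha.le_upper, ae_base_of_ae_size h2] with z e1 e2 hz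
  exact e1.trans (e2 hz)

end Rate

/-! ### The transport–fragmentation operator -/

section Operator

variable {N : ℕ} {Ω : Set (EuclideanSpace ℝ (Fin N))} {T₀ : ℝ → SpaceL1 Ω →ₗ.[ℝ] SpaceL1 Ω}
  {a : EuclideanSpace ℝ (Fin N) → ℝ → ℝ} {α₁ α₂ : ℝ → ℝ} {M : ℝ}
  {b : EuclideanSpace ℝ (Fin N) → ℝ → ℝ → ℝ} {b₀ l : ℝ}

/-- The integrability condition on $au$ says that it is a class $h$ of the state space, and the gain
depends on $u$ only through $h$, which makes it the bounded operator $B$ applied to $h$. -/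
theorem transportFragmentationGraph_iff {q : ℝ} {B : StateSpace Ω q →L[ℝ] StateSpace Ω q}
    (hB : ∀ h, B h =ᵐ[baseMeasure Ω] gainFun b h) (u f : StateSpace Ω q) :
    TransportFragmentationGraph T₀ a b q u f ↔
      LossGainGraph (TransportGraph T₀ q) (fun z => a z.1 z.2) B u f := by
  have key : ∀ g h : StateSpace Ω q, (h =ᵐ[baseMeasure Ω] fun z => a z.1 z.2 * u z) →
      ⇑(g - h + B h) =ᵐ[stateMeasure Ω q] fun z =>
        g z - a z.1 z.2 * u z + ∫ s in Ioi z.2, b z.1 z.2 s * a z.1 s * u (z.1, s) := by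
    intro g h hh
    filter_upwards [Lp.coeFn_add (g - h) (B h), Lp.coeFn_sub g h, ae_state_iff.2 hh,
      ae_state_iff.2 (hB h), ae_state_iff.2 (gainFun_congr (b := b) hh)] with z e1 e2 e3 e4 e5
    rw [e1, Pi.add_apply, e2, Pi.sub_apply, e3, e4, e5, gainFun]
    simp only [mul_assoc]
  constructor
  · rintro ⟨g, hg, hm, hf⟩
    have hh := hm.coeFn_toLp
    exact ⟨g, hm.toLp _, hg, hh, Lp.ext (hf.trans (key g _ (ae_state_iff.1 hh)).symm)⟩
  · rintro ⟨g, h, hg, hh, rfl⟩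
    exact ⟨g, hg, (memLp_congr_ae hh).1 (Lp.memLp h), key g h (ae_state_iff.1 hh)⟩

/-- The constants are $\delta=1-c$, with $c$ the fraction of $1+s^q$ left by the moments for $s\ge
s_0$, and $\omega=(2b_0+1)A$, with $A$ a bound for the rate on sizes up to $s_0$. -/
theorem lossGainAssumption (hΩ : IsOpen Ω) (ha : RateAssumption Ω a α₁ α₂ M)
    (hb : KernelAssumption Ω b b₀ l) {ρ : ℝ} (hρ : 1 < ρ) (hbρ : MomentAssumption Ω b ρ)
    (hT₀ : TransportAssumption Ω T₀ ρ) {q : ℝ} (hq : max 1 l < q) :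
    ∃ (S : C0Semigroup (StateSpace Ω q)) (B : StateSpace Ω q →L[ℝ] StateSpace Ω q) (δ ω : ℝ),
      (∀ h, B h =ᵐ[baseMeasure Ω] gainFun b h) ∧
      LossGainAssumption (TransportGraph T₀ q) S (fun z => a z.1 z.2) B
        (fun k : ℕ => {z | z.2 < k}) δ ω := by
  obtain ⟨S, hS, hsub⟩ := hT₀.exists_semigroup q
  obtain ⟨B, hB, hBκ⟩ := exists_gain_clm hΩ hb hq
  obtain ⟨c, hc0, hc1, s₀, hs₀⟩ := hbρ.moments_lt hΩ hb hρ hq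
  obtain ⟨A, hA0, hA⟩ := ha.exists_bound s₀
  have hb1 := hb.one_le
  have hJ : ∀ k : ℕ, MeasurableSet {z : EuclideanSpace ℝ (Fin N) × ℝ | z.2 < k} := fun k =>
    measurableSet_lt measurable_snd measurable_const
  have hω : 0 ≤ (2 * b₀ + 1) * A := by positivity
  refine ⟨S, B, 1 - c, (2 * b₀ + 1) * A, hB, hS, hsub, hJ, ?_, ?_, ?_,
    aeStronglyMeasurable_state_iff.2 (ha.aestronglyMeasurable hΩ), ae_state_iff.2 ha.nonneg, ?_,
    ?_, ?_, by linarith, hω, ?_⟩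
  · intro j k hjk z (hz : z.2 < j)
    exact hz.trans_le (by exact_mod_cast hjk)
  · exact Eventually.of_forall fun z => exists_nat_gt z.2
  · intro k u g h
    refine h.mul ((Iio (k : ℝ)).indicator 1) ?_ ?_
    · filter_upwards [ae_state_iff.1 (cut_ae (hJ k) u)] with z hz
      rw [hz]
      by_cases h : z.2 < k <;> simp [h]
    · filter_upwards [ae_state_iff.1 (cut_ae (hJ k) g)] with z hz
      rw [hz]
      by_cases h : z.2 < k <;> simp [h]
  · intro k
    obtain ⟨C, -, hC⟩ := ha.exists_bound k
    refine ⟨C, ?_⟩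
    filter_upwards [ae_state_iff.2 hC] with z hz (hzk : z.2 < k) using hz hzk.le
  · intro h hh
    rw [← Lp.coeFn_nonneg] at hh ⊢
    refine ae_state_iff.2 ?_
    filter_upwards [hB h, gainFun_nonneg hΩ hb (ae_state_iff.1 hh)] with z e1 e2
    rw [e1]
    exact e2
  · intro k h
    apply Lp.ext
    filter_upwards [cut_ae (hJ k) (B (cut {z | z.2 < (k : ℝ)} h)),
      ae_state_iff.2 (hB (cut {z | z.2 < (k : ℝ)} h)),
      ae_state_iff.2 (gainFun_congr (b := b) (ae_state_iff.1 (cut_ae (hJ k) h)))] with z e1 e2 e3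
    rw [e1]
    by_cases hz : z.2 < k
    · simp [hz]
    -- A particle of size at least $k$ could only come from a larger parent, and those have been cut
    -- away.
    · rw [e2, e3, indicator_of_notMem (show z ∉ {z | z.2 < (k : ℝ)} from hz), gainFun,
        setIntegral_eq_zero_of_forall_eq_zero]
      intro s (hs : z.2 < s)
      rw [indicator_of_notMem, mul_zero]
      exact fun h : s < k => hz (hs.trans h)
  · intro u h hu hh
    set w : EuclideanSpace ℝ (Fin N) × ℝ → ℝ≥0∞ := fun z => ENNReal.ofReal (1 + z.2 ^ q) with hw
    -- Sharp factor $c$ everywhere, plus the crude factor $2b_0+1$ below $s_0$; there $|h|=a|u|\le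
    -- A|u|$, so the second part costs only a multiple of $\|u\|$.
    set κ : EuclideanSpace ℝ (Fin N) × ℝ → ℝ≥0∞ := fun z => ENNReal.ofReal c * w z +
      {z : EuclideanSpace ℝ (Fin N) × ℝ | z.2 < s₀}.indicator
        (fun z => ENNReal.ofReal (2 * b₀ + 1) * w z) z with hκ
    have h1 : ∀ᵐ z ∂baseMeasure Ω,
        kernelMoment b 0 z.1 z.2 + kernelMoment b q z.1 z.2 ≤ κ z := by
      filter_upwards [hs₀, hb.moments_le hΩ hq] with z e1 e2
      by_cases hz : z.2 < s₀
      · refine e2.trans ?_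
        rw [ENNReal.ofReal_mul (by linarith), hκ]
        simp only [mem_ofPred_eq, hz, indicator_of_mem]
        exact le_add_self
      · refine (e1 (not_lt.1 hz)).trans ?_
        rw [ENNReal.ofReal_mul hc0]
        exact le_self_add
    have h2 : ∫⁻ z, κ z * ‖h z‖ₑ ∂baseMeasure Ω ≤ ∫⁻ z, (ENNReal.ofReal c * (w z * ‖h z‖ₑ) +
        ENNReal.ofReal ((2 * b₀ + 1) * A) * (w z * ‖u z‖ₑ)) ∂baseMeasure Ω := by
      refine lintegral_mono_ae ?_
      filter_upwards [hA, ha.nonneg, ae_state_iff.1 hh] with z e1 e2 e3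
      rw [hκ]
      simp only
      rw [add_mul, mul_assoc]
      refine add_le_add_right ?_ _
      by_cases hz : z.2 < s₀
      · rw [indicator_of_mem (show z ∈ {z | z.2 < s₀} from hz), e3, enorm_mul,
          ENNReal.ofReal_mul (by linarith)]
        calc ENNReal.ofReal (2 * b₀ + 1) * w z * (‖a z.1 z.2‖ₑ * ‖u z‖ₑ)
            ≤ ENNReal.ofReal (2 * b₀ + 1) * w z * (ENNReal.ofReal A * ‖u z‖ₑ) := by
              rw [Real.enorm_of_nonneg e2]
              gcongr
              exact e1 hz.le
          _ = _ := by ring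
      · rw [indicator_of_notMem (show z ∉ {z | z.2 < s₀} from hz), zero_mul]
        exact zero_le
    have hwm : Measurable w := measurable_weight q
    have hm : ∀ v : StateSpace Ω q, Measurable fun z => w z * ‖v z‖ₑ := fun v =>
      hwm.mul (Lp.stronglyMeasurable v).measurable.enorm
    rw [lintegral_add_left ((hm h).const_mul _), lintegral_const_mul _ (hm h),
      lintegral_const_mul _ (hm u), ← ofReal_norm_state, ← ofReal_norm_state,
      ← ENNReal.ofReal_mul hc0, ← ENNReal.ofReal_mul hω,
      ← ENNReal.ofReal_add (by positivity) (by positivity)] at h2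
    have h3 := (ENNReal.ofReal_le_ofReal_iff (by positivity)).1 ((hBκ h κ h1).trans h2)
    linarith

end Operator

/-! ### Smoothing -/

section Smoothing

/-- A uniform estimate of `B` through `ι` lifts `A` through `ι` if `ι` has dense range. -/
theorem exists_lift_of_denseRange {X Y : Type*} [NormedAddCommGroup X] [NormedSpace ℝ X]
    [CompleteSpace X] [NormedAddCommGroup Y] [NormedSpace ℝ Y] {ι : X →L[ℝ] Y}
    (hι : DenseRange ι) {A : Y →L[ℝ] Y} {B : X →L[ℝ] X} (hAB : ∀ w, ι (B w) = A (ι w)) {C : ℝ}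
    (hC : ∀ w, ‖B w‖ ≤ C * ‖ι w‖) (u : Y) : ∃ y, ι y = A u ∧ ‖y‖ ≤ C * ‖u‖ := by
  obtain ⟨v, hv, hvu⟩ := mem_closure_iff_seq_limit.1 (hι u)
  choose w hw using hv
  obtain rfl : v = fun k => ι (w k) := funext fun k => (hw k).symm
  have hcau : CauchySeq fun k => B (w k) := by
    have h1 : CauchySeq fun k => C • ι (w k) := (hvu.const_smul C).cauchySeq
    rw [Metric.cauchySeq_iff] at h1 ⊢
    intro ε hε
    obtain ⟨K, hK⟩ := h1 ε hε
    refine ⟨K, fun m hm n hn => lt_of_le_of_lt ?_ (hK m hm n hn)⟩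
    rw [dist_eq_norm, dist_eq_norm, ← map_sub, ← smul_sub, ← map_sub, norm_smul]
    exact (hC _).trans (by gcongr; exact le_abs_self C)
  obtain ⟨y, hy⟩ := cauchySeq_tendsto_of_complete hcau
  refine ⟨y, tendsto_nhds_unique ((ι.continuous.tendsto y).comp hy) ?_,
    le_of_tendsto_of_tendsto hy.norm (hvu.norm.const_mul C) (Eventually.of_forall fun k => hC _)⟩
  simp only [Function.comp_def, hAB]
  exact (A.continuous.tendsto u).comp hvu

/-- Trading time against moments: for large sizes the loss absorbs the growth of the weight. -/
theorem exists_weight_le {δ a₀ γ m₀ ε β p r : ℝ} (hδ : 0 < δ) (ha₀ : 0 < a₀) (hm₀ : 1 ≤ m₀)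
    (hβ : 0 < β) (hεβ : ε ≤ β) (hr : 0 ≤ r) (hβε : γ * (β - ε) = r - p) :
    ∃ C, 0 ≤ C ∧ ∀ t, 0 < t → t ≤ 1 → ∀ m, 0 ≤ m → ∀ A, 0 ≤ A → (m₀ ≤ m → a₀ * m ^ γ ≤ A) →
      β * t ^ (β - 1) * (1 + m ^ r) ≤
        δ * t ^ β * (A * (1 + m ^ r)) + C * t ^ (ε - 1) * (1 + m ^ p) := by
  -- The threshold for $tm^\gamma$ above which $\delta t a\ge\beta$, that is, the loss alone
  -- dominates.
  set κ := β / (δ * a₀) with hκ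
  have hκ0 : 0 < κ := by positivity
  have hC1 : 0 ≤ β * (1 + m₀ ^ r) := by positivity
  have hC2 : 0 ≤ 2 * β * κ ^ (β - ε) := by positivity
  refine ⟨β * (1 + m₀ ^ r) + 2 * β * κ ^ (β - ε), by positivity, fun t ht ht1 m hm A hA hmA => ?_⟩
  have hw : 1 ≤ 1 + m ^ p := one_le_weight hm p
  have hwr : 0 < 1 + m ^ r := weight_pos hm r
  have htε : 0 < t ^ (ε - 1) := Real.rpow_pos_of_pos ht _
  have htβ : 0 < t ^ β := Real.rpow_pos_of_pos ht _
  have hloss : 0 ≤ δ * t ^ β * (A * (1 + m ^ r)) := by positivity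
  rcases lt_or_ge m m₀ with hmm | hmm
  · have h1 : t ^ (β - 1) ≤ t ^ (ε - 1) :=
      Real.rpow_le_rpow_of_exponent_ge ht ht1 (by linarith)
    have h2 : m ^ r ≤ m₀ ^ r := Real.rpow_le_rpow hm hmm.le hr
    calc β * t ^ (β - 1) * (1 + m ^ r) ≤ β * t ^ (ε - 1) * (1 + m₀ ^ r) * 1 := by
          rw [mul_one]; gcongr
      _ ≤ β * t ^ (ε - 1) * (1 + m₀ ^ r) * (1 + m ^ p) := by gcongr
      _ = β * (1 + m₀ ^ r) * (t ^ (ε - 1) * (1 + m ^ p)) := by ring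
      _ ≤ (β * (1 + m₀ ^ r) + 2 * β * κ ^ (β - ε)) * (t ^ (ε - 1) * (1 + m ^ p)) := by
          gcongr
          linarith
      _ ≤ _ := by rw [← mul_assoc]; linarith
  · have hm1 : 1 ≤ m := hm₀.trans hmm
    have hm0 : 0 < m := by linarith
    have hgr : 0 ≤ (β * (1 + m₀ ^ r) + 2 * β * κ ^ (β - ε)) * t ^ (ε - 1) * (1 + m ^ p) := by
      positivity
    have htt : t ^ β = t * t ^ (β - 1) := by
      rw [← Real.rpow_one_add' ht.le (by linarith)]
      congr 1
      ring
    rcases le_or_gt κ (t * m ^ γ) with hc | hc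
    · have h1 : β ≤ δ * t * A := by
        rw [hκ, div_le_iff₀ (by positivity)] at hc
        calc β ≤ t * m ^ γ * (δ * a₀) := hc
          _ = δ * t * (a₀ * m ^ γ) := by ring
          _ ≤ δ * t * A := by gcongr; exact hmA hmm
      calc β * t ^ (β - 1) * (1 + m ^ r) ≤ δ * t * A * t ^ (β - 1) * (1 + m ^ r) := by gcongr
        _ = δ * t ^ β * (A * (1 + m ^ r)) := by rw [htt]; ring
        _ ≤ _ := by linarith
    -- Below the threshold, $t^{\beta-1}m^r=(tm^\gamma)^{\beta-\varepsilon}\,t^{\varepsilon-1}m^p$,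
    -- because $\gamma(\beta-\varepsilon)=r-p$; the first factor is at most
    -- $\kappa^{\beta-\varepsilon}$.
    · have h1 : 1 ≤ m ^ r := Real.one_le_rpow hm1 hr
      have h2 : t ^ (β - 1) * m ^ r = (t * m ^ γ) ^ (β - ε) * (t ^ (ε - 1) * m ^ p) := by
        rw [Real.mul_rpow ht.le (by positivity), ← Real.rpow_mul hm, hβε,
          show β - 1 = (β - ε) + (ε - 1) by ring, Real.rpow_add ht,
          show m ^ r = m ^ (r - p) * m ^ p by rw [← Real.rpow_add hm0]; congr 1; ring]
        ring
      have h3 : (t * m ^ γ) ^ (β - ε) ≤ κ ^ (β - ε) :=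
        Real.rpow_le_rpow (by positivity) hc.le (by linarith)
      calc β * t ^ (β - 1) * (1 + m ^ r) ≤ β * t ^ (β - 1) * (m ^ r + m ^ r) := by gcongr
        _ = 2 * β * (t ^ (β - 1) * m ^ r) := by ring
        _ ≤ 2 * β * (κ ^ (β - ε) * (t ^ (ε - 1) * m ^ p)) := by
            rw [h2]; gcongr
        _ = 2 * β * κ ^ (β - ε) * (t ^ (ε - 1) * m ^ p) := by ring
        _ ≤ (β * (1 + m₀ ^ r) + 2 * β * κ ^ (β - ε)) * (t ^ (ε - 1) * (1 + m ^ p)) := by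
            gcongr <;> linarith
        _ ≤ _ := by rw [← mul_assoc]; linarith

/-- The integral form of a differential inequality with a singular right-hand side. -/
theorem rpow_mul_le_of_deriv_le {φ φ' : ℝ → ℝ} {ω β ε D : ℝ} (hβ : 0 < β) (hε : 0 < ε)
    (hω : 0 ≤ ω) (hD : 0 ≤ D) (hφ : Continuous φ)
    (hφ' : ∀ t, 0 ≤ t → HasDerivWithinAt φ (φ' t) (Ici t) t)
    (h : ∀ t, 0 < t → t ≤ 1 →
      t ^ β * (φ' t - ω * φ t) + β * t ^ (β - 1) * φ t ≤ D * t ^ (ε - 1))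
    {t : ℝ} (ht : 0 < t) (ht1 : t ≤ 1) : Real.exp (-(ω * t)) * (t ^ β * φ t) ≤ D / ε * t ^ ε := by
  set Φ : ℝ → ℝ := fun s => Real.exp (-(ω * s)) * (s ^ β * φ s) with hΦ
  have hβc : Continuous fun s : ℝ => s ^ β := Real.continuous_rpow_const hβ.le
  have hΦc : Continuous Φ := by fun_prop
  have hεc : Continuous fun s : ℝ => s ^ ε := Real.continuous_rpow_const hε.le
  -- The powers $s^{\beta-1}$ and $s^{\varepsilon-1}$ may blow up at $0$, so the comparison starts
  -- at $\tau>0$ and $\tau\to0$ afterwards; the boundary terms vanish since $\beta,\varepsilon>0$.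
  have key : ∀ τ, 0 < τ → τ ≤ t → Φ t ≤ Φ τ + D / ε * (t ^ ε - τ ^ ε) := by
    intro τ hτ hτt
    refine image_le_of_deriv_right_le_deriv_boundary (a := τ) (b := t) (f := Φ)
      (f' := fun s => Real.exp (-(ω * s)) *
        (s ^ β * (φ' s - ω * φ s) + β * s ^ (β - 1) * φ s))
      (B := fun s => Φ τ + D / ε * (s ^ ε - τ ^ ε)) (B' := fun s => D * s ^ (ε - 1))
      hΦc.continuousOn ?_ (by simp) (by fun_prop) ?_ ?_ (right_mem_Icc.2 hτt)
    · intro s hs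
      have hs0 : 0 < s := hτ.trans_le hs.1
      have h1 : HasDerivWithinAt (fun s => Real.exp (-(ω * s))) (Real.exp (-(ω * s)) * -(ω * 1))
          (Ici s) s := ((hasDerivAt_id s).const_mul ω).neg.exp.hasDerivWithinAt
      have h2 : HasDerivWithinAt (fun s : ℝ => s ^ β) (β * s ^ (β - 1)) (Ici s) s :=
        (Real.hasDerivAt_rpow_const (Or.inl hs0.ne')).hasDerivWithinAt
      convert! h1.mul (h2.mul (hφ' s hs0.le)) using 1
      simp only [Pi.mul_apply]
      ring
    · intro s hs
      have hs0 : 0 < s := hτ.trans_le hs.1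
      have h2 : HasDerivAt (fun s : ℝ => s ^ ε) (ε * s ^ (ε - 1)) s :=
        Real.hasDerivAt_rpow_const (Or.inl hs0.ne')
      have h3 := (((h2.sub_const (τ ^ ε)).const_mul (D / ε)).const_add (Φ τ)).hasDerivWithinAt
        (s := Ici s)
      convert! h3 using 1
      field_simp
    · intro s hs
      have hs0 : 0 < s := hτ.trans_le hs.1
      have h1 := h s hs0 (hs.2.le.trans ht1)
      have h2 : Real.exp (-(ω * s)) ≤ 1 := Real.exp_le_one_iff.2 (by nlinarith)
      have h3 : 0 ≤ D * s ^ (ε - 1) := by positivity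
      calc Real.exp (-(ω * s)) * (s ^ β * (φ' s - ω * φ s) + β * s ^ (β - 1) * φ s)
          ≤ Real.exp (-(ω * s)) * (D * s ^ (ε - 1)) := by gcongr
        _ ≤ 1 * (D * s ^ (ε - 1)) := by gcongr
        _ = _ := one_mul _
  have hlim : Tendsto (fun τ => Φ τ + D / ε * (t ^ ε - τ ^ ε)) (𝓝[>] 0)
      (𝓝 (Φ 0 + D / ε * (t ^ ε - 0 ^ ε))) :=
    ((by fun_prop : Continuous fun τ => Φ τ + D / ε * (t ^ ε - τ ^ ε)).tendsto 0).mono_left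
      nhdsWithin_le_nhds
  have h0 : Φ 0 + D / ε * (t ^ ε - 0 ^ ε) = D / ε * t ^ ε := by
    simp [hΦ, Real.zero_rpow hβ.ne', Real.zero_rpow hε.ne']
  rw [h0] at hlim
  refine ge_of_tendsto hlim ?_
  filter_upwards [Ioc_mem_nhdsGT ht] with τ hτ using key τ hτ.1 hτ.2

variable {N : ℕ} {Ω : Set (EuclideanSpace ℝ (Fin N))} {T₀ : ℝ → SpaceL1 Ω →ₗ.[ℝ] SpaceL1 Ω}
  {a : EuclideanSpace ℝ (Fin N) → ℝ → ℝ} {α₁ α₂ : ℝ → ℝ} {M : ℝ}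
  {b : EuclideanSpace ℝ (Fin N) → ℝ → ℝ → ℝ} {b₀ l : ℝ}

theorem one_add_rpow_le {m p r : ℝ} (hm : 0 ≤ m) (hp : 0 ≤ p) (hpr : p ≤ r) :
    1 + m ^ p ≤ 2 * (1 + m ^ r) := by
  have h0 : 0 ≤ m ^ r := Real.rpow_nonneg hm r
  rcases le_total m 1 with h | h
  · have := Real.rpow_le_one hm h hp
    linarith
  · have := Real.rpow_le_rpow_of_exponent_le h hpr
    linarith

/-- The inclusion of the state spaces. -/
theorem exists_inclusion (Ω : Set (EuclideanSpace ℝ (Fin N))) {p r : ℝ} (hp : 0 ≤ p)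
    (hpr : p ≤ r) : ∃ ι : StateSpace Ω r →L[ℝ] StateSpace Ω p,
      (∀ u, ι u =ᵐ[baseMeasure Ω] u) ∧ DenseRange ι := by
  obtain ⟨ι, hι, -⟩ := exists_weight_clm (Ω := Ω) (p := r) (q := p) (fun _ => 1) measurable_const 2
    zero_le_two (fun m hm => by simpa using one_add_rpow_le hm hp hpr)
  simp only [one_mul] at hι
  refine ⟨ι, hι, fun u => ?_⟩
  have hJ : ∀ k : ℕ, MeasurableSet {z : EuclideanSpace ℝ (Fin N) × ℝ | z.2 < k} := fun k =>
    measurableSet_lt measurable_snd measurable_const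
  refine mem_closure_of_tendsto (tendsto_cut (μ := stateMeasure Ω p) hJ ?_
    (Eventually.of_forall fun z => exists_nat_gt z.2) u) (Eventually.of_forall fun k => ?_)
  · intro j k hjk z (hz : z.2 < j)
    exact hz.trans_le (by exact_mod_cast hjk)
  -- On sizes below $k$ the weight $1+m^r$ is bounded, so truncations of elements of $\mathcal
  -- X^1_p$ lie in $\mathcal X^1_r$.
  · obtain ⟨L, hL, -⟩ := exists_weight_clm (Ω := Ω) (p := p) (q := r)
      ((Iio (k : ℝ)).indicator 1) (measurable_one.indicator measurableSet_Iio) (1 + (k : ℝ) ^ r)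
      (by positivity) (fun m hm => by
        have h1 : 1 ≤ 1 + m ^ p := one_le_weight hm p
        by_cases h : m < k
        · have h2 : m ^ r ≤ (k : ℝ) ^ r := Real.rpow_le_rpow hm h.le (hp.trans hpr)
          simp only [mem_Iio, h, indicator_of_mem, Pi.one_apply, abs_one, one_mul]
          calc 1 + m ^ r ≤ (1 + (k : ℝ) ^ r) * 1 := by linarith
            _ ≤ _ := by gcongr
        · simp only [mem_Iio, h, not_false_eq_true, indicator_of_notMem, abs_zero, zero_mul]
          positivity)
    refine ⟨L u, Lp.ext (ae_state_iff.2 ?_)⟩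
    filter_upwards [hι (L u), hL u, ae_state_iff.1 (cut_ae (hJ k) u)] with z e1 e2 e3
    rw [e1, e2, e3]
    by_cases h : z.2 < k <;> simp [h]

theorem LossGainGraph.map_inclusion {p r : ℝ} {ι : StateSpace Ω r →L[ℝ] StateSpace Ω p}
    (hι : ∀ u, ι u =ᵐ[baseMeasure Ω] u) {B : StateSpace Ω r →L[ℝ] StateSpace Ω r}
    {B' : StateSpace Ω p →L[ℝ] StateSpace Ω p} (hB : ∀ h, B h =ᵐ[baseMeasure Ω] gainFun b h)
    (hB' : ∀ h, B' h =ᵐ[baseMeasure Ω] gainFun b h) {u f : StateSpace Ω r}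
    (h : LossGainGraph (TransportGraph T₀ r) (fun z => a z.1 z.2) B u f) :
    LossGainGraph (TransportGraph T₀ p) (fun z => a z.1 z.2) B' (ι u) (ι f) := by
  obtain ⟨g, h, hg, hh, rfl⟩ := h
  refine ⟨ι g, ι h, hg.mul (fun _ => 1) (by simpa using hι u) (by simpa using hι g), ?_, ?_⟩
  · refine ae_state_iff.2 ?_
    filter_upwards [hι h, hι u, ae_state_iff.1 hh] with z e1 e2 e3
    rw [e1, e2, e3]
  · have h1 : ι (B h) = B' (ι h) := by
      refine Lp.ext (ae_state_iff.2 ?_)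
      filter_upwards [hι (B h), hB h, hB' (ι h), gainFun_congr (b := b) (hι h)] with z e1 e2 e3 e4
      rw [e1, e2, e3, e4]
    rw [map_add, map_sub, h1]

/-- The image under $\iota$ of an orbit in the domain solves the second Cauchy problem, whose
solutions are unique; density of the domain does the rest. Thus the semigroup in $\mathcal X^1_r$ is
the restriction of the one in $\mathcal X^1_p$. -/
theorem Generates.map_op {X Y : Type*} [NormedAddCommGroup X] [NormedSpace ℝ X] [CompleteSpace X]
    [NormedAddCommGroup Y] [NormedSpace ℝ Y] [CompleteSpace Y] {R : X → X → Prop}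
    {S : C0Semigroup X} {R' : Y → Y → Prop} {S' : C0Semigroup Y} (h : Generates R S)
    (h' : Generates R' S') (ι : X →L[ℝ] Y) (hι : ∀ {u f}, R u f → R' (ι u) (ι f)) (t : ℝ≥0)
    (u : X) : ι (S.op t u) = S'.op t (ι u) := by
  have key : EqOn (fun u => ι (S.op t u)) (fun u => S'.op t (ι u)) {u | ∃ f, R u f} := by
    rintro u ⟨f, huf⟩
    have := h'.eq_op t (v := fun s => ι (S.orbit u s))
      (ι.continuous.comp (S.continuous_orbit u)).continuousOn fun x hx =>
        ⟨_, hι (h.orbit_mem huf hx.1),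
          ι.hasFDerivAt.comp_hasDerivWithinAt x (h.hasDerivWithinAt huf hx.1)⟩
    simpa [C0Semigroup.orbit_coe, C0Semigroup.orbit_zero] using this
  exact congrFun (Continuous.ext_on h.dense (by fun_prop) (by fun_prop) key) u

/-- Integration of a pointwise inequality of weights against $|v|$, where $y$ is $v$ itself viewed
in the larger space and $h$ is its loss. -/
theorem norm_le_of_weight_le {p r A A' C : ℝ} (hA : 0 ≤ A) (hA' : 0 ≤ A') (hC : 0 ≤ C)
    (hΩa : ∀ᵐ z ∂baseMeasure Ω, 0 ≤ a z.1 z.2)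
    (hw : ∀ᵐ z ∂baseMeasure Ω,
      A * (1 + z.2 ^ r) ≤ A' * (a z.1 z.2 * (1 + z.2 ^ r)) + C * (1 + z.2 ^ p))
    {v h : StateSpace Ω r} {y : StateSpace Ω p} (hh : h =ᵐ[baseMeasure Ω] fun z => a z.1 z.2 * v z)
    (hy : y =ᵐ[baseMeasure Ω] v) : A * ‖v‖ ≤ A' * ‖h‖ + C * ‖y‖ := by
  have hm : ∀ {q : ℝ} (v : StateSpace Ω q),
      Measurable fun z => ENNReal.ofReal (1 + z.2 ^ q) * ‖v z‖ₑ := fun {q} v =>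
    (measurable_weight q).mul (Lp.stronglyMeasurable v).measurable.enorm
  rw [← ENNReal.ofReal_le_ofReal_iff (by positivity), ENNReal.ofReal_mul hA,
    ENNReal.ofReal_add (by positivity) (by positivity), ENNReal.ofReal_mul hA',
    ENNReal.ofReal_mul hC, ofReal_norm_state, ofReal_norm_state, ofReal_norm_state,
    ← lintegral_const_mul _ (hm v), ← lintegral_const_mul _ (hm h), ← lintegral_const_mul _ (hm y),
    ← lintegral_add_left ((hm h).const_mul _)]
  refine lintegral_mono_ae ?_
  filter_upwards [hΩa, hw, hh, hy, ae_base_snd_nonneg] with z e1 e2 e3 e4 e5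
  have hr := (weight_pos e5 r).le
  have hp := (weight_pos e5 p).le
  rw [e3, e4, enorm_mul, Real.enorm_of_nonneg e1]
  calc ENNReal.ofReal A * (ENNReal.ofReal (1 + z.2 ^ r) * ‖v z‖ₑ)
      = ENNReal.ofReal (A * (1 + z.2 ^ r)) * ‖v z‖ₑ := by rw [ENNReal.ofReal_mul hA, mul_assoc]
    _ ≤ ENNReal.ofReal (A' * (a z.1 z.2 * (1 + z.2 ^ r)) + C * (1 + z.2 ^ p)) * ‖v z‖ₑ := by
        gcongr
    _ = _ := by
        rw [ENNReal.ofReal_add (by positivity) (by positivity), ENNReal.ofReal_mul hA',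
          ENNReal.ofReal_mul e1, ENNReal.ofReal_mul hC]
        ring

/-- Moment regularization of nonnegative states. -/
theorem LossGainAssumption.rpow_mul_norm_op_le {p r : ℝ}
    {T : StateSpace Ω r → StateSpace Ω r → Prop}
    {S : C0Semigroup (StateSpace Ω r)} {B : StateSpace Ω r →L[ℝ] StateSpace Ω r}
    {J : ℕ → Set (EuclideanSpace ℝ (Fin N) × ℝ)} {δ ω : ℝ}
    (H : LossGainAssumption T S (fun z => a z.1 z.2) B J δ ω)
    {G : C0Semigroup (StateSpace Ω r)}
    (hG : Generates (LossGainGraph T (fun z => a z.1 z.2) B) G)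
    (hpos : ∀ t u, 0 ≤ u → 0 ≤ G.op t u) {ι : StateSpace Ω r →L[ℝ] StateSpace Ω p}
    (hι : ∀ u, ι u =ᵐ[baseMeasure Ω] u) {K : ℝ} (hK0 : 0 ≤ K)
    (hK : ∀ t ≤ 1, ∀ u, ‖ι (G.op t u)‖ ≤ K * ‖ι u‖) {β ε C : ℝ} (hβ : 0 < β) (hε : 0 < ε)
    (hC : 0 ≤ C)
    (hw : ∀ t, 0 < t → t ≤ 1 → ∀ᵐ z ∂baseMeasure Ω, β * t ^ (β - 1) * (1 + z.2 ^ r) ≤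
      δ * t ^ β * (a z.1 z.2 * (1 + z.2 ^ r)) + C * t ^ (ε - 1) * (1 + z.2 ^ p))
    {t : ℝ≥0} (ht : 0 < t) (ht1 : t ≤ 1) {u : StateSpace Ω r} (hu : 0 ≤ u) :
    Real.exp (-(ω * t)) * ((t : ℝ) ^ β * ‖G.op t u‖) ≤ C * (K * ‖ι u‖) / ε * (t : ℝ) ^ ε := by
  have hcl : IsClosed {u : StateSpace Ω r | 0 ≤ u} := isClosed_nonneg
  have hconv : Convex ℝ {u : StateSpace Ω r | 0 ≤ u} := by
    intro x (hx : 0 ≤ x) y (hy : 0 ≤ y) c d hc hd _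
    change 0 ≤ c • x + d • y
    rw [← Lp.coeFn_nonneg] at hx hy ⊢
    filter_upwards [hx, hy, Lp.coeFn_add (c • x) (d • y), Lp.coeFn_smul c x, Lp.coeFn_smul d y]
      with z e1 e2 e3 e4 e5
    rw [e3, Pi.add_apply, e4, e5, Pi.smul_apply, Pi.smul_apply, smul_eq_mul, smul_eq_mul]
    exact add_nonneg (mul_nonneg hc e1) (mul_nonneg hd e2)
  have hmem := hG.mem_closure_inter hcl hconv (f := u) fun t => hpos t u hu
  -- Both sides are continuous in $u$, and nonnegative elements of the domain are dense in the cone,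
  -- so $u$ may be taken in the domain.
  refine closure_minimal (t := {u : StateSpace Ω r | Real.exp (-(ω * t)) * ((t : ℝ) ^ β *
    ‖G.op t u‖) ≤ C * (K * ‖ι u‖) / ε * (t : ℝ) ^ ε}) ?_
    (isClosed_le (by fun_prop) (by fun_prop)) hmem
  rintro u ⟨⟨f, huf⟩, hu : 0 ≤ u⟩
  have hpos' : ∀ s, 0 ≤ G.orbit u s := fun s => hpos _ _ hu
  have hD : 0 ≤ C * (K * ‖ι u‖) := by positivity
  -- The mass functional replaces the norm: it is linear, hence differentiable along the orbit, and
  -- agrees with the norm there by positivity.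
  have h1 := rpow_mul_le_of_deriv_le (φ := fun s => totalMass (stateMeasure Ω r) (G.orbit u s))
    (φ' := fun s => totalMass (stateMeasure Ω r) (G.orbit f s)) (t := t) hβ hε H.omega_nonneg hD
    ((totalMass _).continuous.comp (G.continuous_orbit u))
    (fun s hs => (totalMass _).hasFDerivAt.comp_hasDerivWithinAt s (hG.hasDerivWithinAt huf hs))
    (fun s hs hs1 => ?_) ht ht1
  · have h2 := totalMass_of_nonneg (hpos' t)
    rw [C0Semigroup.orbit_coe] at h2
    simp only [C0Semigroup.orbit_coe, h2] at h1
    exact h1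
  · obtain ⟨g, h, hg, hh, hf⟩ := hG.orbit_mem huf hs.le
    have h2 := H.totalMass_le_of_nonneg (hpos' s) hg hh
    have hδ := H.delta_pos.le
    have hsβ : 0 ≤ s ^ β := Real.rpow_nonneg hs.le _
    have hsε : 0 ≤ s ^ (ε - 1) := Real.rpow_nonneg hs.le _
    have hsβ' : 0 ≤ s ^ (β - 1) := Real.rpow_nonneg hs.le _
    have h3 := norm_le_of_weight_le (p := p) (r := r) (A := β * s ^ (β - 1)) (A' := δ * s ^ β)
      (C := C * s ^ (ε - 1)) (by positivity) (by positivity) (by positivity)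
      (ae_state_iff.1 H.rate_nonneg) (hw s hs hs1) (ae_state_iff.1 hh) (hι (G.orbit u s))
    have h4 : ‖ι (G.orbit u s)‖ ≤ K * ‖ι u‖ := hK _ (Real.toNNReal_le_one.2 hs1) u
    simp only [totalMass_of_nonneg (hpos' s), hf]
    calc s ^ β * (totalMass (stateMeasure Ω r) (g - h + B h) - ω * ‖G.orbit u s‖) +
          β * s ^ (β - 1) * ‖G.orbit u s‖
        ≤ s ^ β * (-(δ * ‖h‖)) + (δ * s ^ β * ‖h‖ + C * s ^ (ε - 1) * (K * ‖ι u‖)) := by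
          gcongr
          · linarith
          · exact h3.trans (by gcongr)
      _ = C * (K * ‖ι u‖) * s ^ (ε - 1) := by ring

/-- Splitting into positive and negative parts, each with norm in $\mathcal X^1_p$ at most that of
$u$; this accounts for the factor $2$. -/
theorem norm_op_le_of_nonneg {p r : ℝ} {ι : StateSpace Ω r →L[ℝ] StateSpace Ω p}
    (hι : ∀ u, ι u =ᵐ[baseMeasure Ω] u) {A : StateSpace Ω r →L[ℝ] StateSpace Ω r} {C : ℝ}
    (hC : 0 ≤ C) (hA : ∀ u, 0 ≤ u → ‖A u‖ ≤ C * ‖ι u‖) (u : StateSpace Ω r) :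
    ‖A u‖ ≤ 2 * C * ‖ι u‖ := by
  have key : ∀ v : StateSpace Ω r, ‖ι v⁺‖ ≤ ‖ι v‖ := by
    intro v
    refine Lp.norm_le_norm_of_ae_le (ae_state_iff.2 ?_)
    filter_upwards [hι v, hι v⁺, ae_state_iff.1 (coeFn_posPart_ae v)] with z e1 e2 e3
    rw [e1, e2, e3, Real.norm_eq_abs, Real.norm_eq_abs, abs_of_nonneg (le_max_right _ _)]
    exact max_le (le_abs_self _) (abs_nonneg _)
  have h1 := (hA _ (posPart_nonneg u)).trans (mul_le_mul_of_nonneg_left (key u) hC)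
  have h2 := (hA _ (posPart_nonneg (-u))).trans (mul_le_mul_of_nonneg_left (key (-u)) hC)
  rw [map_neg ι, norm_neg] at h2
  have h3 : A u = A u⁺ - A (-u)⁺ := by rw [← map_sub, posPart_neg, posPart_sub_negPart]
  rw [h3]
  linarith [norm_sub_le (A u⁺) (A (-u)⁺)]

theorem Generates.op_eq {X : Type*} [NormedAddCommGroup X] [NormedSpace ℝ X]
    [CompleteSpace X] {R : X → X → Prop} {S S' : C0Semigroup X} (h : Generates R S)
    (h' : Generates R S') (t : ℝ≥0) : S'.op t = S.op t :=
  ContinuousLinearMap.ext fun u => (h'.map_op h (.id ℝ X) (fun h => h) t u)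

/-- Long times are reached by a bounded evolution followed by a unit time of smoothing. -/
theorem exists_lift_of_le_one {X Y : Type*} [NormedAddCommGroup X] [NormedSpace ℝ X]
    [NormedAddCommGroup Y] [NormedSpace ℝ Y] {ι : X →L[ℝ] Y} {G : C0Semigroup Y}
    {C ω β : ℝ} (hC : 0 ≤ C) (hω : 0 ≤ ω) (hβ : 0 ≤ β)
    (hGω : ∀ t : ℝ≥0, ‖G.op t‖ ≤ Real.exp (ω * t))
    (h : ∀ t : ℝ≥0, 0 < t → t ≤ 1 → ∀ u, ∃ y, ι y = G.op t u ∧ ‖y‖ ≤ C * (t : ℝ) ^ (-β) * ‖u‖)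
    {t : ℝ≥0} (ht : 0 < t) (u : Y) :
    ∃ y, ι y = G.op t u ∧ ‖y‖ ≤ C * Real.exp ((ω + β) * t) * (t : ℝ) ^ (-β) * ‖u‖ := by
  have ht' : (0 : ℝ) < t := ht
  rcases le_total t 1 with ht1 | ht1
  · obtain ⟨y, hy, hyn⟩ := h t ht ht1 u
    refine ⟨y, hy, hyn.trans ?_⟩
    have h1 : 1 ≤ Real.exp ((ω + β) * t) := Real.one_le_exp (by positivity)
    gcongr
    exact le_mul_of_one_le_right hC h1
  · obtain ⟨y, hy, hyn⟩ := h 1 one_pos le_rfl (G.op (t - 1) u)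
    refine ⟨y, ?_, hyn.trans ?_⟩
    · rw [hy, ← G.op_add_apply, add_tsub_cancel_of_le ht1]
    · have h1 : ‖G.op (t - 1) u‖ ≤ Real.exp (ω * t) * ‖u‖ := by
        refine (G.op (t - 1)).le_of_opNorm_le ((hGω _).trans (Real.exp_le_exp.2 ?_)) u
        gcongr
        exact tsub_le_self
      -- From $t\le e^t$: the factor $e^{\beta t}$ compensates the decay of $t^{-\beta}$ for
      -- $t\ge1$, so one formula covers all times.
      have h2 : 1 ≤ Real.exp (β * t) * (t : ℝ) ^ (-β) := by
        rw [Real.rpow_neg ht'.le, ← div_eq_mul_inv, one_le_div (by positivity), mul_comm,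
          Real.exp_mul]
        exact Real.rpow_le_rpow ht'.le (by linarith [Real.add_one_le_exp (t : ℝ)]) hβ
      rw [NNReal.coe_one, Real.one_rpow, mul_one]
      calc C * ‖G.op (t - 1) u‖ ≤ C * (Real.exp (ω * t) * ‖u‖) * 1 := by
            rw [mul_one]; gcongr
        _ ≤ C * (Real.exp (ω * t) * ‖u‖) * (Real.exp (β * t) * (t : ℝ) ^ (-β)) := by gcongr
        _ = _ := by
            rw [add_mul, Real.exp_add]
            ring

theorem RateAssumption.exists_weight_le (ha : RateAssumption Ω a α₁ α₂ M) {a₀ γ m₀ : ℝ}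
    (ha₀ : 0 < a₀) (hm₀ : 1 ≤ m₀) (hα₁ : ∀ᵐ m ∂sizeMeasure, m₀ ≤ m → a₀ * m ^ γ ≤ α₁ m)
    {δ ε β p r : ℝ} (hδ : 0 < δ) (hβ : 0 < β) (hεβ : ε ≤ β) (hr : 0 ≤ r)
    (hβε : γ * (β - ε) = r - p) :
    ∃ C, 0 ≤ C ∧ ∀ t, 0 < t → t ≤ 1 → ∀ᵐ z ∂baseMeasure Ω, β * t ^ (β - 1) * (1 + z.2 ^ r) ≤
      δ * t ^ β * (a z.1 z.2 * (1 + z.2 ^ r)) + C * t ^ (ε - 1) * (1 + z.2 ^ p) := by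
  obtain ⟨C, hC, h⟩ := TransportFragmentation.exists_weight_le hδ ha₀ hm₀ hβ hεβ hr hβε
  refine ⟨C, hC, fun t ht ht1 => ?_⟩
  filter_upwards [ae_base_snd_nonneg, ha.nonneg, ha.lower_le, ae_base_of_ae_size hα₁]
    with z e1 e2 e3 e4
  exact h t ht ht1 _ e1 _ e2 fun hm => (e4 hm).trans e3

/-- Smoothing for the transport–fragmentation semigroup at times at most one. -/
theorem exists_lift_op (hΩ : IsOpen Ω) (ha : RateAssumption Ω a α₁ α₂ M)
    (hb : KernelAssumption Ω b b₀ l) {ρ : ℝ} (hρ : 1 < ρ) (hbρ : MomentAssumption Ω b ρ)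
    (hT₀ : TransportAssumption Ω T₀ ρ) {a₀ γ m₀ : ℝ} (ha₀ : 0 < a₀) (hγ : 0 < γ) (hm₀ : 1 ≤ m₀)
    (hα₁ : ∀ᵐ m ∂sizeMeasure, m₀ ≤ m → a₀ * m ^ γ ≤ α₁ m) {n p r : ℝ} (hp : max 1 l < p)
    (hnp : n < p) (hpr : p < r) {G : C0Semigroup (StateSpace Ω p)}
    (hG : Generates (TransportFragmentationGraph T₀ a b p) G) {ω : ℝ} (hω : 0 ≤ ω)
    (hGω : ∀ t : ℝ≥0, ‖G.op t‖ ≤ Real.exp (ω * t)) {ι : StateSpace Ω r →L[ℝ] StateSpace Ω p}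
    (hι : ∀ u, ι u =ᵐ[baseMeasure Ω] u) (hιd : DenseRange ι) :
    ∃ C, 0 ≤ C ∧ ∀ t : ℝ≥0, 0 < t → t ≤ 1 → ∀ u,
      ∃ y, ι y = G.op t u ∧ ‖y‖ ≤ C * (t : ℝ) ^ (-((r - n) / γ)) * ‖u‖ := by
  have hr : max 1 l < r := hp.trans hpr
  have hr0 : 0 ≤ r := (zero_le_one.trans (le_max_left 1 l)).trans hr.le
  obtain ⟨S, B, δ, ω', hB, H⟩ := lossGainAssumption hΩ ha hb hρ hbρ hT₀ hr
  obtain ⟨-, B', -, -, hB', -⟩ := lossGainAssumption hΩ ha hb hρ hbρ hT₀ hp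
  obtain ⟨G', hG', -, hpos⟩ := H.exists_semigroup
  have hcomm : ∀ (t : ℝ≥0) u, ι (G'.op t u) = G.op t (ι u) := fun t u =>
    hG'.map_op hG ι (fun h =>
      (transportFragmentationGraph_iff hB' _ _).2 (h.map_inclusion hι hB hB')) t u
  set β := (r - n) / γ with hβ
  -- Chosen so that $\gamma(\beta-\varepsilon)=r-p$; positivity, needed for integrability of
  -- $t^{\varepsilon-1}$ at $0$, is $n<p$.
  set ε := (p - n) / γ with hε
  have hβ0 : 0 < β := div_pos (by linarith) hγ
  have hε0 : 0 < ε := div_pos (by linarith) hγ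
  have hεβ : ε ≤ β := by rw [hε, hβ]; gcongr
  obtain ⟨C, hC, hw⟩ := ha.exists_weight_le ha₀ hm₀ hα₁ (p := p) (r := r) H.delta_pos hβ0 hεβ hr0
    (by rw [hβ, hε]; field_simp; ring)
  have hK : ∀ t ≤ 1, ∀ u, ‖ι (G'.op t u)‖ ≤ Real.exp ω * ‖ι u‖ := by
    intro t ht u
    rw [hcomm]
    refine (G.op t).le_of_opNorm_le ((hGω t).trans (Real.exp_le_exp.2 ?_)) _
    exact mul_le_of_le_one_right hω ht
  have key : ∀ t : ℝ≥0, 0 < t → t ≤ 1 → ∀ u, 0 ≤ u →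
      ‖G'.op t u‖ ≤ Real.exp ω' * (C * Real.exp ω / ε) * (t : ℝ) ^ (-β) * ‖ι u‖ := by
    intro t ht ht1 u hu
    have ht' : (0 : ℝ) < t := ht
    have htβ : 0 < (t : ℝ) ^ β := Real.rpow_pos_of_pos ht' β
    have h1 := H.rpow_mul_norm_op_le hG' hpos hι (Real.exp_pos ω).le hK hβ0 hε0 hC hw ht ht1 hu
    -- The gained factor $t^\varepsilon$ is discarded, leaving the rate
    -- $t^{-\beta}=t^{(n-r)/\gamma}$.
    have h2 : (t : ℝ) ^ ε ≤ 1 := Real.rpow_le_one ht'.le ht1 hε0.le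
    have h3 : Real.exp (-ω') ≤ Real.exp (-(ω' * t)) :=
      Real.exp_le_exp.2 (neg_le_neg (mul_le_of_le_one_right H.omega_nonneg ht1))
    have h4 : Real.exp (-ω') * ((t : ℝ) ^ β * ‖G'.op t u‖) ≤ C * (Real.exp ω * ‖ι u‖) / ε :=
      calc _ ≤ Real.exp (-(ω' * t)) * ((t : ℝ) ^ β * ‖G'.op t u‖) := by gcongr
        _ ≤ _ := h1
        _ ≤ _ := mul_le_of_le_one_right (by positivity) h2
    rw [Real.exp_neg, inv_mul_le_iff₀ (Real.exp_pos _), ← le_div_iff₀' htβ] at h4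
    refine h4.trans_eq ?_
    rw [Real.rpow_neg ht'.le]
    ring
  refine ⟨2 * (Real.exp ω' * (C * Real.exp ω / ε)), by positivity, fun t ht ht1 u => ?_⟩
  refine exists_lift_of_denseRange hιd (hcomm t) (fun w => ?_) u
  rw [mul_assoc 2]
  exact norm_op_le_of_nonneg hι (by positivity) (key t ht ht1) w

end Smoothing

end TransportFragmentation

end

/-! ### Generation and smoothing for the transport–fragmentation operator -/

open TransportFragmentation in
theorem theorem3p2 {N : ℕ} {Ω : Set (EuclideanSpace ℝ (Fin N))} (hΩ : IsOpen Ω)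
    (T₀ : ℝ → SpaceL1 Ω →ₗ.[ℝ] SpaceL1 Ω)
    (a : EuclideanSpace ℝ (Fin N) → ℝ → ℝ) (α₁ α₂ : ℝ → ℝ) (M : ℝ)
    (ha : RateAssumption Ω a α₁ α₂ M)
    (b : EuclideanSpace ℝ (Fin N) → ℝ → ℝ → ℝ) (b₀ l : ℝ) (hb : KernelAssumption Ω b b₀ l)
    (ρ : ℝ) (hρ : max 1 l < ρ) (hbρ : MomentAssumption Ω b ρ)
    (hT₀ : TransportAssumption Ω T₀ ρ)
    (a₀ γ m₀ : ℝ) (ha₀ : 0 < a₀) (hγ : 0 < γ) (hm₀ : 1 ≤ m₀)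
    (hα₁ : ∀ᵐ m ∂sizeMeasure, m₀ ≤ m → a₀ * m ^ γ ≤ α₁ m)
    (n p r : ℝ) (hn : max 1 l < n) (hnp : n < p) (hpr : p < r) :
    (∃ G : C0Semigroup (StateSpace Ω p), Generates (TransportFragmentationGraph T₀ a b p) G ∧
      ∀ t u, 0 ≤ u → 0 ≤ G.op t u) ∧
    ∀ G : C0Semigroup (StateSpace Ω p), Generates (TransportFragmentationGraph T₀ a b p) G →
      ∃ C > 0, ∃ θ > 0, ∀ t : ℝ≥0, 0 < t → ∀ u : StateSpace Ω p,
        ∃ hu : MemLp (G.op t u) 1 (stateMeasure Ω r),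
          ‖hu.toLp (G.op t u)‖ ≤
            C * Real.exp (θ * t) * (t : ℝ) ^ ((n - r) / γ) * ‖u‖ := by
  have hρ1 : 1 < ρ := (le_max_left _ _).trans_lt hρ
  have hp : max 1 l < p := hn.trans hnp
  have hp0 : 0 ≤ p := (zero_le_one.trans (le_max_left 1 l)).trans hp.le
  obtain ⟨S, B, δ, ω, hB, H⟩ := lossGainAssumption hΩ ha hb hρ1 hbρ hT₀ hp
  obtain ⟨G, hG, hGω, hpos⟩ := H.exists_semigroup
  replace hG : Generates (TransportFragmentationGraph T₀ a b p) G := fun u f =>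
    (transportFragmentationGraph_iff hB u f).trans (hG u f)
  refine ⟨⟨G, hG, hpos⟩, fun G' hG' => ?_⟩
  obtain ⟨ι, hι, hιd⟩ := exists_inclusion Ω hp0 hpr.le
  have hω : 0 ≤ 2 * ω := mul_nonneg zero_le_two H.omega_nonneg
  have hGω' : ∀ t : ℝ≥0, ‖G'.op t‖ ≤ Real.exp (2 * ω * t) := fun t => by
    -- A generator determines its semigroup, so the growth bound of the constructed semigroup holds
    -- for any other one generated by the same operator.
    rw [Generates.op_eq hG hG' t]
    exact hGω t
  obtain ⟨C, hC, hlift⟩ := exists_lift_op hΩ ha hb hρ1 hbρ hT₀ ha₀ hγ hm₀ hα₁ hp hnp hpr hG' hω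
    hGω' hι hιd
  have hβ : 0 < (r - n) / γ := div_pos (by linarith) hγ
  -- Adding $1$ makes the constant strictly positive; the exponent is positive through
  -- $(r-n)/\gamma$ even when $\omega=0$.
  refine ⟨C + 1, by linarith, 2 * ω + (r - n) / γ, by linarith, fun t ht u => ?_⟩
  obtain ⟨y, hy, hyn⟩ := exists_lift_of_le_one hC hω hβ.le hGω' hlift ht u
  have hae : y =ᵐ[stateMeasure Ω r] G'.op t u := by
    have h1 := hι y
    rw [hy] at h1
    exact ae_state_iff.2 h1.symm
  refine ⟨(memLp_congr_ae hae).1 (Lp.memLp y), ?_⟩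
  have hLp : MemLp.toLp _ ((memLp_congr_ae hae).1 (Lp.memLp y)) = y :=
    Lp.ext ((MemLp.coeFn_toLp _).trans hae.symm)
  rw [hLp, show (n - r) / γ = -((r - n) / γ) by ring]
  refine hyn.trans ?_
  gcongr
  linarith
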